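/- **Setting.** Fix $L>0$, $\beta<0$ and $M\ge 0$. Let $W^{k,2}_{\mathrm{per}^\star}$ be the set of $u\in W^{k,2}_{\mathrm{loc}}(\mathbb R)$ with $u(x+L)-u(x)=-1$, let $W^{k,2}_{\mathrm{per}}$ be its $L$-periodic analogue, both normed by $\|u\|_{W^{k,2}}^2=\sum_{j\le k}\int_0^L|u^{(j)}|^2\,dx$, and let $(Hu)(x)=\frac1L\,\mathrm{PV}\!\int_0^L u(x-s)\cot\frac{\pi s}{L}\,ds$ be the $L$-periodic Hilbert transform. Consider $$h_t=\Bigl(-\tfrac{2\pi}{L}H(h_x)+\bigl(3h_x+\tfrac1{h_x}\bigr)h_{xx}\Bigr)_{xx}.\tag{1}$$ A strong solution of (1) on $[0,T]$ is a function $h$ with $h_x<0$ that satisfies (1) almost everywhere and $$h\in L^\infty([0,T];W^{7,2}_{\mathrm{per}^\star})\cap L^2([0,T];W^{9,2}_{\mathrm{per}^\star})\cap C([0,T];W^{3,2}_{\mathrm{per}^\star}),\qquad h_t\in L^\infty([0,T];W^{3,2}_{\mathrm{per}}).$$ Let $\phi(\cdot,t)$ be the inverse function of $h(\cdot,t)$,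 that is $h(\phi(\alpha,t),t)=\alpha$ for all $\alpha\in\mathbb R$. For $N\ge1$ put $a=1/N$, $\alpha_i=(N-i)/N$ and $\phi_i(t)=\phi(\alpha_i,t)$ for $i\in\mathbb Z$ (so $\phi_{i+N}=\phi_i+L$), and $$\bar f_i=-\frac2L\sum_{j\ne i}\frac{a}{\phi_j-\phi_i}+\Bigl(\frac1{\phi_{i+1}-\phi_i}-\frac1{\phi_i-\phi_{i-1}}\Bigr)+\Bigl(\frac{a^2}{(\phi_{i+1}-\phi_i)^3}-\frac{a^2}{(\phi_i-\phi_{i-1})^3}\Bigr),$$ where the sum over $j\in\mathbb Z\setminus\{i\}$ is taken symmetrically about $i$. Let $$E^N(\phi)=a^2\!\!\sum_{1\le i<j\le N}\!\frac2L\ln\Bigl|\sin\frac{\pi(\phi_j-\phi_i)}{L}\Bigr|+a\sum_{i=1}^{N}\Bigl(-\ln\Bigl|\frac{\phi_i-\phi_{i+1}}{a}\Bigr|+\frac{a^2}{2}\frac1{(\phi_i-\phi_{i+1})^2}\Bigr)$$ and $$v_1(\alpha;\phi)=-\frac{\phi_{\alpha\alpha}}{L\,\phi_\alpha^2}(\alpha),\qquad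 r_0(\alpha;\phi)=\Bigl(\frac{v_{1\alpha}\,\phi_{\alpha\alpha}}{\phi_\alpha^2}-\frac{v_{1\alpha\alpha}}{\phi_\alpha}\Bigr)(\alpha).$$ **Theorem.** There are $T_0>0$ and $C$, depending only on $L$, $\beta$ and $M$, such that the following holds for every $0<T\le T_0$ and every strong solution $h$ of (1) on $[0,T]$ whose initial value satisfies $h(0)\in W^{7,2}_{\mathrm{per}^\star}$, $\|h(0)\|_{W^{7,2}}\le M$ and $h_x(0)\le2\beta$. For all $N\ge1$ there are numbers $R_i(t)$ such that for all $t\in[0,T]$ and $i=1,\dots,N$ $$\frac{d\phi_i}{dt}=\frac1a\Bigl(\frac{\bar f_{i+1}-\bar f_i}{\phi_{i+1}-\phi_i}-\frac{\bar f_i-\bar f_{i-1}}{\phi_i-\phi_{i-1}}\Bigr)-r_0(\alpha_i;\phi)\,a+R_i\,a^2,\qquad |r_0(\alpha_i;\phi)|\le C,\quad |R_i|\le C.$$ In addition, for all $t\in[0,T]$, $E^N(\phi)$ is differentiable in time and $$\frac{dE^N(\phi)}{dt}+\sum_{i=1}^N\frac{(\bar f_{i+1}-\bar f_i)^2}{\phi_{i+1}-\phi_i}\le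 Ca,\qquad \frac{dE^N(\phi)}{dt}+|\beta|\,a\sum_{i=1}^N\Bigl(\frac{\bar f_{i+1}-\bar f_i}{a}\Bigr)^2\le Ca .$$ (Time derivatives at $t=0$ and $t=T$ are one-sided.) -/

import Mathlib

open Set Filter Topology MeasureTheory
open scoped ENNReal NNReal

namespace StepFlow

noncomputable section

/-! ### Sobolev spaces on the line, through weak derivatives -/

/-- `g` is a `k`-th weak derivative of `u` on `ℝ`. -/
def IsWeakDeriv (k : ℕ) (u g : ℝ → ℝ) : Prop :=
  LocallyIntegrable u ∧ LocallyIntegrable g ∧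
    ∀ ψ : ℝ → ℝ, ContDiff ℝ (⊤ : ℕ∞) ψ → HasCompactSupport ψ →
      ∫ x, u x * iteratedDeriv k ψ x = (-1) ^ k * ∫ x, g x * ψ x

/-- `u ∈ W^{k,2}_loc(ℝ)`: every weak derivative of order at most `k` exists and is square
integrable on bounded sets. -/
def MemSobolevLoc (k : ℕ) (u : ℝ → ℝ) : Prop :=
  ∀ j ≤ k, ∃ g, IsWeakDeriv j u g ∧ ∀ R : ℝ, MemLp g 2 (volume.restrict (Icc (-R) R))

open Classical in
/-- The `k`-th weak derivative of `u` (unique up to a null set when it exists). -/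
def weakDeriv (k : ℕ) (u : ℝ → ℝ) : ℝ → ℝ :=
  if hu : ∃ g, IsWeakDeriv k u g then hu.choose else 0

/-- The norm of `W^{k,2}([0,L])`, that is `(∑_{j ≤ k} ∫_0^L |u^{(j)}|²)^{1/2}`. -/
def sobolevNorm (L : ℝ) (k : ℕ) (u : ℝ → ℝ) : ℝ≥0∞ :=
  (∑ j ∈ Finset.range (k + 1), ∫⁻ x in Icc 0 L, ‖weakDeriv j u x‖ₑ ^ 2) ^ (1 / 2 : ℝ)

/-- The space `W^{k,2}_per⋆`: functions in `W^{k,2}_loc(ℝ)` that drop by `1` over each period `L`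
(elements are given by their continuous representatives). -/
def MemSobolevStar (L : ℝ) (k : ℕ) (u : ℝ → ℝ) : Prop :=
  Continuous u ∧ MemSobolevLoc k u ∧ ∀ x, u (x + L) = u x - 1

/-- The space `W^{k,2}_per` of `L`-periodic functions
(elements are given by their continuous representatives). -/
def MemSobolevPer (L : ℝ) (k : ℕ) (u : ℝ → ℝ) : Prop :=
  Continuous u ∧ MemSobolevLoc k u ∧ ∀ x, u (x + L) = u x

/-! ### The continuum model -/

/-- The `L`-periodic Hilbert transform
`(H u)(x) = (1/L) PV ∫_0^L u(x - s) cot(π s / L) ds`. -/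
def hilbertTransform (L : ℝ) (u : ℝ → ℝ) (x : ℝ) : ℝ :=
  1 / L * limUnder (𝓝[>] (0 : ℝ))
    (fun δ => ∫ s in δ..(L - δ), u (x - s) * Real.cot (Real.pi * s / L))

/-- The chemical potential `-(2π/L) H(h_x) + (3 h_x + 1/h_x) h_xx` of a height profile. -/
def chemPotential (L : ℝ) (u : ℝ → ℝ) (x : ℝ) : ℝ :=
  -(2 * Real.pi / L) * hilbertTransform L (deriv u) x
    + (3 * deriv u x + 1 / deriv u x) * iteratedDeriv 2 u x

/-- `h` (time first, then space) is a strong solution on `[0, T]` of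
`h_t = (-(2π/L) H(h_x) + (3 h_x + 1/h_x) h_xx)_xx` with `h_x < 0`, in the class
`L^∞([0,T]; W^{m,2}_per⋆) ∩ L²([0,T]; W^{m+2,2}_per⋆) ∩ C([0,T]; W^{m-4,2}_per⋆)` with
`h_t ∈ L^∞([0,T]; W^{m-4,2}_per)`, for `m ≥ 5`.  Here `g` is the time derivative `h_t`. -/
structure IsStrongSolution (L T : ℝ) (m : ℕ) (h : ℝ → ℝ → ℝ) : Prop where
  linfty : ∃ K : ℝ≥0, ∀ᵐ t ∂(volume.restrict (Icc 0 T)),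
    MemSobolevStar L m (h t) ∧ sobolevNorm L m (h t) ≤ K
  ltwo_mem : ∀ᵐ t ∂(volume.restrict (Icc 0 T)), MemSobolevStar L (m + 2) (h t)
  ltwo : ∫⁻ t in Icc 0 T, sobolevNorm L (m + 2) (h t) ^ 2 < ⊤
  cont_mem : ∀ t ∈ Icc 0 T, MemSobolevStar L (m - 4) (h t)
  cont : ∀ s ∈ Icc 0 T,
    Tendsto (fun t => sobolevNorm L (m - 4) (h t - h s)) (𝓝[Icc 0 T] s) (𝓝 0)
  decreasing : ∀ t ∈ Icc 0 T, ∀ x, deriv (h t) x < 0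
  evolution : ∃ g : ℝ → ℝ → ℝ,
    (∃ K : ℝ≥0, ∀ᵐ t ∂(volume.restrict (Icc 0 T)),
      MemSobolevPer L (m - 4) (g t) ∧ sobolevNorm L (m - 4) (g t) ≤ K) ∧
    (∀ x, ∀ t ∈ Icc 0 T, IntervalIntegrable (fun s => g s x) volume 0 t ∧
      h t x = h 0 x + ∫ s in 0..t, g s x) ∧
    ∀ᵐ t ∂(volume.restrict (Icc 0 T)), ∀ᵐ x, g t x = iteratedDeriv 2 (chemPotential L (h t)) x

/-! ### The discrete model: `N` steps per period, step height `a = 1/N` -/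

/-- The heights `α_i = (N - i) / N`. -/
def node (N : ℕ) (i : ℤ) : ℝ := ((N : ℝ) - (i : ℝ)) / (N : ℝ)

/-- The nodal values `φ_i = φ(α_i)`. -/
def nodal (N : ℕ) (φ : ℝ → ℝ) (i : ℤ) : ℝ := φ (node N i)

/-- The discrete chemical potential
`-(2/L) ∑_{j ≠ i} a/(x_j - x_i) + (1/(x_{i+1} - x_i) - 1/(x_i - x_{i-1}))`
`+ (a²/(x_{i+1} - x_i)³ - a²/(x_i - x_{i-1})³)`.
The sum over all integers `j ≠ i`, which does not converge absolutely, is taken symmetrically: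
the terms `j = i ± (m + 1)` are paired. -/
def discreteChem (L a : ℝ) (x : ℤ → ℝ) (i : ℤ) : ℝ :=
  -(2 / L) * (∑' m : ℕ, (a / (x (i + (m + 1)) - x i) + a / (x (i - (m + 1)) - x i)))
    + (1 / (x (i + 1) - x i) - 1 / (x i - x (i - 1)))
    + (a ^ 2 / (x (i + 1) - x i) ^ 3 - a ^ 2 / (x i - x (i - 1)) ^ 3)

/-- The right-hand side of the step-flow equations,
`(1/a) ((f_{i+1} - f_i)/(x_{i+1} - x_i) - (f_i - f_{i-1})/(x_i - x_{i-1}))`. -/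
def stepVelocity (L a : ℝ) (x : ℤ → ℝ) (i : ℤ) : ℝ :=
  1 / a * ((discreteChem L a x (i + 1) - discreteChem L a x i) / (x (i + 1) - x i)
    - (discreteChem L a x i - discreteChem L a x (i - 1)) / (x i - x (i - 1)))

/-- The discrete energy of `N` steps per period. -/
def discreteEnergy (L : ℝ) (N : ℕ) (x : ℤ → ℝ) : ℝ :=
  (1 / (N : ℝ)) ^ 2 * (∑ i ∈ Finset.Icc (1 : ℤ) N, ∑ j ∈ Finset.Icc (i + 1) (N : ℤ),
      2 / L * Real.log |Real.sin (Real.pi / L * (x j - x i))|)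
    + 1 / (N : ℝ) * ∑ i ∈ Finset.Icc (1 : ℤ) N,
      (-Real.log |(x i - x (i + 1)) / (1 / (N : ℝ))|
        + (1 / (N : ℝ)) ^ 2 / 2 * (1 / (x i - x (i + 1)) ^ 2))

/-- `v₁ = -φ_αα / (L φ_α²)`. -/
def vOne (L : ℝ) (φ : ℝ → ℝ) (α : ℝ) : ℝ :=
  -(iteratedDeriv 2 φ α / (L * deriv φ α ^ 2))

/-- `r₀ = v₁_α φ_αα / φ_α² - v₁_αα / φ_α`. -/
def rZero (L : ℝ) (φ : ℝ → ℝ) (α : ℝ) : ℝ :=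
  deriv (vOne L φ) α * iteratedDeriv 2 φ α / deriv φ α ^ 2
    - iteratedDeriv 2 (vOne L φ) α / deriv φ α

end

end StepFlow

namespace StepFlow

noncomputable section

/-! ### Functions with bounded derivatives -/

/-- `g` has continuous derivatives up to order `k`, all bounded by `B`. -/
def CB : ℕ → ℝ → (ℝ → ℝ) → Prop
  | 0, B, g => Continuous g ∧ ∀ x, |g x| ≤ B
  | k + 1, B, g => Differentiable ℝ g ∧ (∀ x, |g x| ≤ B) ∧ CB k B (deriv g)

namespace CB

variable {k : ℕ} {B B' : ℝ} {f g : ℝ → ℝ}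

theorem continuous (h : CB k B g) : Continuous g := by
  cases k with
  | zero => exact h.1
  | succ k => exact h.1.continuous

theorem bound (h : CB k B g) (x : ℝ) : |g x| ≤ B := by
  cases k with
  | zero => exact h.2 x
  | succ k => exact h.2.1 x

theorem nonneg (h : CB k B g) : 0 ≤ B := (abs_nonneg _).trans (h.bound 0)

theorem mono (h : CB k B g) (hB : B ≤ B') : CB k B' g := by
  induction k generalizing g with
  | zero => exact ⟨h.1, fun x => (h.2 x).trans hB⟩
  | succ k ih => exact ⟨h.1, fun x => (h.2.1 x).trans hB, ih h.2.2⟩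

theorem of_succ (h : CB (k + 1) B g) : CB k B g := by
  induction k generalizing g with
  | zero => exact ⟨h.1.continuous, h.2.1⟩
  | succ k ih => exact ⟨h.1, h.2.1, ih h.2.2⟩

theorem of_le {m : ℕ} (h : CB k B g) (hm : m ≤ k) : CB m B g := by
  induction k with
  | zero => obtain rfl : m = 0 := by omega
            exact h
  | succ k ih =>
    rcases Nat.lt_or_ge k m with h1 | h1
    · obtain rfl : m = k + 1 := by omega
      exact h
    · exact ih h.of_succ h1

theorem of_hasDerivAt {g' : ℝ → ℝ} (hd : ∀ x, HasDerivAt g (g' x) x) (hb : ∀ x, |g x| ≤ B)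
    (h : CB k B g') : CB (k + 1) B g :=
  ⟨fun x => (hd x).differentiableAt, hb, by rwa [show deriv g = g' from funext fun x => (hd x).deriv]⟩

theorem contDiff (h : CB k B g) : ContDiff ℝ k g := by
  induction k generalizing g with
  | zero => exact contDiff_zero.2 h.1
  | succ k ih =>
    push_cast
    exact contDiff_succ_iff_deriv.2 ⟨h.1, by simp, ih h.2.2⟩

theorem iteratedDeriv_bound (h : CB k B g) {j : ℕ} (hj : j ≤ k) (x : ℝ) :
    |iteratedDeriv j g x| ≤ B := by
  induction j generalizing g k with
  | zero => simpa using h.bound x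
  | succ j ih =>
    obtain ⟨k, rfl⟩ : ∃ m, k = m + 1 := ⟨k - 1, by omega⟩
    rw [iteratedDeriv_succ']
    exact ih h.2.2 (by omega)

theorem of_contDiff (h : ContDiff ℝ k g) (hb : ∀ j ≤ k, ∀ x, |iteratedDeriv j g x| ≤ B) :
    CB k B g := by
  induction k generalizing g with
  | zero => exact ⟨h.continuous, fun x => by simpa using hb 0 le_rfl x⟩
  | succ k ih =>
    push_cast at h
    obtain ⟨h1, -, h2⟩ := contDiff_succ_iff_deriv.1 h
    refine ⟨h1, fun x => by simpa using hb 0 (by omega) x, ih h2 fun j hj x => ?_⟩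
    have := hb (j + 1) (by omega) x
    rwa [iteratedDeriv_succ'] at this

theorem const {c : ℝ} (hc : |c| ≤ B) : CB k B (fun _ => c) := by
  induction k generalizing c with
  | zero => exact ⟨continuous_const, fun _ => hc⟩
  | succ k ih =>
    refine ⟨differentiable_const _, fun _ => hc, ?_⟩
    rw [deriv_const']
    exact ih (by simpa using (abs_nonneg c).trans hc)

theorem add (hf : CB k B f) (hg : CB k B' g) : CB k (B + B') (fun x => f x + g x) := by
  induction k generalizing f g with
  | zero => exact ⟨hf.1.add hg.1, fun x => (abs_add_le _ _).trans (add_le_add (hf.2 x) (hg.2 x))⟩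
  | succ k ih =>
    exact of_hasDerivAt (fun x => (hf.1 x).hasDerivAt.add (hg.1 x).hasDerivAt)
      (fun x => (abs_add_le _ _).trans (add_le_add (hf.2.1 x) (hg.2.1 x))) (ih hf.2.2 hg.2.2)

theorem mul (hf : CB k B f) (hg : CB k B' g) : CB k (2 ^ k * (B * B')) (fun x => f x * g x) := by
  have hB := hf.nonneg
  have hB' := hg.nonneg
  have key : ∀ x, |f x * g x| ≤ B * B' := fun x => by
    rw [abs_mul]; exact mul_le_mul (hf.bound x) (hg.bound x) (abs_nonneg _) hB
  induction k generalizing f g with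
  | zero => exact ⟨hf.1.mul hg.1, fun x => by simpa using key x⟩
  | succ k ih =>
    refine of_hasDerivAt (fun x => (hf.1 x).hasDerivAt.mul (hg.1 x).hasDerivAt)
      (fun x => (key x).trans (le_mul_of_one_le_left (by positivity) (one_le_pow₀ (by norm_num)))) ?_
    have h1 := ih hf.2.2 hg.of_succ fun x => by
      rw [abs_mul]; exact mul_le_mul (hf.2.2.bound x) (hg.bound x) (abs_nonneg _) hB
    have h2 := ih hf.of_succ hg.2.2 fun x => by
      rw [abs_mul]; exact mul_le_mul (hf.bound x) (hg.2.2.bound x) (abs_nonneg _) hB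
    exact (h1.add h2).mono (by rw [pow_succ]; linarith)

end CB

/-- A family of functions with uniformly bounded derivatives up to order `k`. -/
def UCB {ι : Type*} (k : ℕ) (g : ι → ℝ → ℝ) : Prop := ∃ B, ∀ i, CB k B (g i)

namespace UCB

variable {ι κ : Type*} {k m : ℕ} {f g φ W : ι → ℝ → ℝ}

theorem bound (h : UCB k g) : ∃ B, ∀ i x, |g i x| ≤ B :=
  let ⟨B, hB⟩ := h; ⟨B, fun i x => (hB i).bound x⟩

theorem reindex (h : UCB k g) (e : κ → ι) : UCB k (fun i => g (e i)) :=
  let ⟨B, hB⟩ := h; ⟨B, fun i => hB (e i)⟩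

theorem of_le (h : UCB k g) (hm : m ≤ k) : UCB m g :=
  let ⟨B, hB⟩ := h; ⟨B, fun i => (hB i).of_le hm⟩

theorem continuous (h : UCB k g) (i : ι) : Continuous (g i) :=
  let ⟨_, hB⟩ := h; (hB i).continuous

theorem differentiable (h : UCB (k + 1) g) (i : ι) : Differentiable ℝ (g i) :=
  let ⟨_, hB⟩ := h; (hB i).1

theorem deriv (h : UCB (k + 1) g) : UCB k (fun i => deriv (g i)) :=
  let ⟨B, hB⟩ := h; ⟨B, fun i => (hB i).2.2⟩

theorem of_deriv {g' : ι → ℝ → ℝ} (hd : ∀ i x, HasDerivAt (g i) (g' i x) x)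
    (hb : ∃ B, ∀ i x, |g i x| ≤ B) (h : UCB k g') : UCB (k + 1) g := by
  obtain ⟨B, hB⟩ := hb
  obtain ⟨B', hB'⟩ := h
  exact ⟨max B B', fun i => CB.of_hasDerivAt (hd i) (fun x => (hB i x).trans (le_max_left _ _))
    ((hB' i).mono (le_max_right _ _))⟩

theorem congr (h : UCB k f) (hfg : ∀ i x, g i x = f i x) : UCB k g := by
  rwa [show g = f from funext fun i => funext fun x => hfg i x]

theorem const {c : ι → ℝ} (hc : ∃ B, ∀ i, |c i| ≤ B) : UCB k (fun i _ => c i) :=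
  let ⟨B, hB⟩ := hc; ⟨B, fun i => CB.const (hB i)⟩

theorem const' (c : ℝ) : UCB k (fun (_ : ι) _ => c) := const ⟨|c|, fun _ => le_rfl⟩

theorem add (hf : UCB k f) (hg : UCB k g) : UCB k (fun i x => f i x + g i x) :=
  let ⟨_, hB⟩ := hf; let ⟨_, hB'⟩ := hg; ⟨_, fun i => (hB i).add (hB' i)⟩

theorem mul (hf : UCB k f) (hg : UCB k g) : UCB k (fun i x => f i x * g i x) :=
  let ⟨_, hB⟩ := hf; let ⟨_, hB'⟩ := hg; ⟨_, fun i => (hB i).mul (hB' i)⟩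

theorem const_mul {c : ι → ℝ} (hg : UCB k g) (hc : ∃ B, ∀ i, |c i| ≤ B) :
    UCB k (fun i x => c i * g i x) := (const hc).mul hg

theorem neg (hg : UCB k g) : UCB k (fun i x => -g i x) :=
  ((const' (-1)).mul hg).congr fun i x => by ring

theorem sub (hf : UCB k f) (hg : UCB k g) : UCB k (fun i x => f i x - g i x) :=
  (hf.add hg.neg).congr fun i x => by ring

theorem inv (hg : UCB k g) (hc : ∃ c > 0, ∀ i x, c ≤ |g i x|) : UCB k (fun i x => 1 / g i x) := by
  obtain ⟨c, hc0, hc⟩ := hc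
  have hne : ∀ i x, g i x ≠ 0 := fun i x h => by
    have := hc i x; rw [h, abs_zero] at this; linarith
  have hb : ∀ i x, |1 / g i x| ≤ 1 / c := fun i x => by
    rw [abs_div, abs_one]; exact one_div_le_one_div_of_le hc0 (hc i x)
  induction k with
  | zero => exact ⟨1 / c, fun i => ⟨continuous_const.div (hg.continuous i) (hne i), hb i⟩⟩
  | succ k ih =>
    have h1 := ih (hg.of_le (Nat.le_succ k))
    refine of_deriv (g' := fun i x => -(_root_.deriv (g i) x * ((1 / g i x) * (1 / g i x))))
      (fun i x => ?_) ⟨_, hb⟩ (hg.deriv.mul (h1.mul h1)).neg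
    have h2 := (hg.differentiable i x).hasDerivAt.inv (hne i x)
    have h3 : (fun x => 1 / g i x) = (g i)⁻¹ := by ext y; simp
    rw [h3]
    refine h2.congr_deriv ?_
    have := hne i x
    field_simp

theorem div (hf : UCB k f) (hg : UCB k g) (hc : ∃ c > 0, ∀ i x, c ≤ |g i x|) :
    UCB k (fun i x => f i x / g i x) :=
  (hf.mul (hg.inv hc)).congr fun i x => by ring

theorem pow (hf : UCB k f) (n : ℕ) : UCB k (fun i x => f i x ^ n) := by
  induction n with
  | zero => simpa using const' 1
  | succ n ih => exact (ih.mul hf).congr fun i x => pow_succ _ _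

theorem comp_zero (hW : UCB 0 W) (hφ : ∀ i, Continuous (φ i)) : UCB 0 (fun i x => W i (φ i x)) :=
  let ⟨B, hB⟩ := hW; ⟨B, fun i => ⟨(hB i).continuous.comp (hφ i), fun _ => (hB i).bound _⟩⟩

theorem comp (hW : UCB (k + 1) W) (hφ : ∀ i, Differentiable ℝ (φ i))
    (hφ' : UCB k (fun i => _root_.deriv (φ i))) : UCB (k + 1) (fun i x => W i (φ i x)) := by
  have hd : ∀ i x, HasDerivAt (fun x => W i (φ i x))
      (_root_.deriv (W i) (φ i x) * _root_.deriv (φ i) x) x := fun i x =>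
    (hW.differentiable i (φ i x)).hasDerivAt.comp x (hφ i x).hasDerivAt
  obtain ⟨B, hB⟩ := hW.bound
  refine of_deriv hd ⟨B, fun i _ => hB i _⟩ ?_
  clear hd hB
  induction k generalizing W with
  | zero => exact (hW.deriv.comp_zero fun i => (hφ i).continuous).mul hφ'
  | succ k ih =>
    obtain ⟨B', hB'⟩ := hW.deriv.bound
    exact (of_deriv (fun i x => (hW.deriv.differentiable i (φ i x)).hasDerivAt.comp x
      (hφ i x).hasDerivAt) ⟨B', fun i _ => hB' i _⟩
      (ih hW.deriv (hφ'.of_le (Nat.le_succ k)))).mul hφ'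

theorem iteratedDeriv (h : UCB (k + m) g) : UCB k (fun i => iteratedDeriv m (g i)) := by
  induction m generalizing g with
  | zero => exact h.congr fun i x => by simp
  | succ m ih =>
    exact (ih (g := fun i => _root_.deriv (g i)) (UCB.deriv (k := k + m) h)).congr
      fun i x => by rw [iteratedDeriv_succ']

end UCB

/-! ### Central differences -/

/-- The central difference quotient with step `a`. -/
def cdiff (a : ℝ) (g : ℝ → ℝ) (x : ℝ) : ℝ := (g (x + a / 2) - g (x - a / 2)) / a

theorem abs_cdiff_le {a B : ℝ} {g : ℝ → ℝ} (ha : 0 < a) (hg : Differentiable ℝ g)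
    (hB : ∀ x, |deriv g x| ≤ B) (x : ℝ) : |cdiff a g x| ≤ B := by
  have := Convex.norm_image_sub_le_of_norm_deriv_le (f := g) (s := univ) (C := B)
    (fun x _ => hg x) (fun x _ => hB x) convex_univ (mem_univ (x - a / 2)) (mem_univ (x + a / 2))
  rw [cdiff, abs_div, abs_of_pos ha, div_le_iff₀ ha]
  simp only [Real.norm_eq_abs] at this
  rwa [show x + a / 2 - (x - a / 2) = a by ring, abs_of_pos ha] at this

theorem hasDerivAt_cdiff {a : ℝ} {g : ℝ → ℝ} (hg : Differentiable ℝ g) (x : ℝ) :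
    HasDerivAt (cdiff a g) (cdiff a (deriv g) x) x := by
  have h1 := (hg (x + a / 2)).hasDerivAt.comp_add_const x (a / 2)
  have h2 := (hg (x - a / 2)).hasDerivAt.comp_sub_const x (a / 2)
  exact (h1.sub h2).div_const a

theorem CB.cdiff {k : ℕ} {a B : ℝ} {g : ℝ → ℝ} (ha : 0 < a) (hg : Differentiable ℝ g)
    (hg' : CB k B (deriv g)) : CB k B (cdiff a g) := by
  induction k generalizing g with
  | zero =>
    exact ⟨continuous_iff_continuousAt.2 fun x => (hasDerivAt_cdiff hg x).continuousAt,
      abs_cdiff_le ha hg hg'.bound⟩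
  | succ k ih =>
    exact of_hasDerivAt (hasDerivAt_cdiff hg) (abs_cdiff_le ha hg hg'.bound) (ih hg'.1 hg'.2.2)

theorem abs_le_pow_succ_of_abs_deriv_le_pow {F F' : ℝ → ℝ} {c : ℝ} {n : ℕ} (h0 : F 0 = 0)
    (hd : ∀ y, 0 ≤ y → HasDerivAt F (F' y) y) (hb : ∀ y, 0 ≤ y → |F' y| ≤ c * y ^ n) {y : ℝ}
    (hy : 0 ≤ y) (hc : 0 ≤ c) : |F y| ≤ c * y ^ (n + 1) := by
  have := Convex.norm_image_sub_le_of_norm_hasDerivWithin_le (f := F) (f' := F') (s := Icc 0 y)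
    (C := c * y ^ n) (fun z hz => (hd z hz.1).hasDerivWithinAt)
    (fun z hz => (hb z hz.1).trans
      (mul_le_mul_of_nonneg_left (pow_le_pow_left₀ hz.1 hz.2 n) hc)) (convex_Icc _ _)
    (left_mem_Icc.2 hy) (right_mem_Icc.2 hy)
  simpa [h0, abs_of_nonneg hy, pow_succ, mul_assoc] using this

theorem abs_cdiff_sub_deriv_le {a B : ℝ} {g : ℝ → ℝ} (ha : 0 < a) (hg : Differentiable ℝ g)
    (hg' : CB 2 B (deriv g)) (x : ℝ) : |(cdiff a g x - deriv g x) / a ^ 2| ≤ B := by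
  have hB := hg'.nonneg
  have d1 : ∀ y, HasDerivAt g (deriv g y) y := fun y => (hg y).hasDerivAt
  have d2 : ∀ y, HasDerivAt (deriv g) (deriv (deriv g) y) y := fun y => (hg'.1 y).hasDerivAt
  have d3 : ∀ y, HasDerivAt (deriv (deriv g)) (deriv (deriv (deriv g)) y) y := fun y =>
    (hg'.2.2.1 y).hasDerivAt
  have h0 : ∀ y, 0 ≤ y → |deriv (deriv g) (x + y) - deriv (deriv g) (x - y)| ≤ 2 * B * y ^ 1 := by
    intro y hy
    refine abs_le_pow_succ_of_abs_deriv_le_pow (n := 0) (by simp)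
      (fun z _ => ((d3 _).comp_const_add x z).sub ((d3 _).comp_const_sub x z))
      (fun z _ => ?_) hy (by positivity)
    have h1 := hg'.2.2.2.2.bound (x + z)
    have h2 := hg'.2.2.2.2.bound (x - z)
    rw [abs_le] at *
    constructor <;> simp <;> linarith [h1.1, h1.2, h2.1, h2.2]
  have h1 : ∀ y, 0 ≤ y → |deriv g (x + y) + deriv g (x - y) - 2 * deriv g x| ≤ 2 * B * y ^ 2 := by
    intro y hy
    refine abs_le_pow_succ_of_abs_deriv_le_pow (n := 1) (by simp; ring)
      (fun z _ => (((d2 _).comp_const_add x z).add ((d2 _).comp_const_sub x z)).sub_const _)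
      (fun z hz => ?_) hy (by positivity)
    simpa [← sub_eq_add_neg] using h0 z hz
  have h2 : ∀ y, 0 ≤ y → |g (x + y) - g (x - y) - 2 * deriv g x * y| ≤ 2 * B * y ^ 3 := by
    intro y hy
    refine abs_le_pow_succ_of_abs_deriv_le_pow (n := 2) (by simp)
      (fun z _ => (((d1 _).comp_const_add x z).sub ((d1 _).comp_const_sub x z)).sub
        ((hasDerivAt_id z).const_mul _))
      (fun z hz => ?_) hy (by positivity)
    simpa using h1 z hz
  have h3 := h2 (a / 2) (by positivity)
  rw [show (cdiff a g x - deriv g x) / a ^ 2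
    = (g (x + a / 2) - g (x - a / 2) - 2 * deriv g x * (a / 2)) / a ^ 3 by
      rw [cdiff]; field_simp, abs_div, abs_of_pos (by positivity : 0 < a ^ 3),
      div_le_iff₀ (by positivity)]
  have : 0 ≤ B * a ^ 3 := by positivity
  linarith

theorem CB.cdiff_sub_deriv {k : ℕ} {a B : ℝ} {g : ℝ → ℝ} (ha : 0 < a)
    (hg : Differentiable ℝ g) (hg' : CB (k + 2) B (deriv g)) :
    CB k B (fun x => (StepFlow.cdiff a g x - deriv g x) / a ^ 2) := by
  induction k generalizing g with
  | zero =>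
    exact ⟨((continuous_iff_continuousAt.2 fun x => (hasDerivAt_cdiff hg x).continuousAt).sub
      hg'.1.continuous).div_const _, abs_cdiff_sub_deriv_le ha hg hg'⟩
  | succ k ih =>
    exact of_hasDerivAt (fun x => ((hasDerivAt_cdiff hg x).sub (hg'.1 x).hasDerivAt).div_const _)
      (abs_cdiff_sub_deriv_le ha hg (hg'.of_le (by omega))) (ih hg'.1 hg'.2.2)

theorem le_abs_cdiff {a c : ℝ} {g : ℝ → ℝ} (ha : 0 < a) (hg : Differentiable ℝ g)
    (hc : ∀ x, c ≤ |deriv g x|) (x : ℝ) : c ≤ |cdiff a g x| := by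
  obtain ⟨y, -, hy⟩ := exists_deriv_eq_slope g (by linarith : x - a / 2 < x + a / 2)
    hg.continuous.continuousOn (fun y _ => (hg y).differentiableWithinAt)
  rw [show x + a / 2 - (x - a / 2) = a by ring] at hy
  rw [cdiff, ← hy]
  exact hc y

namespace UCB

variable {ι : Type*} {k : ℕ} {a : ι → ℝ} {g φ : ι → ℝ → ℝ}

theorem cdiff (ha : ∀ i, 0 < a i) (hg : ∀ i, Differentiable ℝ (g i))
    (hg' : UCB k (fun i => _root_.deriv (g i))) : UCB k (fun i => cdiff (a i) (g i)) :=
  let ⟨B, hB⟩ := hg'; ⟨B, fun i => CB.cdiff (ha i) (hg i) (hB i)⟩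

theorem cdiff' (ha : ∀ i, 0 < a i) (hg : UCB (k + 1) g) : UCB k (fun i => StepFlow.cdiff (a i) (g i)) :=
  cdiff ha hg.differentiable hg.deriv

theorem cdiff_sub_deriv (ha : ∀ i, 0 < a i) (hg : ∀ i, Differentiable ℝ (g i))
    (hg' : UCB (k + 2) (fun i => _root_.deriv (g i))) :
    UCB k (fun i x => (StepFlow.cdiff (a i) (g i) x - _root_.deriv (g i) x) / a i ^ 2) :=
  let ⟨B, hB⟩ := hg'; ⟨B, fun i => CB.cdiff_sub_deriv (ha i) (hg i) (hB i)⟩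

theorem cdiff_sub_deriv' (ha : ∀ i, 0 < a i) (hg : UCB (k + 3) g) :
    UCB k (fun i x => (StepFlow.cdiff (a i) (g i) x - _root_.deriv (g i) x) / a i ^ 2) :=
  cdiff_sub_deriv ha hg.differentiable hg.deriv

end UCB

/-! ### Consistency of the local differences -/

section Local

variable {ι : Type*} {a : ι → ℝ} {g φ : ι → ℝ → ℝ}

theorem cdiff_add (a : ℝ) (f g : ℝ → ℝ) (x : ℝ) :
    cdiff a (fun y => f y + g y) x = cdiff a f x + cdiff a g x := by
  simp only [cdiff]; ring

theorem cdiff_sub (a : ℝ) (f g : ℝ → ℝ) (x : ℝ) :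
    cdiff a (fun y => f y - g y) x = cdiff a f x - cdiff a g x := by
  simp only [cdiff]; ring

theorem cdiff_const_mul (a c : ℝ) (g : ℝ → ℝ) (x : ℝ) :
    cdiff a (fun y => c * g y) x = c * cdiff a g x := by
  simp only [cdiff]; ring

theorem cdiff_div_const (a c : ℝ) (g : ℝ → ℝ) (x : ℝ) :
    cdiff a (fun y => g y / c) x = cdiff a g x / c := by
  simp only [cdiff]; ring

theorem exists_le_abs_cdiff (ha : ∀ i, 0 < a i) (hφ : ∀ i, Differentiable ℝ (φ i))
    (hc : ∃ c > 0, ∀ i x, c ≤ |deriv (φ i) x|) :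
    ∃ c > 0, ∀ i x, c ≤ |cdiff (a i) (φ i) x| :=
  let ⟨c, h0, h⟩ := hc; ⟨c, h0, fun i x => le_abs_cdiff (ha i) (hφ i) (h i) x⟩

theorem ne_zero_of_le_abs {g : ι → ℝ → ℝ} (hc : ∃ c > 0, ∀ i x, c ≤ |g i x|) (i : ι) (x : ℝ) :
    g i x ≠ 0 := fun h => by
  obtain ⟨c, h0, hc⟩ := hc
  have := hc i x
  rw [h, abs_zero] at this
  linarith

theorem ucb_inv_cdiff_sub (ha : ∀ i, 0 < a i) (hφ : ∀ i, Differentiable ℝ (φ i))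
    (hφ' : UCB 5 (fun i => deriv (φ i))) (hc : ∃ c > 0, ∀ i x, c ≤ |deriv (φ i) x|) :
    UCB 3 (fun i x => (1 / cdiff (a i) (φ i) x - 1 / deriv (φ i) x) / a i ^ 2) := by
  have hc' := exists_le_abs_cdiff ha hφ hc
  have h1 := (hφ'.of_le (by norm_num : 3 ≤ 5)).inv hc
  have h2 := ((UCB.cdiff ha hφ hφ').of_le (by norm_num : 3 ≤ 5)).inv hc'
  refine ((UCB.cdiff_sub_deriv (k := 3) ha hφ hφ').mul (h1.mul h2)).neg.congr fun i x => ?_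
  have := ne_zero_of_le_abs hc i x
  have := ne_zero_of_le_abs hc' i x
  have := (ha i).ne'
  field_simp
  ring

theorem ucb_inv_cube_cdiff_sub (ha : ∀ i, 0 < a i) (hφ : ∀ i, Differentiable ℝ (φ i))
    (hφ' : UCB 5 (fun i => deriv (φ i))) (hc : ∃ c > 0, ∀ i x, c ≤ |deriv (φ i) x|) :
    UCB 3 (fun i x => (1 / cdiff (a i) (φ i) x ^ 3 - 1 / deriv (φ i) x ^ 3) / a i ^ 2) := by
  have hc' := exists_le_abs_cdiff ha hφ hc
  have h1 := (hφ'.of_le (by norm_num : 3 ≤ 5)).inv hc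
  have h2 := ((UCB.cdiff ha hφ hφ').of_le (by norm_num : 3 ≤ 5)).inv hc'
  refine ((ucb_inv_cdiff_sub ha hφ hφ' hc).mul
    (((h1.mul h1).add (h1.mul h2)).add (h2.mul h2))).congr fun i x => ?_
  have := ne_zero_of_le_abs hc i x
  have := ne_zero_of_le_abs hc' i x
  have := (ha i).ne'
  field_simp
  ring

/-- If `F - G = O(a²)` in `C³` and `G ∈ C⁵`, then the central difference of `F` is `G' + O(a²)`
in `C²`. -/
theorem ucb_cdiff_sub_deriv_of_close {F G : ι → ℝ → ℝ} (ha : ∀ i, 0 < a i)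
    (hFG : UCB 3 (fun i x => (F i x - G i x) / a i ^ 2)) (hG : UCB 5 G) :
    UCB 2 (fun i x => (cdiff (a i) (F i) x - deriv (G i) x) / a i ^ 2) := by
  refine ((UCB.cdiff' ha hFG).add (UCB.cdiff_sub_deriv' ha hG)).congr fun i x => ?_
  rw [cdiff_div_const, cdiff_sub]
  ring

theorem bounded_cdiff_div_cdiff_sub (ha : ∀ i, 0 < a i) (hφ : ∀ i, Differentiable ℝ (φ i))
    (hφ' : UCB 5 (fun i => deriv (φ i))) (hc : ∃ c > 0, ∀ i x, c ≤ |deriv (φ i) x|)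
    (hg : UCB 4 g) :
    ∃ C, ∀ i x, |(cdiff (a i) (fun y => cdiff (a i) (g i) y / cdiff (a i) (φ i) y) x
      - deriv (fun y => deriv (g i) y / deriv (φ i) y) x) / a i ^ 2| ≤ C := by
  have hc' := exists_le_abs_cdiff ha hφ hc
  have h1 := ((UCB.cdiff ha hφ hφ').of_le (by norm_num : 1 ≤ 5)).inv hc'
  have h2 : UCB 3 (fun i x => deriv (g i) x / deriv (φ i) x) :=
    hg.deriv.div (hφ'.of_le (by norm_num)) hc
  have h3 := ((UCB.cdiff_sub_deriv' (k := 1) ha hg).mul h1).add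
    ((hg.deriv.of_le (by norm_num : 1 ≤ 3)).mul
      ((ucb_inv_cdiff_sub ha hφ hφ' hc).of_le (by norm_num : 1 ≤ 3)))
  have h4 : UCB 1 (fun i x => (cdiff (a i) (g i) x / cdiff (a i) (φ i) x
      - deriv (g i) x / deriv (φ i) x) / a i ^ 2) := h3.congr fun i x => by
    have := (ha i).ne'
    ring
  obtain ⟨C, hC⟩ := ((UCB.cdiff' ha h4).add (UCB.cdiff_sub_deriv' (k := 0) ha h2)).bound
  refine ⟨C, fun i x => ?_⟩
  have := hC i x
  rw [cdiff_div_const, cdiff_sub] at this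
  convert this using 2
  ring

theorem bounded_cdiff_div_cdiff (ha : ∀ i, 0 < a i) (hφ : ∀ i, Differentiable ℝ (φ i))
    (hφ' : UCB 5 (fun i => deriv (φ i))) (hc : ∃ c > 0, ∀ i x, c ≤ |deriv (φ i) x|)
    (hg : UCB 2 g) :
    ∃ C, ∀ i x, |cdiff (a i) (fun y => cdiff (a i) (g i) y / cdiff (a i) (φ i) y) x| ≤ C :=
  (UCB.cdiff' (k := 0) ha ((UCB.cdiff' ha hg).div ((UCB.cdiff ha hφ hφ').of_le (by norm_num))
    (exists_le_abs_cdiff ha hφ hc))).bound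

theorem abs_cdiff_le_of_bound {a B : ℝ} {g : ℝ → ℝ} (ha : 0 < a) (hg : ∀ x, |g x| ≤ B) (x : ℝ) :
    |cdiff a g x| ≤ 2 * B / a := by
  rw [cdiff, abs_div, abs_of_pos ha]
  gcongr
  have h1 := hg (x + a / 2)
  have h2 := hg (x - a / 2)
  rw [abs_le] at *
  constructor <;> linarith [h1.1, h1.2, h2.1, h2.2]

theorem bounded_cdiff_div_cdiff_of_bound (ha : ∀ i, 0 < a i) (hφ : ∀ i, Differentiable ℝ (φ i))
    (hc : ∃ c > 0, ∀ i x, c ≤ |deriv (φ i) x|) (hg : ∃ B, ∀ i x, |g i x| ≤ B) :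
    ∃ C, ∀ i x, |a i ^ 2 * cdiff (a i) (fun y => cdiff (a i) (g i) y / cdiff (a i) (φ i) y) x| ≤ C := by
  obtain ⟨c, hc0, hc⟩ := exists_le_abs_cdiff ha hφ hc
  obtain ⟨B, hB⟩ := hg
  refine ⟨4 * B / c, fun i x => ?_⟩
  have h1 := ha i
  have hB0 : 0 ≤ B := (abs_nonneg _).trans (hB i 0)
  have h2 : ∀ y, |cdiff (a i) (g i) y / cdiff (a i) (φ i) y| ≤ 2 * B / a i / c := fun y => by
    rw [abs_div]
    exact div_le_div₀ (by positivity) (abs_cdiff_le_of_bound h1 (hB i) y) hc0 (hc i y)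
  have h3 := abs_cdiff_le_of_bound h1 h2 x
  rw [abs_mul, abs_of_pos (by positivity : 0 < a i ^ 2)]
  calc _ ≤ a i ^ 2 * (2 * (2 * B / a i / c) / a i) := by gcongr
    _ = _ := by field_simp; ring

end Local

/-! ### Hadamard quotients -/

/-- The weighted radial mean `∫_0^1 θ^n g(θ s) dθ`. -/
def hmean (n : ℕ) (g : ℝ → ℝ) (s : ℝ) : ℝ := ∫ θ in (0 : ℝ)..1, θ ^ n * g (θ * s)

theorem abs_hmean_le {n : ℕ} {B : ℝ} {g : ℝ → ℝ} (hB : ∀ x, |g x| ≤ B) (s : ℝ) :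
    |hmean n g s| ≤ B := by
  have := intervalIntegral.norm_integral_le_of_norm_le_const (a := (0 : ℝ)) (b := 1) (C := B)
    (f := fun θ => θ ^ n * g (θ * s)) fun θ hθ => by
      rw [uIoc_of_le zero_le_one] at hθ
      rw [Real.norm_eq_abs, abs_mul, abs_of_nonneg (pow_nonneg hθ.1.le n)]
      exact (mul_le_of_le_one_left (abs_nonneg _) (pow_le_one₀ hθ.1.le hθ.2)).trans (hB _)
  simpa [hmean] using this

theorem continuous_hmean {n : ℕ} {g : ℝ → ℝ} (hg : Continuous g) : Continuous (hmean n g) := by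
  unfold hmean
  fun_prop

theorem hasDerivAt_hmean {n : ℕ} {B : ℝ} {g : ℝ → ℝ} (hg : CB 1 B g) (s : ℝ) :
    HasDerivAt (hmean n g) (hmean (n + 1) (deriv g) s) s := by
  have hg1 := hg.continuous
  have hg2 := hg.2.2.continuous
  have := intervalIntegral.hasDerivAt_integral_of_dominated_loc_of_deriv_le (𝕜 := ℝ)
    (μ := volume) (a := 0) (b := 1) (x₀ := s) (s := univ) (bound := fun _ => B)
    (F := fun s θ => θ ^ n * g (θ * s)) (F' := fun s θ => θ ^ (n + 1) * deriv g (θ * s))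
    Filter.univ_mem (Eventually.of_forall fun x => by fun_prop)
    (Continuous.intervalIntegrable (by fun_prop) _ _)
    (by fun_prop) (ae_of_all _ fun θ hθ x _ => ?_) (by simp)
    (ae_of_all _ fun θ _ x _ => ?_)
  · exact this.2
  · rw [uIoc_of_le zero_le_one] at hθ
    rw [Real.norm_eq_abs, abs_mul, abs_of_nonneg (pow_nonneg hθ.1.le _)]
    exact (mul_le_of_le_one_left (abs_nonneg _) (pow_le_one₀ hθ.1.le hθ.2)).trans (hg.2.2.bound _)
  · have h1 : HasDerivAt (fun x : ℝ => θ * x) θ x := by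
      simpa using (hasDerivAt_id x).const_mul θ
    have := (((hg.1 (θ * x)).hasDerivAt.comp x h1).const_mul (θ ^ n))
    exact this.congr_deriv (by ring)

theorem CB.hmean {k n : ℕ} {B : ℝ} {g : ℝ → ℝ} (hg : CB k B g) : CB k B (hmean n g) := by
  induction k generalizing g n with
  | zero => exact ⟨continuous_hmean hg.1, abs_hmean_le hg.2⟩
  | succ k ih =>
    exact of_hasDerivAt (hasDerivAt_hmean (hg.of_le (by omega))) (abs_hmean_le hg.2.1) (ih hg.2.2)

theorem UCB.hmean {ι : Type*} {k n : ℕ} {g : ι → ℝ → ℝ} (hg : UCB k g) :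
    UCB k (fun i => StepFlow.hmean n (g i)) :=
  let ⟨B, hB⟩ := hg; ⟨B, fun i => (hB i).hmean⟩

theorem mul_hmean_deriv {g : ℝ → ℝ} (hg : Differentiable ℝ g) (hg' : Continuous (deriv g)) (s : ℝ) :
    s * hmean 0 (deriv g) s = g s - g 0 := by
  have h1 : ∀ θ ∈ uIcc (0 : ℝ) 1, HasDerivAt (fun θ => g (θ * s)) (s * deriv g (θ * s)) θ := by
    intro θ _
    have h1 : HasDerivAt (fun x : ℝ => x * s) s θ := by simpa using (hasDerivAt_id θ).mul_const s
    exact ((hg (θ * s)).hasDerivAt.comp θ h1).congr_deriv (by ring)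
  have := intervalIntegral.integral_eq_sub_of_hasDerivAt h1
    (Continuous.intervalIntegrable (by fun_prop) _ _)
  simp only [hmean, pow_zero, one_mul]
  rw [← intervalIntegral.integral_const_mul, this]
  simp

theorem hmean_zero (n : ℕ) (g : ℝ → ℝ) : hmean n g 0 = g 0 / (n + 1) := by
  simp [hmean, integral_pow]
  ring

theorem hmean_zero_le {c : ℝ} {g : ℝ → ℝ} (hg : Continuous g) (hc : ∀ x, g x ≤ c) (s : ℝ) :
    hmean 0 g s ≤ c := by
  have := intervalIntegral.integral_mono_on (μ := volume) (a := (0 : ℝ)) (b := 1) zero_le_one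
    (f := fun θ => θ ^ 0 * g (θ * s)) (g := fun _ => c)
    (Continuous.intervalIntegrable (by fun_prop) _ _) intervalIntegrable_const (fun x _ => by simpa using hc _)
  simpa [hmean] using this

/-! ### The regular part of the cotangent -/

theorem exists_CB_of_hasCompactSupport {f : ℝ → ℝ} (hf : ContDiff ℝ (⊤ : ℕ∞) f)
    (hs : HasCompactSupport f) (k : ℕ) : ∃ B, CB k B f := by
  induction k generalizing f with
  | zero =>
    obtain ⟨B, hB⟩ := hf.continuous.bounded_above_of_compact_support hs
    exact ⟨B, hf.continuous, hB⟩
  | succ k ih =>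
    obtain ⟨B, hB⟩ := hf.continuous.bounded_above_of_compact_support hs
    obtain ⟨B', hB'⟩ := ih (contDiff_infty_iff_deriv.1 hf).2 hs.deriv
    exact ⟨max B B', (contDiff_infty_iff_deriv.1 hf).1, fun x => (hB x).trans (le_max_left _ _),
      hB'.mono (le_max_right _ _)⟩

theorem CB_sin_cos (k : ℕ) : CB k 1 Real.sin ∧ CB k 1 Real.cos := by
  induction k with
  | zero => exact ⟨⟨Real.continuous_sin, Real.abs_sin_le_one⟩, Real.continuous_cos, Real.abs_cos_le_one⟩
  | succ k ih =>
    refine ⟨CB.of_hasDerivAt Real.hasDerivAt_sin Real.abs_sin_le_one ih.2,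
      CB.of_hasDerivAt Real.hasDerivAt_cos Real.abs_cos_le_one ?_⟩
    refine CB.of_contDiff (by fun_prop) fun j hj x => ?_
    rw [iteratedDeriv_fun_neg, abs_neg]
    exact ih.1.iteratedDeriv_bound hj x

theorem exists_cot_regular_part {r : ℝ} (hr0 : 0 < r) (hr : r < Real.pi) :
    ∃ C : ℝ → ℝ, (∀ k, ∃ B, CB k B C) ∧ C 0 = 0 ∧
      ∀ z, z ≠ 0 → |z| ≤ r → Real.cot z = 1 / z + C z := by
  set S := hmean 0 Real.cos with hS
  have hcos : deriv Real.sin = Real.cos := Real.deriv_sin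
  have hSz : ∀ z, z * S z = Real.sin z := fun z => by
    have := mul_hmean_deriv Real.differentiable_sin (by rw [hcos]; exact Real.continuous_cos) z
    rwa [hcos, Real.sin_zero, sub_zero] at this
  have hS0 : S 0 = 1 := by simp [hS, hmean_zero]
  have hScb : ∀ k, CB k 1 S := fun k => (CB_sin_cos k).2.hmean
  have hSne : ∀ z, |z| < Real.pi → S z ≠ 0 := by
    intro z hz h
    have h1 := hSz z
    rw [h, mul_zero] at h1
    rcases eq_or_ne z 0 with rfl | h0
    · rw [hS0] at h; exact one_ne_zero h
    · rw [abs_lt] at hz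
      exact h0 ((Real.sin_eq_zero_iff_of_lt_of_lt hz.1 hz.2).1 h1.symm)
  set g := fun z => Real.cos z + (-1) * S z with hg
  have hgcb : ∀ k, CB k (1 + 2 ^ k) g := fun k =>
    (CB_sin_cos k).2.add (((CB.const (c := -1) (B := 1) (by simp)).mul (hScb k)).mono (by simp))
  have hU : ContDiff ℝ (⊤ : ℕ∞) (hmean 0 (deriv g)) :=
    contDiff_infty.2 fun k => (hgcb (k + 1)).2.2.hmean.contDiff
  have hUz : ∀ z, z * hmean 0 (deriv g) z = Real.cos z - S z := fun z => by
    rw [mul_hmean_deriv (hgcb 1).1 (hgcb 1).2.2.continuous z, hg]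
    simp [hS0]; ring
  have hg0 : deriv g 0 = 0 := by
    have h1 := (Real.hasDerivAt_cos 0).add ((hasDerivAt_hmean (n := 0) ((CB_sin_cos 1).2) 0).const_mul (-1))
    rw [show deriv g 0 = _ from h1.deriv, hmean_zero]
    simp
  let χ : ContDiffBump (0 : ℝ) := ⟨r, (r + Real.pi) / 2, hr0, by linarith⟩
  refine ⟨fun z => χ z * (hmean 0 (deriv g) z / S z), exists_CB_of_hasCompactSupport ?_ ?_, ?_, ?_⟩
  · refine contDiff_iff_contDiffAt.2 fun z => ?_
    by_cases hz : |z| < Real.pi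
    · exact χ.contDiff.contDiffAt.mul (hU.contDiffAt.div
        (contDiff_infty.2 fun k => (hScb k).contDiff).contDiffAt (hSne z hz))
    · refine contDiffAt_const (c := (0 : ℝ)) |>.congr_of_eventuallyEq ?_
      have h1 : z ∉ tsupport χ := by
        rw [χ.tsupport_eq, Metric.mem_closedBall, Real.dist_eq, sub_zero]
        change ¬ |z| ≤ (r + Real.pi) / 2
        linarith
      filter_upwards [(isClosed_tsupport χ).isOpen_compl.mem_nhds h1] with y hy
      rw [image_eq_zero_of_notMem_tsupport hy, zero_mul]
  · exact χ.hasCompactSupport.mul_right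
  · simp [hmean_zero, hg0]
  · intro z hz hzr
    have h1 : χ z = 1 := χ.one_of_mem_closedBall (by simpa using hzr)
    have h2 := hSne z (by linarith)
    have h3 := hUz z
    have h4 := hSz z
    simp only [h1, one_mul]
    rw [Real.cot_eq_cos_div_sin, ← h4, show Real.cos z = z * hmean 0 (deriv g) z + S z by linarith]
    field_simp
    ring

/-! ### The corrected trapezoidal rule -/

theorem trapezoid_cell {B : ℝ} {K : ℝ → ℝ} (hK : CB 4 B K) (c : ℝ) {y : ℝ} (hy : 0 ≤ y) :
    |(∫ s in c..(c + y), K s) - y / 2 * (K c + K (c + y))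
      + y ^ 2 / 12 * (deriv K (c + y) - deriv K c)| ≤ B * y ^ 5 := by
  have hB := hK.nonneg
  set K1 := deriv K
  set K2 := deriv K1
  set K3 := deriv K2
  have d0 : ∀ z, HasDerivAt (fun z => K (c + z)) (K1 (c + z)) z := fun z =>
    (hK.1 _).hasDerivAt.comp_const_add c z
  have d1 : ∀ z, HasDerivAt (fun z => K1 (c + z)) (K2 (c + z)) z := fun z =>
    (hK.2.2.1 _).hasDerivAt.comp_const_add c z
  have d2 : ∀ z, HasDerivAt (fun z => K2 (c + z)) (K3 (c + z)) z := fun z =>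
    (hK.2.2.2.2.1 _).hasDerivAt.comp_const_add c z
  have d3 : ∀ z, HasDerivAt (fun z => K3 (c + z)) (deriv K3 (c + z)) z := fun z =>
    (hK.2.2.2.2.2.2.1 _).hasDerivAt.comp_const_add c z
  have hI : ∀ z, HasDerivAt (fun z => ∫ s in c..(c + z), K s) (K (c + z)) z := fun z =>
    (intervalIntegral.integral_hasDerivAt_right (hK.continuous.intervalIntegrable _ _)
      hK.continuous.stronglyMeasurable.stronglyMeasurableAtFilter
      hK.continuous.continuousAt).comp_const_add c z
  have h2 : ∀ z, 0 ≤ z → |1 / 6 * (K1 (c + z) - K1 c) - z / 6 * K2 (c + z)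
      + z ^ 2 / 12 * K3 (c + z)| ≤ B * z ^ 3 := by
    intro z hz
    refine abs_le_pow_succ_of_abs_deriv_le_pow (n := 2)
      (F := fun z => 1 / 6 * (K1 (c + z) - K1 c) - z / 6 * K2 (c + z) + z ^ 2 / 12 * K3 (c + z))
      (F' := fun z => z ^ 2 / 12 * deriv K3 (c + z)) (by simp) (fun w _ => ?_) (fun w hw => ?_) hz hB
    · refine (((((d1 w).sub_const _).const_mul _).sub (((hasDerivAt_id w).div_const 6).mul (d2 w))).add
        (((hasDerivAt_pow 2 w).div_const 12).mul (d3 w))).congr_deriv ?_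
      simp; ring
    · have := hK.2.2.2.2.2.2.2.2.bound (c + w)
      rw [abs_mul, abs_of_nonneg (by positivity)]
      nlinarith [abs_nonneg (deriv K3 (c + w)), sq_nonneg w]
  have h1 : ∀ z, 0 ≤ z → |1 / 2 * (K (c + z) - K c) - z / 3 * K1 (c + z) - z / 6 * K1 c
      + z ^ 2 / 12 * K2 (c + z)| ≤ B * z ^ 4 := by
    intro z hz
    refine abs_le_pow_succ_of_abs_deriv_le_pow (n := 3)
      (F := fun z => 1 / 2 * (K (c + z) - K c) - z / 3 * K1 (c + z) - z / 6 * K1 c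
      + z ^ 2 / 12 * K2 (c + z)) (by simp) (fun w _ => ?_) h2 hz hB
    refine ((((((d0 w).sub_const _).const_mul _).sub (((hasDerivAt_id w).div_const 3).mul (d1 w))).sub
      (((hasDerivAt_id w).div_const 6).mul_const _)).add
      (((hasDerivAt_pow 2 w).div_const 12).mul (d2 w))).congr_deriv ?_
    simp; ring
  refine abs_le_pow_succ_of_abs_deriv_le_pow (n := 4)
    (F := fun y => (∫ s in c..(c + y), K s) - y / 2 * (K c + K (c + y))
      + y ^ 2 / 12 * (K1 (c + y) - K1 c)) (by simp) (fun w _ => ?_) h1 hy hB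
  refine (((hI w).sub (((hasDerivAt_id w).div_const 2).mul ((d0 w).const_add (K c)))).add
    (((hasDerivAt_pow 2 w).div_const 12).mul ((d1 w).sub_const (K1 c)))).congr_deriv ?_
  simp; ring

theorem trapezoid_periodic {B : ℝ} {K : ℝ → ℝ} (hK : CB 4 B K) (hper : ∀ s, K (s + 1) = K s)
    {N : ℕ} (hN : 1 ≤ N) :
    |(1 / (N : ℝ)) * ∑ j ∈ Finset.range N, K (j * (1 / (N : ℝ))) - ∫ s in (0 : ℝ)..1, K s|
      ≤ B * (1 / (N : ℝ)) ^ 4 := by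
  have hN0 : (0 : ℝ) < N := by exact_mod_cast hN
  set a := 1 / (N : ℝ) with ha
  have ha0 : 0 < a := by positivity
  have hNa : N * a = 1 := by rw [ha]; field_simp
  have hper' : deriv K 1 = deriv K 0 := by
    have h1 : (fun s => K (s + 1)) = K := funext hper
    have h2 := deriv_comp_add_const (f := K) (a := 1) (x := 0)
    rw [h1, zero_add] at h2
    exact h2.symm
  have hint : ∫ s in (0 : ℝ)..1, K s
      = ∑ j ∈ Finset.range N, ∫ s in (j * a)..((j + 1 : ℕ) * a), K s := by
    rw [intervalIntegral.sum_integral_adjacent_intervals (a := fun j : ℕ => (j : ℝ) * a)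
      fun k _ => hK.continuous.intervalIntegrable _ _]
    simp [hNa]
  have ht1 : ∑ j ∈ Finset.range N, (deriv K ((j + 1 : ℕ) * a) - deriv K (j * a)) = 0 := by
    rw [Finset.sum_range_sub (fun j : ℕ => deriv K (j * a)), hNa]
    simp [hper']
  have ht2 : ∑ j ∈ Finset.range N, (K ((j + 1 : ℕ) * a) - K (j * a)) = 0 := by
    rw [Finset.sum_range_sub (fun j : ℕ => K (j * a)), hNa]
    have := hper 0
    rw [zero_add] at this
    simp [this]
  have key : a * ∑ j ∈ Finset.range N, K (j * a) - ∫ s in (0 : ℝ)..1, K s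
      = -∑ j ∈ Finset.range N, ((∫ s in (j * a)..(j * a + a), K s)
        - a / 2 * (K (j * a) + K (j * a + a))
        + a ^ 2 / 12 * (deriv K (j * a + a) - deriv K (j * a))) := by
    have e : ∀ j : ℕ, (j : ℝ) * a + a = (j + 1 : ℕ) * a := fun j => by push_cast; ring
    simp only [e]
    rw [Finset.sum_add_distrib, Finset.sum_sub_distrib, ← hint, ← Finset.mul_sum, ← Finset.mul_sum,
      ht1]
    have h3 : ∑ j ∈ Finset.range N, (K (j * a) + K ((j + 1 : ℕ) * a))
        = 2 * ∑ j ∈ Finset.range N, K (j * a) := by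
      rw [Finset.sum_sub_distrib] at ht2
      rw [Finset.sum_add_distrib]
      linarith
    rw [h3]; ring
  rw [key, abs_neg]
  refine (Finset.abs_sum_le_sum_abs _ _).trans
    ((Finset.sum_le_sum fun j _ => trapezoid_cell hK _ ha0.le).trans_eq ?_)
  rw [Finset.sum_const, Finset.card_range, nsmul_eq_mul]
  linear_combination B * a ^ 4 * hNa

/-! ### The regularized cotangent kernel -/

theorem CB.of_locally {k : ℕ} {B : ℝ} {f : ℝ → ℝ}
    (h : ∀ x, ∃ g, CB k B g ∧ f =ᶠ[𝓝 x] g) : CB k B f := by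
  induction k generalizing f with
  | zero =>
    refine ⟨continuous_iff_continuousAt.2 fun x => ?_, fun x => ?_⟩ <;> obtain ⟨g, hg, hx⟩ := h x
    · exact hg.continuous.continuousAt.congr hx.symm
    · rw [hx.eq_of_nhds]; exact hg.bound x
  | succ k ih =>
    refine ⟨fun x => ?_, fun x => ?_, ih fun x => ?_⟩ <;> obtain ⟨g, hg, hx⟩ := h x
    · exact (hg.1 x).congr_of_eventuallyEq hx
    · rw [hx.eq_of_nhds]; exact hg.bound x
    · exact ⟨deriv g, hg.2.2, hx.deriv⟩

theorem cot_periodic : Function.Periodic Real.cot Real.pi := fun x => by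
  rw [Real.cot_eq_cos_div_sin, Real.cot_eq_cos_div_sin, Real.sin_add_pi, Real.cos_add_pi,
    neg_div_neg_eq]

theorem cot_neg (x : ℝ) : Real.cot (-x) = -Real.cot x := by
  rw [Real.cot_eq_cos_div_sin, Real.cot_eq_cos_div_sin, Real.sin_neg, Real.cos_neg, div_neg]

theorem cot_add_int_mul (L : ℝ) (hL : L ≠ 0) (x : ℝ) (n : ℤ) :
    Real.cot (Real.pi * (x + n * L) / L) = Real.cot (Real.pi * x / L) := by
  rw [show Real.pi * (x + n * L) / L = Real.pi * x / L + n * Real.pi by field_simp]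
  exact cot_periodic.int_mul n _

theorem sub_le_of_deriv_le {c : ℝ} {φ : ℝ → ℝ} (hφ : Differentiable ℝ φ) (hc : ∀ x, deriv φ x ≤ c)
    {x y : ℝ} (hxy : x ≤ y) : φ y - φ x ≤ c * (y - x) :=
  image_sub_le_mul_sub_of_deriv_le hφ hc hxy

theorem shift_int {L : ℝ} {φ : ℝ → ℝ} (hper : ∀ x, φ (x + 1) = φ x - L) (x : ℝ) (n : ℤ) :
    φ (x + n) = φ x - n * L := by
  have h : Function.Periodic (fun x => φ x + x * L) 1 := fun x => by
    simp only [hper]; ring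
  have := h.int_mul n x
  simp only [mul_one] at this
  linarith

section Kernel

variable {ι : Type*} {L : ℝ} {φ : ι → ℝ → ℝ}

theorem abs_shift_sub_le {c : ℝ} {φ : ℝ → ℝ} (hφ : Differentiable ℝ φ)
    (hc0 : 0 ≤ c) (hc : ∀ x, deriv φ x ≤ -c) (hper : ∀ x, φ (x + 1) = φ x - L)
    {s : ℝ} (hs : |s| ≤ 3 / 4) (α : ℝ) : |φ (α + s) - φ α| ≤ L - c / 4 := by
  rw [abs_le] at hs
  have h1 := hper α
  have h2 := hper (α - 1)
  rw [sub_add_cancel] at h2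
  rcases le_total 0 s with h | h
  · have h3 := sub_le_of_deriv_le hφ hc (show α + s ≤ α + 1 by linarith)
    have h4 := sub_le_of_deriv_le hφ hc (show α ≤ α + s by linarith)
    rw [abs_le]
    constructor <;> nlinarith
  · have h3 := sub_le_of_deriv_le hφ hc (show α - 1 ≤ α + s by linarith)
    have h4 := sub_le_of_deriv_le hφ hc (show α + s ≤ α by linarith)
    rw [abs_le]
    constructor <;> nlinarith

theorem exists_kernel (hL : 0 < L) (hφ : ∀ i, Differentiable ℝ (φ i))
    (hφ' : UCB 5 (fun i => deriv (φ i))) (hneg : ∃ c > 0, ∀ i x, deriv (φ i) x ≤ -c)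
    (hper : ∀ i x, φ i (x + 1) = φ i x - L) :
    ∃ K : ι × ℝ → ℝ → ℝ, UCB 4 K ∧ (∀ p s, K p (s + 1) = K p s) ∧
      (∀ i α, K (i, α) 0 = -(iteratedDeriv 2 (φ i) α / (2 * deriv (φ i) α ^ 2))) ∧
      ∀ i α (s : ℝ), (∀ n : ℤ, s ≠ n) → K (i, α) s =
        Real.pi / L * Real.cot (Real.pi * (φ i (α + s) - φ i α) / L)
          - Real.pi / deriv (φ i) α * Real.cot (Real.pi * s) := by
  obtain ⟨c, hc0, hc⟩ := hneg
  have hpi := Real.pi_pos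
  set r := Real.pi * max (3 / 4) (1 - c / (4 * L)) with hr
  have hr0 : 0 < r := mul_pos hpi (lt_max_of_lt_left (by norm_num))
  have hrpi : r < Real.pi := by
    rw [hr]
    refine mul_lt_of_lt_one_right hpi (max_lt (by norm_num) ?_)
    have : 0 < c / (4 * L) := by positivity
    linarith
  obtain ⟨C, hCcb, hC0, hC⟩ := exists_cot_regular_part hr0 hrpi
  -- the radial mean of the derivative
  let D : ι × ℝ → ℝ → ℝ := fun p s => deriv (φ p.1) (p.2 + s)
  have hD : UCB 5 D := (hφ'.reindex Prod.fst).comp (φ := fun (p : ι × ℝ) s => p.2 + s)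
    (fun p => by fun_prop) ((UCB.const' 1).congr fun i x => by simp)
  let ψ : ι × ℝ → ℝ → ℝ := fun p => hmean 0 (D p)
  have hψ : UCB 5 ψ := hD.hmean
  have hDle : ∀ p s, D p s ≤ -c := fun p s => hc _ _
  have hψle : ∀ p s, ψ p s ≤ -c := fun p s => hmean_zero_le (hD.continuous p) (hDle p) s
  have hψabs : ∃ c > 0, ∀ p s, c ≤ |ψ p s| :=
    ⟨c, hc0, fun p s => by rw [abs_of_neg (by linarith [hψle p s])]; linarith [hψle p s]⟩
  have hψne : ∀ p s, ψ p s ≠ 0 := fun p s => by have := hψle p s; linarith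
  have hψ0 : ∀ p, ψ p 0 = deriv (φ p.1) p.2 := fun p => by simp [ψ, D, hmean_zero]
  let ψ₁ : ι × ℝ → ℝ → ℝ := fun p => hmean 0 (deriv (ψ p))
  have hψ₁ : UCB 4 ψ₁ := hψ.deriv.hmean
  have hψs : ∀ p s, s * ψ p s = φ p.1 (p.2 + s) - φ p.1 p.2 := by
    intro p s
    have e : deriv (fun s => φ p.1 (p.2 + s)) = D p := by
      ext s; exact deriv_comp_const_add _ _ _
    have := mul_hmean_deriv (g := fun s => φ p.1 (p.2 + s))
      ((hφ p.1).comp (by fun_prop)) (by rw [e]; exact hD.continuous p) s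
    rw [e] at this
    simpa using this
  have hψ₁s : ∀ p s, s * ψ₁ p s = ψ p s - ψ p 0 := fun p s =>
    mul_hmean_deriv (hψ.differentiable p) (hψ.deriv.continuous p) s
  have hinv0 : ∃ B, ∀ p : ι × ℝ, |1 / ψ p 0| ≤ B :=
    let ⟨B, hB⟩ := (hψ.inv hψabs).bound; ⟨B, fun p => hB p 0⟩
  have hC4 : ∀ Δ : ι × ℝ → ℝ → ℝ, (∀ p, Differentiable ℝ (Δ p)) →
      UCB 3 (fun p => deriv (Δ p)) → UCB 4 (fun p s => C (Δ p s)) := fun Δ h1 h2 =>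
    UCB.comp (W := fun _ => C) (let ⟨B, hB⟩ := hCcb 4; ⟨B, fun _ => hB⟩) h1 h2
  let k₀ : ι × ℝ → ℝ → ℝ := fun p s => -(ψ₁ p s * (1 / ψ p s) * (1 / ψ p 0))
    + Real.pi / L * C (Real.pi * (φ p.1 (p.2 + s) - φ p.1 p.2) / L)
    - Real.pi * (1 / ψ p 0) * C (Real.pi * s)
  have hdΔ : ∀ (p : ι × ℝ) s, HasDerivAt (fun s => Real.pi * (φ p.1 (p.2 + s) - φ p.1 p.2) / L)
      (Real.pi / L * D p s) s := fun p s => by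
    have h1 := ((hφ p.1 (p.2 + s)).hasDerivAt.comp_const_add p.2 s).sub_const (φ p.1 p.2)
    exact ((h1.const_mul Real.pi).div_const L).congr_deriv (by simp only [D]; ring)
  have hk₀ : UCB 4 k₀ := by
    refine UCB.sub (UCB.add (UCB.neg ((hψ₁.mul ((hψ.of_le (by norm_num)).inv hψabs)).mul
      (UCB.const hinv0))) (UCB.const_mul (hC4 _ (fun p s => (hdΔ p s).differentiableAt) ?_)
        ⟨_, fun _ => le_rfl⟩)) (UCB.mul (UCB.mul (UCB.const' Real.pi) (UCB.const hinv0))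
        (hC4 (fun _ s => Real.pi * s) (fun p => by fun_prop) ?_))
    · exact ((hD.of_le (by norm_num)).const_mul (c := fun _ => Real.pi / L)
        ⟨_, fun _ => le_rfl⟩).congr fun p s => (hdΔ p s).deriv
    · refine (UCB.const' Real.pi).congr fun p s => ?_
      simp
  have hform : ∀ p s, s ≠ 0 → |s| ≤ 3 / 4 → k₀ p s =
      Real.pi / L * Real.cot (Real.pi * (φ p.1 (p.2 + s) - φ p.1 p.2) / L)
          - Real.pi / deriv (φ p.1) p.2 * Real.cot (Real.pi * s) := by
    intro p s hs0 hs
    have h1 := abs_shift_sub_le (hφ p.1) hc0.le (hc p.1) (hper p.1) hs p.2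
    have h2 : φ p.1 (p.2 + s) - φ p.1 p.2 ≠ 0 := by
      rw [← hψs]; exact mul_ne_zero hs0 (hψne p s)
    have h3 : |Real.pi * (φ p.1 (p.2 + s) - φ p.1 p.2) / L| ≤ r := by
      rw [abs_div, abs_mul, abs_of_pos hpi, abs_of_pos hL, mul_div_assoc, hr]
      refine mul_le_mul_of_nonneg_left (le_max_of_le_right ?_) hpi.le
      rw [div_le_iff₀ hL]
      field_simp
      linarith
    have h4 : |Real.pi * s| ≤ r := by
      rw [abs_mul, abs_of_pos hpi, hr]
      exact mul_le_mul_of_nonneg_left (le_max_of_le_left hs) hpi.le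
    rw [hC _ (by positivity) h3, hC _ (by positivity) h4, ← hψ0]
    simp only [k₀]
    have h5 : ψ₁ p s = (ψ p s - ψ p 0) / s := by rw [← hψ₁s]; field_simp
    have := hψne p s
    have := hψne p 0
    rw [h5, ← hψs]
    field_simp
    ring
  have hform_per : ∀ (p : ι × ℝ) (s : ℝ) (n : ℤ),
      Real.pi / L * Real.cot (Real.pi * (φ p.1 (p.2 + (s + n)) - φ p.1 p.2) / L)
          - Real.pi / deriv (φ p.1) p.2 * Real.cot (Real.pi * (s + n))
      = Real.pi / L * Real.cot (Real.pi * (φ p.1 (p.2 + s) - φ p.1 p.2) / L)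
          - Real.pi / deriv (φ p.1) p.2 * Real.cot (Real.pi * s) := by
    intro p s n
    rw [← add_assoc, shift_int (hper p.1), show Real.pi * (s + n) = Real.pi * s + n * Real.pi by ring,
      cot_periodic.int_mul n, show φ p.1 (p.2 + s) - n * L - φ p.1 p.2
        = (φ p.1 (p.2 + s) - φ p.1 p.2) + ((-n : ℤ) : ℝ) * L by push_cast; ring,
      cot_add_int_mul L hL.ne']
  have hfl : ∀ s : ℝ, |s - ⌊s + 1 / 2⌋| ≤ 1 / 2 := fun s => by
    have h1 := Int.floor_le (s + 1 / 2)
    have h2 := Int.lt_floor_add_one (s + 1 / 2)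
    rw [abs_le]; constructor <;> linarith
  have hglue : ∀ p (s : ℝ) (n : ℤ), |s - n| < 3 / 4 → k₀ p (s - ⌊s + 1 / 2⌋) = k₀ p (s - n) := by
    intro p s n hn
    have h1 := hfl s
    set m := ⌊s + 1 / 2⌋
    rcases eq_or_ne m n with h | h
    · rw [h]
    · have h2 : (1 : ℝ) ≤ |(m : ℝ) - n| := by
        exact_mod_cast Int.one_le_abs (sub_ne_zero.2 h)
      have h3 : |(m : ℝ) - n| ≤ |s - n| + |s - m| := by
        rw [show (m : ℝ) - n = (s - n) - (s - m) by ring]; exact abs_sub _ _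
      have h4 : s - m ≠ 0 := fun h0 => by rw [h0, abs_zero] at h3; linarith
      have h5 : s - n ≠ 0 := fun h0 => by rw [h0, abs_zero] at h3; linarith
      rw [hform p _ h4 (by linarith), hform p _ h5 hn.le,
        ← hform_per p (s - m) (m - n)]
      push_cast
      rw [show s - m + ((m : ℝ) - n) = s - n by ring]
  refine ⟨fun p s => k₀ p (s - ⌊s + 1 / 2⌋), ?_, fun p s => ?_, fun i α => ?_, fun i α s hs => ?_⟩
  · obtain ⟨B, hB⟩ : UCB 4 (fun (q : (ι × ℝ) × ℝ) s => k₀ q.1 (s - q.2)) :=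
      (hk₀.reindex Prod.fst).comp (φ := fun (q : (ι × ℝ) × ℝ) s => s - q.2) (fun q => by fun_prop)
        ((UCB.const' 1).congr fun i x => by simp)
    refine ⟨B, fun p => CB.of_locally fun x => ⟨_, hB (p, ⌊x + 1 / 2⌋), ?_⟩⟩
    have : ∀ᶠ s : ℝ in 𝓝 x, |s - ⌊x + 1 / 2⌋| < 3 / 4 :=
      (by fun_prop : ContinuousAt (fun s : ℝ => |s - ⌊x + 1 / 2⌋|) x).eventually_lt_const
        ((hfl x).trans_lt (by norm_num))
    filter_upwards [this] with s hs
    exact hglue p s _ hs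
  · simp only
    rw [show s + 1 + 1 / 2 = s + 1 / 2 + 1 by ring, Int.floor_add_one]
    push_cast
    ring_nf
  · have h1 : ⌊(0 : ℝ) + 1 / 2⌋ = 0 := by norm_num
    have h2 : HasDerivAt (ψ (i, α)) (hmean 1 (deriv (D (i, α))) 0) 0 := by
      obtain ⟨B, hB⟩ := hD
      exact hasDerivAt_hmean ((hB (i, α)).of_le (by norm_num)) 0
    have h3 : deriv (D (i, α)) 0 = iteratedDeriv 2 (φ i) α := by
      simp only [D]
      rw [deriv_comp_const_add (deriv (φ i)), iteratedDeriv_succ, iteratedDeriv_one, add_zero]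
    simp only [h1, Int.cast_zero, sub_zero, k₀, add_zero, sub_self, mul_zero, zero_div, hC0, ψ₁,
      hmean_zero, h2.deriv, h3, hψ0]
    have := hψne (i, α) 0
    rw [hψ0] at this
    field_simp
    norm_num
  · have h1 : s - ⌊s + 1 / 2⌋ ≠ 0 := sub_ne_zero.2 (hs _)
    refine (hform (i, α) _ h1 ((hfl s).trans (by norm_num))).trans ?_
    rw [← hform_per (i, α) (s - ⌊s + 1 / 2⌋) ⌊s + 1 / 2⌋, sub_add_cancel]

theorem sum_cot_eq_zero (N : ℕ) :
    ∑ j ∈ Finset.Ico 1 N, Real.cot (Real.pi * (j * (1 / (N : ℝ)))) = 0 := by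
  have h := Finset.sum_Ico_reflect (fun j : ℕ => Real.cot (Real.pi * (j * (1 / (N : ℝ))))) 1
    (le_refl N |>.trans (Nat.le_succ N))
  simp only [Nat.add_sub_cancel, Nat.add_sub_cancel_left] at h
  have h2 : ∀ j ∈ Finset.Ico 1 N, Real.cot (Real.pi * (((N - j : ℕ) : ℝ) * (1 / (N : ℝ))))
      = -Real.cot (Real.pi * (j * (1 / (N : ℝ)))) := by
    intro j hj
    rw [Finset.mem_Ico] at hj
    have hN : (N : ℝ) ≠ 0 := by
      have : 0 < N := by omega
      positivity
    rw [← cot_neg, ← cot_periodic (-_), Nat.cast_sub hj.2.le]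
    congr 1
    field_simp
    ring
  have h3 := Finset.sum_congr rfl h2
  rw [Finset.sum_neg_distrib] at h3
  rw [h3] at h
  linarith

/-- The sum of the cotangent kernel over the nodes of one period agrees up to `O(a⁴)` with
its regularized integral, corrected by the missing diagonal term. -/
theorem cot_sum_consistency (hL : 0 < L) (hφ : ∀ i, Differentiable ℝ (φ i))
    (hφ' : UCB 5 (fun i => deriv (φ i))) (hneg : ∃ c > 0, ∀ i x, deriv (φ i) x ≤ -c)
    (hper : ∀ i x, φ i (x + 1) = φ i x - L) :
    ∃ (K : ι × ℝ → ℝ → ℝ) (C : ℝ), UCB 4 K ∧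
      (∀ i α (s : ℝ), (∀ n : ℤ, s ≠ n) → K (i, α) s =
        Real.pi / L * Real.cot (Real.pi * (φ i (α + s) - φ i α) / L)
          - Real.pi / deriv (φ i) α * Real.cot (Real.pi * s)) ∧
      ∀ i α (N : ℕ), 1 ≤ N →
        |1 / (N : ℝ) * ∑ j ∈ Finset.Ico 1 N,
            Real.pi / L * Real.cot (Real.pi * (φ i (α + j * (1 / (N : ℝ))) - φ i α) / L)
          - ((∫ s in (0 : ℝ)..1, K (i, α) s)
            + 1 / (N : ℝ) * (iteratedDeriv 2 (φ i) α / (2 * deriv (φ i) α ^ 2)))|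
          ≤ C * (1 / (N : ℝ)) ^ 4 := by
  obtain ⟨K, hK, hKper, hK0, hKs⟩ := exists_kernel hL hφ hφ' hneg hper
  obtain ⟨B, hB⟩ := id hK
  refine ⟨K, B, hK, hKs, fun i α N hN => ?_⟩
  have h1 := trapezoid_periodic (hB (i, α)) (hKper (i, α)) hN
  have hN0 : (0 : ℝ) < N := by exact_mod_cast hN
  rw [Finset.range_eq_Ico, Finset.sum_eq_sum_Ico_succ_bot (by omega : 0 < N)] at h1
  have h2 : ∀ j ∈ Finset.Ico (0 + 1) N, K (i, α) (j * (1 / (N : ℝ))) =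
      Real.pi / L * Real.cot (Real.pi * (φ i (α + j * (1 / (N : ℝ))) - φ i α) / L)
          - Real.pi / deriv (φ i) α * Real.cot (Real.pi * (j * (1 / (N : ℝ)))) := by
    intro j hj
    rw [Finset.mem_Ico] at hj
    refine hKs i α _ fun n hn => ?_
    have h3 : (j : ℤ) = n * N := by
      have : (j : ℝ) = n * N := by rw [← hn]; field_simp
      exact_mod_cast this
    have h4 : (0 : ℤ) < n * N := by omega
    have h5 : 0 < n := pos_of_mul_pos_left h4 (by positivity)
    nlinarith [hj.2]
  rw [Finset.sum_congr rfl h2, Finset.sum_sub_distrib, ← Finset.mul_sum (a := Real.pi / deriv (φ i) α),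
    zero_add, sum_cot_eq_zero, Nat.cast_zero, zero_mul, hK0] at h1
  convert h1 using 2
  ring

end Kernel

/-! ### The periodic Hilbert transform -/

/-- The Hilbert transform as an absolutely convergent integral. -/
def hilb (L : ℝ) (v : ℝ → ℝ) (x : ℝ) : ℝ :=
  1 / L * ∫ y in (0 : ℝ)..L, (v (x - y) - v x) * Real.cot (Real.pi * y / L)

theorem measurable_cot : Measurable Real.cot := by
  rw [show Real.cot = fun x => Real.cos x / Real.sin x from funext Real.cot_eq_cos_div_sin]
  fun_prop

theorem abs_cot_le {z : ℝ} (h0 : 0 < z) (h1 : z ≤ Real.pi / 2) : |Real.cot z| ≤ 1 / z := by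
  have hs : 0 < Real.sin z := Real.sin_pos_of_pos_of_lt_pi h0 (by linarith [Real.pi_pos])
  have hc : 0 ≤ Real.cos z := Real.cos_nonneg_of_neg_pi_div_two_le_of_le (by linarith) h1
  rw [Real.cot_eq_cos_div_sin, abs_of_nonneg (div_nonneg hc hs.le), div_le_div_iff₀ hs h0, one_mul]
  rcases hc.eq_or_lt with h | h
  · rw [← h]; simpa using hs.le
  · have h2 := Real.le_tan h0.le (lt_of_le_of_ne h1 fun h2 => by
      rw [h2, Real.cos_pi_div_two] at h; exact lt_irrefl _ h)
    rw [Real.tan_eq_sin_div_cos, le_div_iff₀ h] at h2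
    linarith

theorem abs_cot_mul_min_le {L y : ℝ} (hL : 0 < L) (hy : y ∈ Ioc 0 L) :
    min y (L - y) * |Real.cot (Real.pi * y / L)| ≤ L / Real.pi := by
  have hpi := Real.pi_pos
  rcases le_total y (L / 2) with h | h
  · have h1 := abs_cot_le (z := Real.pi * y / L) (by have := hy.1; positivity) (by
      rw [div_le_div_iff₀ hL two_pos]; nlinarith)
    calc _ ≤ y * (1 / (Real.pi * y / L)) :=
          mul_le_mul (min_le_left _ _) h1 (abs_nonneg _) hy.1.le
      _ = _ := by have := hy.1.ne'; field_simp
  · rcases hy.2.eq_or_lt with h2 | h2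
    · rw [h2, sub_self]
      have : min L 0 = 0 := min_eq_right hL.le
      rw [this, zero_mul]; positivity
    · have h3 : 0 < L - y := by linarith
      have h1 := abs_cot_le (z := Real.pi * (L - y) / L) (by positivity) (by
        rw [div_le_div_iff₀ hL two_pos]; nlinarith)
      have h4 : |Real.cot (Real.pi * (L - y) / L)| = |Real.cot (Real.pi * y / L)| := by
        rw [show Real.pi * (L - y) / L = -(Real.pi * y / L) + Real.pi by field_simp; ring,
          cot_periodic, cot_neg, abs_neg]
      rw [h4] at h1
      calc _ ≤ (L - y) * (1 / (Real.pi * (L - y) / L)) :=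
            mul_le_mul (min_le_right _ _) h1 (abs_nonneg _) h3.le
        _ = _ := by field_simp

theorem abs_sub_le_of_CB {B : ℝ} {v : ℝ → ℝ} (hv : CB 1 B v) (x y : ℝ) :
    |v x - v y| ≤ B * |x - y| := by
  simpa using Convex.norm_image_sub_le_of_norm_deriv_le (f := v) (s := univ) (C := B)
    (fun x _ => hv.1 x) (fun x _ => hv.2.2.bound x) convex_univ (mem_univ y) (mem_univ x)

section

variable {L B : ℝ} {v : ℝ → ℝ}

theorem abs_shift_sub_le_min (hv : CB 1 B v) (hper : ∀ x, v (x + L) = v x) (x : ℝ) {y : ℝ}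
    (hy : y ∈ Ioc 0 L) : |v (x - y) - v x| ≤ B * min y (L - y) := by
  have hB := hv.nonneg
  rcases le_total y (L - y) with h | h
  · rw [min_eq_left h]
    refine (abs_sub_le_of_CB hv _ _).trans_eq ?_
    rw [sub_sub_cancel_left, abs_neg, abs_of_pos hy.1]
  · rw [min_eq_right h, ← hper (x - y)]
    refine (abs_sub_le_of_CB hv _ _).trans_eq ?_
    rw [show x - y + L - x = L - y by ring, abs_of_nonneg (by linarith [hy.2])]

theorem abs_hilb_integrand_le (hL : 0 < L) (hv : CB 1 B v) (hper : ∀ x, v (x + L) = v x) (x : ℝ)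
    {y : ℝ} (hy : y ∈ Ioc 0 L) :
    |(v (x - y) - v x) * Real.cot (Real.pi * y / L)| ≤ B * (L / Real.pi) := by
  rw [abs_mul]
  calc _ ≤ B * min y (L - y) * |Real.cot (Real.pi * y / L)| := by
        gcongr; exact abs_shift_sub_le_min hv hper x hy
    _ ≤ _ := by
        rw [mul_assoc]
        exact mul_le_mul_of_nonneg_left (abs_cot_mul_min_le hL hy) hv.nonneg

theorem aestronglyMeasurable_hilb_integrand (hv : Continuous v) (x : ℝ) (μ : Measure ℝ) :
    AEStronglyMeasurable (fun y => (v (x - y) - v x) * Real.cot (Real.pi * y / L)) μ := by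
  have h := measurable_cot
  have h1 : Measurable fun y => (v (x - y) - v x) * Real.cot (Real.pi * y / L) :=
    (Continuous.measurable (by fun_prop)).mul (h.comp (by fun_prop))
  exact h1.aestronglyMeasurable

theorem intervalIntegrable_hilb_integrand (hL : 0 < L) (hv : CB 1 B v)
    (hper : ∀ x, v (x + L) = v x) (x : ℝ) :
    IntervalIntegrable (fun y => (v (x - y) - v x) * Real.cot (Real.pi * y / L)) volume 0 L := by
  rw [intervalIntegrable_iff_integrableOn_Ioc_of_le hL.le]
  refine Measure.integrableOn_of_bounded (M := B * (L / Real.pi)) (by simp)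
    (aestronglyMeasurable_hilb_integrand hv.continuous x _) ?_
  exact (ae_restrict_iff' measurableSet_Ioc).2 (ae_of_all _ fun y hy =>
    abs_hilb_integrand_le hL hv hper x hy)

theorem abs_hilb_le (hL : 0 < L) (hv : CB 1 B v) (hper : ∀ x, v (x + L) = v x) (x : ℝ) :
    |hilb L v x| ≤ B * (L / Real.pi) := by
  have := intervalIntegral.norm_integral_le_of_norm_le_const (a := 0) (b := L)
    (C := B * (L / Real.pi)) (f := fun y => (v (x - y) - v x) * Real.cot (Real.pi * y / L))
    fun y hy => by
      rw [uIoc_of_le hL.le] at hy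
      exact abs_hilb_integrand_le hL hv hper x hy
  rw [hilb, abs_mul, abs_of_pos (by positivity)]
  rw [sub_zero, abs_of_pos hL, Real.norm_eq_abs] at this
  calc _ ≤ 1 / L * (B * (L / Real.pi) * L) := by gcongr
    _ = _ := by field_simp

theorem hasDerivAt_hilb (hL : 0 < L) (hv : CB 2 B v) (hper : ∀ x, v (x + L) = v x) (x : ℝ) :
    HasDerivAt (hilb L v) (hilb L (deriv v) x) x := by
  have hper' : ∀ x, deriv v (x + L) = deriv v x := fun x => by
    rw [← deriv_comp_add_const, show (fun x => v (x + L)) = v from funext hper]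
  have := intervalIntegral.hasDerivAt_integral_of_dominated_loc_of_deriv_le (𝕜 := ℝ)
    (μ := volume) (a := 0) (b := L) (x₀ := x) (s := univ) (bound := fun _ => B * (L / Real.pi))
    (F := fun x y => (v (x - y) - v x) * Real.cot (Real.pi * y / L))
    (F' := fun x y => (deriv v (x - y) - deriv v x) * Real.cot (Real.pi * y / L))
    Filter.univ_mem
    (Eventually.of_forall fun x => aestronglyMeasurable_hilb_integrand hv.continuous x _)
    (intervalIntegrable_hilb_integrand hL hv.of_succ hper x)
    (aestronglyMeasurable_hilb_integrand hv.2.2.continuous x _)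
    (ae_of_all _ fun y hy x _ => by
      rw [uIoc_of_le hL.le] at hy
      exact abs_hilb_integrand_le hL hv.2.2 hper' x hy)
    (by simp) (ae_of_all _ fun y _ x _ => ?_)
  · exact this.2.const_mul (1 / L)
  · exact (((hv.1 (x - y)).hasDerivAt.comp_sub_const x y).sub (hv.1 x).hasDerivAt).mul_const _

theorem deriv_periodic (hper : ∀ x, v (x + L) = v x) (x : ℝ) : deriv v (x + L) = deriv v x := by
  rw [← deriv_comp_add_const, show (fun x => v (x + L)) = v from funext hper]

theorem CB.hilb {k : ℕ} (hL : 0 < L) (hv : CB (k + 1) B v) (hper : ∀ x, v (x + L) = v x) :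
    CB k (B * (L / Real.pi)) (hilb L v) := by
  induction k generalizing v with
  | zero =>
    refine ⟨?_, abs_hilb_le hL hv hper⟩
    unfold StepFlow.hilb
    refine continuous_const.mul (intervalIntegral.continuous_of_dominated_interval
      (bound := fun _ => B * (L / Real.pi))
      (fun x => aestronglyMeasurable_hilb_integrand hv.continuous x _)
      (fun x => ae_of_all _ fun y hy => ?_) (by simp) (ae_of_all _ fun y _ => ?_))
    · rw [uIoc_of_le hL.le] at hy
      exact abs_hilb_integrand_le hL hv hper x hy
    · have := hv.continuous
      fun_prop
  | succ k ih =>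
    exact of_hasDerivAt (hasDerivAt_hilb hL (hv.of_le (by omega)) hper)
      (abs_hilb_le hL (hv.of_le (by omega)) hper) (ih hv.2.2 (deriv_periodic hper))

theorem integral_cot_symm (δ : ℝ) (hL : L ≠ 0) :
    ∫ s in δ..(L - δ), Real.cot (Real.pi * s / L) = 0 := by
  have h := intervalIntegral.integral_comp_sub_left (a := δ) (b := L - δ)
    (fun s => Real.cot (Real.pi * s / L)) L
  rw [sub_sub_cancel] at h
  have h2 : ∀ s, Real.cot (Real.pi * (L - s) / L) = -Real.cot (Real.pi * s / L) := fun s => by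
    rw [show Real.pi * (L - s) / L = -(Real.pi * s / L) + Real.pi by field_simp; ring,
      cot_periodic, cot_neg]
  simp only [h2, intervalIntegral.integral_neg] at h
  linarith

theorem continuousOn_cot_scaled (hL : 0 < L) :
    ContinuousOn (fun s => Real.cot (Real.pi * s / L)) (Ioo 0 L) := by
  have : ∀ s ∈ Ioo 0 L, Real.sin (Real.pi * s / L) ≠ 0 := fun s hs =>
    (Real.sin_pos_of_pos_of_lt_pi (by have := hs.1; have := Real.pi_pos; positivity) (by
      rw [div_lt_iff₀ hL]; exact mul_lt_mul_of_pos_left hs.2 Real.pi_pos)).ne'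
  simp only [Real.cot_eq_cos_div_sin]
  exact ContinuousOn.div (by fun_prop) (by fun_prop) this

theorem uIcc_subset_Ioo_of_mem {p q : ℝ} (hp : p ∈ Ioo 0 L) (hq : q ∈ Ioo 0 L) :
    uIcc p q ⊆ Ioo 0 L := fun _ hx =>
  ⟨(lt_min hp.1 hq.1).trans_le hx.1, hx.2.trans_lt (max_lt hp.2 hq.2)⟩

theorem integral_mul_cot_split (hL : 0 < L) (hv : Continuous v) (x : ℝ) {p q : ℝ}
    (hp : p ∈ Ioo 0 L) (hq : q ∈ Ioo 0 L) :
    ∫ s in p..q, v (x - s) * Real.cot (Real.pi * s / L) =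
      (∫ s in p..q, (v (x - s) - v x) * Real.cot (Real.pi * s / L))
        + v x * ∫ s in p..q, Real.cot (Real.pi * s / L) := by
  have hc := (continuousOn_cot_scaled hL).mono (uIcc_subset_Ioo_of_mem hp hq)
  rw [← intervalIntegral.integral_const_mul, ← intervalIntegral.integral_add]
  · refine intervalIntegral.integral_congr fun s _ => ?_
    ring
  · exact (ContinuousOn.mul (by fun_prop) hc).intervalIntegrable
  · exact (continuousOn_const.mul hc).intervalIntegrable

theorem tendsto_integral_endpoints {f : ℝ → ℝ} (hL : 0 < L) (hf : IntervalIntegrable f volume 0 L)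
    {l : Filter ℝ} {p q : ℝ → ℝ} (hp : Tendsto p l (𝓝 0)) (hq : Tendsto q l (𝓝 L))
    (hp' : ∀ᶠ δ in l, p δ ∈ Ioo 0 L) (hq' : ∀ᶠ δ in l, q δ ∈ Ioo 0 L) :
    Tendsto (fun δ => ∫ y in p δ..q δ, f y) l (𝓝 (∫ y in (0 : ℝ)..L, f y)) := by
  have hcont := intervalIntegral.continuousOn_primitive_interval (a := 0) (b := L) (μ := volume)
    (f := f) (by
      rw [uIcc_of_le hL.le, integrableOn_Icc_iff_integrableOn_Ioc]
      exact (intervalIntegrable_iff_integrableOn_Ioc_of_le hL.le).1 hf)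
  rw [uIcc_of_le hL.le] at hcont
  have h1 : Tendsto (fun δ => ∫ y in (0 : ℝ)..p δ, f y) l (𝓝 (∫ y in (0 : ℝ)..0, f y)) :=
    (hcont 0 ⟨le_rfl, hL.le⟩).tendsto.comp (tendsto_nhdsWithin_iff.2
      ⟨hp, hp'.mono fun _ h => Ioo_subset_Icc_self h⟩)
  have h2 : Tendsto (fun δ => ∫ y in (0 : ℝ)..q δ, f y) l (𝓝 (∫ y in (0 : ℝ)..L, f y)) :=
    (hcont L ⟨hL.le, le_rfl⟩).tendsto.comp (tendsto_nhdsWithin_iff.2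
      ⟨hq, hq'.mono fun _ h => Ioo_subset_Icc_self h⟩)
  have h3 := h2.sub h1
  rw [intervalIntegral.integral_same, sub_zero] at h3
  refine h3.congr' ?_
  filter_upwards [hp', hq'] with δ h4 h5
  refine intervalIntegral.integral_interval_sub_left (hf.mono_set ?_) (hf.mono_set ?_) <;>
  · rw [uIcc_of_le hL.le]
    exact uIcc_subset_Icc ⟨le_rfl, hL.le⟩ (Ioo_subset_Icc_self ‹_›)

theorem eventually_pos_lt (hL : 0 < L) : ∀ᶠ δ in 𝓝[>] (0 : ℝ), δ ∈ Ioo 0 L :=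
  Ioo_mem_nhdsGT hL

theorem hilbertTransform_eq_hilb (hL : 0 < L) (hv : CB 1 B v) (hper : ∀ x, v (x + L) = v x)
    (x : ℝ) : hilbertTransform L v x = hilb L v x := by
  rw [hilbertTransform, hilb]
  congr 1
  have ht : Tendsto (fun δ : ℝ => δ) (𝓝[>] 0) (𝓝 0) := tendsto_id.mono_left nhdsWithin_le_nhds
  have hp := eventually_pos_lt hL
  have hq : ∀ᶠ δ in 𝓝[>] (0 : ℝ), L - δ ∈ Ioo 0 L := by
    filter_upwards [hp] with δ hδ
    exact ⟨by linarith [hδ.2], by linarith [hδ.1]⟩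
  refine ((tendsto_integral_endpoints hL (intervalIntegrable_hilb_integrand hL hv hper x) ht
    (q := fun δ => L - δ) (by simpa using ht.const_sub L) hp hq).congr' ?_).limUnder_eq
  filter_upwards [hp, hq] with δ h1 h2
  rw [integral_mul_cot_split hL hv.continuous x h1 h2, integral_cot_symm δ hL.ne', mul_zero, add_zero]

theorem integral_cot_eq (hL : 0 < L) {p q : ℝ} (hp : p ∈ Ioo 0 L) (hq : q ∈ Ioo 0 L) :
    ∫ s in p..q, Real.cot (Real.pi * s / L)
      = L / Real.pi * (Real.log (Real.sin (Real.pi * q / L)) - Real.log (Real.sin (Real.pi * p / L))) := by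
  have hpi := Real.pi_pos
  have hd : ∀ s ∈ uIcc p q, HasDerivAt (fun s => L / Real.pi * Real.log (Real.sin (Real.pi * s / L)))
      (Real.cot (Real.pi * s / L)) s := by
    intro s hs
    have hs' := uIcc_subset_Ioo_of_mem hp hq hs
    have hsin : Real.sin (Real.pi * s / L) ≠ 0 :=
      (Real.sin_pos_of_pos_of_lt_pi (by have := hs'.1; positivity) (by
        rw [div_lt_iff₀ hL]; exact mul_lt_mul_of_pos_left hs'.2 hpi)).ne'
    have h1 : HasDerivAt (fun s => Real.pi * s / L) (Real.pi / L) s := by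
      simpa using ((hasDerivAt_id s).const_mul Real.pi).div_const L
    refine (((h1.sin).log hsin).const_mul (L / Real.pi)).congr_deriv ?_
    rw [Real.cot_eq_cos_div_sin]
    field_simp
  rw [intervalIntegral.integral_eq_sub_of_hasDerivAt hd
    ((continuousOn_cot_scaled hL).mono (uIcc_subset_Ioo_of_mem hp hq)).intervalIntegrable]
  ring

end

/-- In the variable `α` the regularized integral of the cotangent kernel is the Hilbert transform
of the slope of the inverse function. -/
theorem integral_kernel_eq_hilb {L B : ℝ} {u φ K : ℝ → ℝ} {α : ℝ} (hL : 0 < L)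
    (hu : CB 1 B (deriv u)) (huper : ∀ x, deriv u (x + L) = deriv u x)
    (hφ : ∀ α, HasDerivAt φ (1 / deriv u (φ α)) α) (hφ' : Continuous (deriv φ))
    (hneg : ∀ x, deriv u x < 0)
    (hper : ∀ x, φ (x + 1) = φ x - L) (hK : Continuous K)
    (hKs : ∀ s : ℝ, (∀ n : ℤ, s ≠ n) → K s =
        Real.pi / L * Real.cot (Real.pi * (φ (α + s) - φ α) / L)
          - Real.pi / deriv φ α * Real.cot (Real.pi * s)) :
    ∫ s in (0 : ℝ)..1, K s = Real.pi * hilb L (deriv u) (φ α) := by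
  have hpi := Real.pi_pos
  have hφneg : ∀ x, deriv φ x < 0 := fun x => by
    rw [(hφ x).deriv]; exact one_div_neg.2 (hneg _)
  have hanti : StrictAnti φ := strictAnti_of_deriv_neg hφneg
  have hφc : Continuous φ := continuous_iff_continuousAt.2 fun x => (hφ x).continuousAt
  have ht : Tendsto (fun δ : ℝ => δ) (𝓝[>] 0) (𝓝 0) := tendsto_id.mono_left nhdsWithin_le_nhds
  have hsmall : ∀ᶠ δ in 𝓝[>] (0 : ℝ), δ ∈ Ioo 0 (1 / 2) := Ioo_mem_nhdsGT (by norm_num)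
  set p := fun δ => φ α - φ (α + δ) with hpdef
  set q := fun δ => φ α - φ (α + (1 - δ)) with hqdef
  have hmem : ∀ s ∈ Ioo (0 : ℝ) 1, φ α - φ (α + s) ∈ Ioo 0 L := fun s hs => by
    have h1 := hanti (show α < α + s by linarith [hs.1])
    have h2 := hanti (show α + s < α + 1 by linarith [hs.2])
    rw [hper] at h2
    exact ⟨by linarith, by linarith⟩
  have hp' : ∀ᶠ δ in 𝓝[>] (0 : ℝ), p δ ∈ Ioo 0 L := by
    filter_upwards [hsmall] with δ hδ
    exact hmem δ ⟨hδ.1, by linarith [hδ.2]⟩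
  have hq' : ∀ᶠ δ in 𝓝[>] (0 : ℝ), q δ ∈ Ioo 0 L := by
    filter_upwards [hsmall] with δ hδ
    exact hmem _ ⟨by linarith [hδ.2], by linarith [hδ.1]⟩
  have hpt : Tendsto p (𝓝[>] 0) (𝓝 0) := by
    have : Continuous p := by fun_prop
    have h := (this.tendsto 0).comp ht
    simpa [hpdef, Function.comp_def] using h
  have hqt : Tendsto q (𝓝[>] 0) (𝓝 L) := by
    have : Continuous q := by fun_prop
    have h := (this.tendsto 0).comp ht
    simpa [hqdef, Function.comp_def, hper] using h
  -- the truncated integral after the change of variables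
  have hcv : ∀ᶠ δ in 𝓝[>] (0 : ℝ), ∫ s in δ..(1 - δ), K s =
      Real.pi / L * ((∫ y in p δ..q δ, (deriv u (φ α - y) - deriv u (φ α)) * Real.cot (Real.pi * y / L))
        + deriv u (φ α) * ∫ y in p δ..q δ, Real.cot (Real.pi * y / L)) := by
    filter_upwards [hsmall, hp', hq'] with δ hδ h1 h2
    have hsub : uIcc δ (1 - δ) ⊆ Ioo (0 : ℝ) 1 :=
      uIcc_subset_Ioo_of_mem ⟨hδ.1, by linarith [hδ.2]⟩ ⟨by linarith [hδ.2], by linarith [hδ.1]⟩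
    have hcot : ∫ s in δ..(1 - δ), Real.cot (Real.pi * s) = 0 := by
      simpa using integral_cot_symm (L := 1) δ one_ne_zero
    have hint : IntervalIntegrable (fun s => Real.pi / deriv φ α * Real.cot (Real.pi * s))
        volume δ (1 - δ) := by
      have := (continuousOn_cot_scaled (L := 1) one_pos).mono hsub
      simp only [div_one] at this
      exact (continuousOn_const.mul this).intervalIntegrable
    have e1 : ∫ s in δ..(1 - δ), K s = ∫ s in δ..(1 - δ),
        (K s + Real.pi / deriv φ α * Real.cot (Real.pi * s)) := by
      rw [intervalIntegral.integral_add (hK.intervalIntegrable _ _) hint,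
        intervalIntegral.integral_const_mul, hcot, mul_zero, add_zero]
    have e2 : ∫ s in δ..(1 - δ), (K s + Real.pi / deriv φ α * Real.cot (Real.pi * s))
        = ∫ s in δ..(1 - δ), ((fun y => Real.pi / L * (deriv u (φ α - y) * Real.cot (Real.pi * y / L)))
          ∘ fun s => φ α - φ (α + s)) s * (-deriv φ (α + s)) := by
      refine intervalIntegral.integral_congr fun s hs => ?_
      have hs' := hsub hs
      have hsn : ∀ n : ℤ, s ≠ n := fun n hn => by
        rw [hn] at hs'
        have h3 : (0 : ℤ) < n := by exact_mod_cast hs'.1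
        have h4 : n < (1 : ℤ) := by exact_mod_cast hs'.2
        omega
      simp only [Function.comp]
      rw [hKs s hsn, (hφ (α + s)).deriv, sub_sub_cancel,
        show Real.pi * (φ (α + s) - φ α) / L = -(Real.pi * (φ α - φ (α + s)) / L) by ring, cot_neg]
      have := (hneg (φ (α + s))).ne
      field_simp
      ring
    rw [e1, e2, intervalIntegral.integral_comp_mul_deriv'' (f := fun s => φ α - φ (α + s))]
    · rw [intervalIntegral.integral_const_mul, integral_mul_cot_split hL hu.continuous _ h1 h2]
    · fun_prop
    · intro s _
      exact (((hφ (α + s)).differentiableAt.hasDerivAt.comp_const_add α s).const_sub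
        (φ α)).hasDerivWithinAt
    · fun_prop
    · have hc : ContinuousOn (fun y => deriv u (φ α - y) * Real.cot (Real.pi * y / L)) (Ioo 0 L) :=
        ContinuousOn.mul (by have := hu.continuous; fun_prop) (continuousOn_cot_scaled hL)
      refine (continuousOn_const.mul hc).mono ?_
      rintro _ ⟨s, hs, rfl⟩
      exact hmem s (hsub hs)
  have hlog : Tendsto (fun δ => ∫ y in p δ..q δ, Real.cot (Real.pi * y / L)) (𝓝[>] 0) (𝓝 0) := by
    have hA : ∀ (f : ℝ → ℝ) (c : ℝ), f 0 = 0 → HasDerivAt f c 0 → c ≠ 0 →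
        Tendsto (fun δ => Real.log (δ⁻¹ * f δ)) (𝓝[>] 0) (𝓝 (Real.log c)) := by
      intro f c h0 h1 h2
      have := h1.tendsto_slope_zero_right
      simp only [zero_add, h0, sub_zero, smul_eq_mul] at this
      exact this.log h2
    have hc : -deriv φ α * (Real.pi / L) ≠ 0 :=
      (mul_pos (neg_pos.2 (hφneg α)) (by positivity)).ne'
    have hd1 : HasDerivAt (fun δ => Real.sin (Real.pi * p δ / L)) (-deriv φ α * (Real.pi / L)) 0 := by
      have h1 : HasDerivAt p (-deriv φ α) 0 := by
        have := (hφ (α + 0)).differentiableAt.hasDerivAt.comp_const_add α 0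
        rw [add_zero] at this
        exact this.const_sub (φ α)
      refine ((h1.const_mul Real.pi).div_const L).sin.congr_deriv ?_
      simp [hpdef]; ring
    have hd2 : HasDerivAt (fun δ => Real.sin (Real.pi * (φ (α - δ) - φ α) / L))
        (-deriv φ α * (Real.pi / L)) 0 := by
      have h1 : HasDerivAt (fun δ => φ (α - δ) - φ α) (-deriv φ α) 0 := by
        have := (hφ (α - 0)).differentiableAt.hasDerivAt.comp_const_sub α 0
        rw [sub_zero] at this
        exact this.sub_const (φ α)
      refine ((h1.const_mul Real.pi).div_const L).sin.congr_deriv ?_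
      simp; ring
    have h3 := ((hA _ _ (by simp) hd2 hc).sub (hA _ _ (by simp [hpdef]) hd1 hc)).const_mul (L / Real.pi)
    rw [sub_self, mul_zero] at h3
    refine h3.congr' ?_
    filter_upwards [hsmall, hp', hq'] with δ hδ h1 h2
    have hsinpos : ∀ y ∈ Ioo 0 L, Real.sin (Real.pi * y / L) ≠ 0 := fun y hy =>
      (Real.sin_pos_of_pos_of_lt_pi (by have := hy.1; positivity) (by
        rw [div_lt_iff₀ hL]; exact mul_lt_mul_of_pos_left hy.2 hpi)).ne'
    have e : Real.sin (Real.pi * (φ (α - δ) - φ α) / L) = Real.sin (Real.pi * q δ / L) := by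
      have h4 := hper (α - δ)
      rw [show α - δ + 1 = α + (1 - δ) by ring] at h4
      rw [← Real.sin_pi_sub]
      congr 1
      simp only [hqdef]
      rw [h4]
      field_simp
      ring
    rw [integral_cot_eq hL h1 h2, e, Real.log_mul (inv_ne_zero hδ.1.ne') (hsinpos _ h2),
      Real.log_mul (inv_ne_zero hδ.1.ne') (hsinpos _ h1)]
    ring
  have hlim1 : Tendsto (fun δ => ∫ s in δ..(1 - δ), K s) (𝓝[>] 0) (𝓝 (∫ s in (0 : ℝ)..1, K s)) := by
    have hs1 : ∀ᶠ δ in 𝓝[>] (0 : ℝ), δ ∈ Ioo 0 1 := Ioo_mem_nhdsGT one_pos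
    refine tendsto_integral_endpoints one_pos (hK.intervalIntegrable _ _) ht
      (q := fun δ => 1 - δ) (by simpa using ht.const_sub 1) hs1 ?_
    filter_upwards [hs1] with δ hδ
    exact ⟨by linarith [hδ.2], by linarith [hδ.1]⟩
  have hlim2 := ((tendsto_integral_endpoints hL
    (intervalIntegrable_hilb_integrand hL hu huper (φ α)) hpt hqt hp' hq').add
    (hlog.const_mul (deriv u (φ α)))).const_mul (Real.pi / L)
  have := tendsto_nhds_unique (hlim1.congr' hcv) hlim2
  rw [this, hilb]
  ring

/-! ### Summation over the periodic images -/

theorem tendsto_cot_partial_sums {L d : ℝ} (hL : 0 < L) (hd0 : 0 ≤ d) (hdL : d < L) :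
    Tendsto (fun Q : ℕ => ∑ q ∈ Finset.range Q, (1 / (d + q * L) + 1 / (d - (q + 1 : ℕ) * L)))
      atTop (𝓝 (Real.pi / L * Real.cot (Real.pi * d / L))) := by
  have htel : ∀ Q : ℕ, ∑ q ∈ Finset.range Q, (1 / (d + q * L) + 1 / (d - (q + 1 : ℕ) * L))
      = 1 / d + ∑ q ∈ Finset.range Q, (1 / (d - (q + 1 : ℕ) * L) + 1 / (d + (q + 1 : ℕ) * L))
        - 1 / (d + Q * L) := by
    intro Q
    induction Q with
    | zero => simp
    | succ Q ih => rw [Finset.sum_range_succ, ih, Finset.sum_range_succ]; ring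
  have hvan : Tendsto (fun Q : ℕ => 1 / (d + Q * L)) atTop (𝓝 0) := by
    simp only [one_div]
    exact tendsto_inv_atTop_zero.comp (tendsto_atTop_add_const_left _ _
      (tendsto_natCast_atTop_atTop.atTop_mul_const hL))
  simp only [htel]
  rcases hd0.eq_or_lt with rfl | hd
  · have h0 : ∀ q : ℕ, (1 / (0 - (q + 1 : ℕ) * L) + 1 / (0 + (q + 1 : ℕ) * L)) = 0 := fun q => by
      rw [zero_sub, zero_add, one_div_neg_eq_neg_one_div, neg_add_cancel]
    simp only [h0, Finset.sum_const_zero]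
    simpa [Real.cot_eq_cos_div_sin] using hvan.neg
  · have hx : ((d / L : ℝ) : ℂ) ∈ Complex.integerComplement := by
      rintro ⟨n, hn⟩
      have hn' : (n : ℝ) = d / L := by exact_mod_cast hn
      have h1 : (0 : ℝ) < n := by rw [hn']; positivity
      have h2 : (n : ℝ) < 1 := by rw [hn', div_lt_one hL]; exact hdL
      have h1' : 0 < n := by exact_mod_cast h1
      have h2' : n < 1 := by exact_mod_cast h2
      omega
    have h := (tendsto_logDeriv_euler_cot_sub hx)
    have h' : Tendsto (fun n : ℕ => ∑ j ∈ Finset.range n,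
        (1 / (d / L - (j + 1 : ℕ)) + 1 / (d / L + (j + 1 : ℕ)))) atTop
        (𝓝 (Real.pi * Real.cot (Real.pi * (d / L)) - 1 / (d / L))) := by
      rw [← Filter.tendsto_ofReal_iff]
      convert h using 2
      · simp [cotTerm]
      · simp
    have h2 := ((h'.const_mul (1 / L)).const_add (1 / d)).sub hvan
    rw [sub_zero] at h2
    convert h2 using 2 with Q
    · rw [Finset.mul_sum]
      congr 2
      refine Finset.sum_congr rfl fun q _ => ?_
      rw [mul_add]
      congr 1 <;> rw [one_div_mul_one_div] <;> congr 1 <;> field_simp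
    · rw [mul_div_assoc]
      field_simp
      ring

section

variable {L : ℝ} {N : ℕ} {d : ℤ → ℝ}

theorem shift_mul (hper : ∀ n, d (n + N) = d n + L) (n q : ℤ) : d (n + q * N) = d n + q * L := by
  have h : Function.Periodic (fun n : ℤ => d n - n * (L / N)) (N : ℤ) := fun n => by
    rcases Nat.eq_zero_or_pos N with rfl | h0
    · simp
    · have : (N : ℝ) ≠ 0 := by positivity
      simp only [hper]; push_cast; field_simp; ring
  rcases Nat.eq_zero_or_pos N with rfl | h0
  · have := hper 0
    have hL : L = 0 := by simpa using this
    simp [hL]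
  · have h1 := h.int_mul q n
    have : (N : ℝ) ≠ 0 := by positivity
    push_cast at h1
    field_simp at h1
    have h2 : (N : ℝ) * d (n + q * N) = N * (d n + q * L) := by linarith
    exact mul_left_cancel₀ this h2

theorem sum_range_mul_block (g : ℕ → ℝ) (Q N : ℕ) :
    ∑ m ∈ Finset.range (Q * N), g m = ∑ q ∈ Finset.range Q, ∑ r ∈ Finset.range N, g (q * N + r) := by
  induction Q with
  | zero => simp
  | succ Q ih => rw [Nat.succ_mul, Finset.sum_range_add, ih, Finset.sum_range_succ]

theorem sum_pairs_block (hper : ∀ n, d (n + N) = d n + L) (h0 : d 0 = 0) (Q : ℕ) :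
    ∑ m ∈ Finset.range (Q * N), (1 / d (m + 1) + 1 / d (-(m + 1))) =
      ∑ r ∈ Finset.range N, ∑ q ∈ Finset.range Q, (1 / (d r + q * L) + 1 / (d r - (q + 1 : ℕ) * L))
        + 1 / (Q * L) := by
  have h1 : ∑ m ∈ Finset.range (Q * N), 1 / d (m + 1)
      = ∑ m ∈ Finset.range (Q * N), 1 / d m + 1 / (Q * L) := by
    have e := Finset.sum_range_succ' (fun m : ℕ => 1 / d m) (Q * N)
    rw [Finset.sum_range_succ] at e
    have h2 : d ((Q * N : ℕ) : ℤ) = Q * L := by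
      have := shift_mul hper 0 Q
      rw [h0] at this
      push_cast at this ⊢
      simpa using this
    rw [h2] at e
    push_cast at e
    rw [h0] at e
    simpa using e.symm
  have h2 : ∑ m ∈ Finset.range (Q * N), 1 / d m
      = ∑ q ∈ Finset.range Q, ∑ r ∈ Finset.range N, 1 / (d r + q * L) := by
    rw [sum_range_mul_block]
    refine Finset.sum_congr rfl fun q _ => Finset.sum_congr rfl fun r _ => ?_
    have := shift_mul hper r q
    push_cast at this ⊢
    rw [← this, add_comm]
  have h3 : ∑ m ∈ Finset.range (Q * N), 1 / d (-(m + 1))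
      = ∑ q ∈ Finset.range Q, ∑ r ∈ Finset.range N, 1 / (d r - (q + 1 : ℕ) * L) := by
    rw [sum_range_mul_block (fun m => 1 / d (-(m + 1)))]
    refine Finset.sum_congr rfl fun q _ => ?_
    rw [← Finset.sum_range_reflect]
    refine Finset.sum_congr rfl fun r hr => ?_
    rw [Finset.mem_range] at hr
    have := shift_mul hper r (-(q + 1 : ℕ))
    have e : (-(((q * N + (N - 1 - r) : ℕ) : ℤ) + 1)) = (r : ℤ) + (-((q + 1 : ℕ) : ℤ)) * N := by
      have : ((N - 1 - r : ℕ) : ℤ) = N - 1 - r := by omega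
      push_cast [this]
      ring
    rw [e, this]
    push_cast
    ring_nf
  rw [Finset.sum_add_distrib, h1, h2, h3, Finset.sum_comm (s := Finset.range Q),
    Finset.sum_comm (s := Finset.range Q), add_right_comm, ← Finset.sum_add_distrib]
  congr 1
  exact Finset.sum_congr rfl fun r _ => Finset.sum_add_distrib.symm

theorem summable_pairs (hL : 0 < L) (hN : 1 ≤ N) (hper : ∀ n, d (n + N) = d n + L) (h0 : d 0 = 0)
    (hmono : StrictMono d) :
    Summable fun m : ℕ => (1 / d (m + 1) + 1 / d (-(m + 1))) := by
  have hN0 : (0 : ℝ) < N := by exact_mod_cast hN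
  rw [← summable_nat_add_iff N]
  have hs : Summable fun m : ℕ => 4 * N ^ 2 / L * (1 / ((m : ℝ) ^ 2)) :=
    (Real.summable_one_div_nat_pow.2 one_lt_two).mul_left _
  refine Summable.of_norm_bounded ((summable_nat_add_iff (N + 1)).2 hs) fun m => ?_
  set n : ℕ := m + N + 1 with hn
  set q := n / N with hq
  set r := n % N with hr
  have hnqr : (n : ℤ) = (r : ℤ) + (q : ℤ) * N := by
    have := Nat.mod_add_div n N
    rw [← hq, ← hr] at this
    rw [← this]; push_cast; ring
  have hrN : r < N := Nat.mod_lt _ (by omega)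
  have hq1 : 1 ≤ q := (Nat.le_div_iff_mul_le (by omega)).2 (by omega)
  have hdn : d n = d r + q * L := by
    rw [hnqr]; exact_mod_cast shift_mul hper r q
  have hdn' : d (-n) = d (-r) - q * L := by
    have := shift_mul hper (-r) (-q)
    rw [hnqr, show -((r : ℤ) + (q : ℤ) * N) = -r + -q * N by ring, this]
    push_cast; ring
  have hdr : 0 ≤ d r := h0 ▸ hmono.monotone (by positivity)
  have hdrL : d r ≤ L := by
    have h1 : d (0 + N) = L := by rw [hper, h0, zero_add]
    rw [← h1]
    exact hmono.monotone (by omega)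
  have hdr' : d (-r) ≤ 0 := h0 ▸ hmono.monotone (by omega)
  have hdrL' : -L ≤ d (-r) := by
    have h1 := hper (-N)
    rw [neg_add_cancel, h0] at h1
    have : d (-N) ≤ d (-r) := hmono.monotone (by omega)
    linarith
  have hqL : 0 < q * L := by positivity
  have hnq : (n : ℝ) ≤ 2 * (q * N) := by
    have h1 : (n : ℝ) = r + q * N := by exact_mod_cast hnqr
    have h2 : (r : ℝ) ≤ N := by exact_mod_cast hrN.le
    have h3 : (1 : ℝ) ≤ q := by exact_mod_cast hq1
    nlinarith
  have e1 : ((m + N : ℕ) : ℤ) + 1 = n := by push_cast [hn]; ring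
  rw [e1, Real.norm_eq_abs]
  have hp1 : q * L ≤ d n := by linarith
  have hp2 : q * L ≤ -d (-n) := by linarith
  have hsum : |d n + d (-n)| ≤ L := by
    rw [hdn, hdn', abs_le]
    constructor <;> linarith
  have e2 : 1 / d n + 1 / d (-n) = -((d n + d (-n)) / (d n * -d (-n))) := by
    have : d n ≠ 0 := by linarith
    have : d (-n) ≠ 0 := by linarith
    field_simp
    ring
  rw [e2, abs_neg, abs_div, abs_of_pos (mul_pos (by linarith) (by linarith) : 0 < d n * -d (-n))]
  have hn0 : (0 : ℝ) < n := by positivity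
  calc |d n + d (-n)| / (d n * -d (-n)) ≤ L / ((q * L) * (q * L)) :=
        div_le_div₀ hL.le hsum (by positivity) (mul_le_mul hp1 hp2 hqL.le (by linarith))
    _ = 4 * N ^ 2 / L * (1 / (2 * (q * N)) ^ 2) := by
        have : (q : ℝ) ≠ 0 := by positivity
        field_simp; norm_num
    _ ≤ 4 * N ^ 2 / L * (1 / (n : ℝ) ^ 2) := by gcongr
    _ = _ := by
        rw [hn]; push_cast; ring_nf

theorem tsum_pairs_eq_cot_sum (hL : 0 < L) (hN : 1 ≤ N) (hper : ∀ n, d (n + N) = d n + L)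
    (h0 : d 0 = 0) (hmono : StrictMono d) :
    ∑' m : ℕ, (1 / d (m + 1) + 1 / d (-(m + 1)))
      = ∑ r ∈ Finset.Ico 1 N, Real.pi / L * Real.cot (Real.pi * d r / L) := by
  have hs := (summable_pairs hL hN hper h0 hmono).hasSum.tendsto_sum_nat
  have hmul : Tendsto (fun Q : ℕ => Q * N) atTop atTop :=
    tendsto_id.atTop_mul_const' (by omega)
  have h1 := hs.comp hmul
  have hvan : Tendsto (fun Q : ℕ => 1 / ((Q : ℝ) * L)) atTop (𝓝 0) := by
    simp only [one_div]
    exact tendsto_inv_atTop_zero.comp (tendsto_natCast_atTop_atTop.atTop_mul_const hL)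
  have h2 := (tendsto_finsetSum (Finset.range N) fun r hr =>
    tendsto_cot_partial_sums (d := d r) hL (h0 ▸ hmono.monotone (by positivity)) (by
      have h3 : d (0 + N) = L := by rw [hper, h0, zero_add]
      rw [← h3]
      exact hmono (by rw [Finset.mem_range] at hr; omega))).add hvan
  rw [add_zero, Finset.range_eq_Ico, Finset.sum_eq_sum_Ico_succ_bot (by omega : 0 < N)] at h2
  have h3 : Real.pi / L * Real.cot (Real.pi * d ((0 : ℕ) : ℤ) / L) = 0 := by
    simp [h0, Real.cot_eq_cos_div_sin]
  rw [h3, zero_add, zero_add] at h2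
  refine tendsto_nhds_unique h1 (h2.congr fun Q => ?_)
  simp only [Function.comp]
  rw [sum_pairs_block hper h0]
  simp only [Finset.range_eq_Ico]

end

/-- For periodic nodes the nonlocal part of the discrete chemical potential is a finite sum of
cotangents. -/
theorem discreteChem_eq {L a : ℝ} {N : ℕ} {x : ℤ → ℝ} (hL : 0 < L) (hN : 1 ≤ N)
    (hper : ∀ n, x (n + N) = x n + L) (hmono : StrictMono x) (i : ℤ) :
    discreteChem L a x i =
      -(2 / L) * (a * ∑ r ∈ Finset.Ico 1 N, Real.pi / L * Real.cot (Real.pi * (x (i + r) - x i) / L))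
      + (1 / (x (i + 1) - x i) - 1 / (x i - x (i - 1)))
      + (a ^ 2 / (x (i + 1) - x i) ^ 3 - a ^ 2 / (x i - x (i - 1)) ^ 3) := by
  have h := tsum_pairs_eq_cot_sum (d := fun n => x (i + n) - x i) hL hN
    (fun n => by rw [← add_assoc, hper]; ring) (by simp)
    (fun m n hmn => by simpa using hmono (show i + m < i + n by omega))
  have h2 : ∑' m : ℕ, (a / (x (i + (m + 1)) - x i) + a / (x (i - (m + 1)) - x i))
      = a * ∑' m : ℕ, (1 / (x (i + (m + 1)) - x i) + 1 / (x (i + -(m + 1)) - x i)) := by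
    rw [← tsum_mul_left]
    refine tsum_congr fun m => ?_
    rw [← sub_eq_add_neg]
    ring
  rw [discreteChem, ← h, h2]

/-! ### Admissible profiles -/

/-- A height profile with bounded derivatives up to order six and slope at most `b`. -/
structure Admissible (L b B : ℝ) (u : ℝ → ℝ) : Prop where
  diff : Differentiable ℝ u
  cb : CB 5 B (deriv u)
  slope : ∀ x, deriv u x ≤ b
  per : ∀ x, u (x + L) = u x - 1

/-- An admissible profile together with its inverse and a number of steps. -/
structure StepProfile (L b B : ℝ) where
  u : ℝ → ℝ
  φ : ℝ → ℝ
  N : ℕ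
  one_le : 1 ≤ N
  adm : Admissible L b B u
  inv : ∀ α, u (φ α) = α

theorem Admissible.deriv_per {L b B : ℝ} {u : ℝ → ℝ} (hu : Admissible L b B u) (x : ℝ) :
    deriv u (x + L) = deriv u x := by
  rw [← deriv_comp_add_const, show (fun x => u (x + L)) = fun x => u x - 1 from funext hu.per,
    deriv_sub_const]

theorem Admissible.chemPotential_eq {L b B : ℝ} {u : ℝ → ℝ} (hL : 0 < L) (hu : Admissible L b B u) (x : ℝ) :
    chemPotential L u x = -(2 * Real.pi / L) * hilb L (deriv u) x
      + (3 * deriv u x + 1 / deriv u x) * deriv (deriv u) x := by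
  rw [chemPotential, hilbertTransform_eq_hilb hL (hu.cb.of_le (by norm_num)) hu.deriv_per,
    iteratedDeriv_succ, iteratedDeriv_one]

theorem Admissible.ucb_chemPotential {L b B : ℝ} (hL : 0 < L) (hb : b < 0) :
    UCB 4 (fun u : {u // Admissible L b B u} => chemPotential L u.1) := by
  have h0 : UCB 5 (fun u : {u // Admissible L b B u} => deriv u.1) := ⟨B, fun u => u.2.cb⟩
  have h1 : UCB 4 (fun u : {u // Admissible L b B u} => hilb L (deriv u.1)) :=
    ⟨_, fun u => CB.hilb hL u.2.cb u.2.deriv_per⟩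
  have h2 := h0.of_le (by norm_num : 4 ≤ 5)
  have h3 : ∃ c > 0, ∀ (u : {u // Admissible L b B u}) x, c ≤ |deriv u.1 x| :=
    ⟨-b, by linarith, fun u x => by
      have := u.2.slope x
      rw [abs_of_neg (by linarith)]; linarith⟩
  exact ((h1.const_mul (c := fun _ => -(2 * Real.pi / L)) ⟨_, fun _ => le_rfl⟩).add
    (((h2.const_mul (c := fun _ => 3) ⟨_, fun _ => le_rfl⟩).add (h2.inv h3)).mul
      h0.deriv)).congr fun u x => u.2.chemPotential_eq hL x

theorem inverse_continuous {b : ℝ} {u φ : ℝ → ℝ} (hb : b < 0) (hu : Differentiable ℝ u)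
    (hs : ∀ x, deriv u x ≤ b) (hinv : ∀ α, u (φ α) = α) : Continuous φ := by
  have h1 : ∀ x y, |b| * |x - y| ≤ |u x - u y| := by
    intro x y
    wlog hxy : x ≤ y generalizing x y
    · rw [abs_sub_comm x, abs_sub_comm (u x)]
      exact this y x (le_of_not_ge hxy)
    have h2 := sub_le_of_deriv_le hu hs hxy
    rw [abs_of_neg hb, abs_of_nonpos (by linarith : x - y ≤ 0)]
    refine le_trans ?_ (le_abs_self _)
    linarith
  have : LipschitzWith (Real.toNNReal (1 / |b|)) φ := LipschitzWith.of_dist_le_mul fun x y => by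
    have h2 := h1 (φ x) (φ y)
    rw [hinv, hinv] at h2
    have hb' : 0 < |b| := abs_pos.2 hb.ne
    rw [Real.coe_toNNReal _ (by positivity), Real.dist_eq, Real.dist_eq, one_div,
      ← div_eq_inv_mul, le_div_iff₀ hb']
    linarith
  exact this.continuous

namespace StepProfile

variable {L b B : ℝ}

/-- The step height. -/
def a (d : StepProfile L b B) : ℝ := 1 / (d.N : ℝ)

theorem a_def (d : StepProfile L b B) : d.a = 1 / (d.N : ℝ) := rfl

theorem a_pos (d : StepProfile L b B) : 0 < d.a := by
  have : (0 : ℝ) < d.N := by exact_mod_cast d.one_le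
  rw [a]; positivity

theorem a_le_one (d : StepProfile L b B) : d.a ≤ 1 := by
  have : (1 : ℝ) ≤ d.N := by exact_mod_cast d.one_le
  rw [a, div_le_one (by linarith)]; exact this

theorem mul_a (d : StepProfile L b B) : (d.N : ℝ) * d.a = 1 := by
  have : (0 : ℝ) < d.N := by exact_mod_cast d.one_le
  rw [a]; field_simp

theorem deriv_u_neg (hb : b < 0) (d : StepProfile L b B) (x : ℝ) : deriv d.u x < 0 :=
  (d.adm.slope x).trans_lt hb

theorem hasDerivAt_φ (hb : b < 0) (d : StepProfile L b B) (α : ℝ) :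
    HasDerivAt d.φ (1 / deriv d.u (d.φ α)) α := by
  rw [one_div]
  exact HasDerivAt.of_local_left_inverse
    (inverse_continuous hb d.adm.diff d.adm.slope d.inv).continuousAt
    (d.adm.diff _).hasDerivAt (d.deriv_u_neg hb _).ne (Eventually.of_forall d.inv)

theorem deriv_φ (hb : b < 0) (d : StepProfile L b B) (α : ℝ) :
    deriv d.φ α = 1 / deriv d.u (d.φ α) := (d.hasDerivAt_φ hb α).deriv

theorem differentiable_φ (hb : b < 0) (d : StepProfile L b B) : Differentiable ℝ d.φ :=
  fun α => (d.hasDerivAt_φ hb α).differentiableAt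

theorem φ_per (hb : b < 0) (d : StepProfile L b B) (α : ℝ) : d.φ (α + 1) = d.φ α - L := by
  have h1 : Function.Injective d.u := (strictAnti_of_deriv_neg (d.deriv_u_neg hb)).injective
  apply h1
  have := d.adm.per (d.φ α - L)
  rw [sub_add_cancel, d.inv] at this
  rw [d.inv]; linarith

theorem exists_deriv_φ_le (hb : b < 0) :
    ∃ c > 0, ∀ (d : StepProfile L b B) x, deriv d.φ x ≤ -c := by
  refine ⟨1 / max B 1, by positivity, fun d x => ?_⟩
  have h1 := (abs_le.1 (d.adm.cb.bound (d.φ x))).1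
  have h2 := d.deriv_u_neg hb (d.φ x)
  have h3 : -max B 1 ≤ deriv d.u (d.φ x) := by linarith [le_max_left B 1]
  rw [d.deriv_φ hb, ← one_div_neg_eq_neg_one_div]
  exact one_div_le_one_div_of_neg_of_le h2 h3

theorem exists_le_abs_deriv_φ (hb : b < 0) :
    ∃ c > 0, ∀ (d : StepProfile L b B) x, c ≤ |deriv d.φ x| := by
  obtain ⟨c, hc0, hc⟩ := exists_deriv_φ_le (L := L) (B := B) hb
  refine ⟨c, hc0, fun d x => ?_⟩
  have := hc d x
  rw [abs_of_neg (by linarith)]; linarith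

theorem exists_le_abs_deriv_u (hb : b < 0) :
    ∃ c > 0, ∀ (d : StepProfile L b B) x, c ≤ |deriv d.u x| :=
  ⟨-b, by linarith, fun d x => by
    have := d.adm.slope x
    rw [abs_of_neg (by linarith)]; linarith⟩

theorem ucb_deriv_u : UCB 5 (fun d : StepProfile L b B => deriv d.u) := ⟨B, fun d => d.adm.cb⟩

theorem ucb_deriv_φ (hb : b < 0) : UCB 5 (fun d : StepProfile L b B => deriv d.φ) := by
  have hW := (ucb_deriv_u (L := L) (b := b) (B := B)).inv (exists_le_abs_deriv_u hb)
  have h0 : UCB 0 (fun d : StepProfile L b B => deriv d.φ) :=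
    ((hW.of_le (Nat.zero_le _)).comp_zero fun d => (d.differentiable_φ hb).continuous).congr
      fun d x => d.deriv_φ hb x
  have hstep : ∀ k, k + 1 ≤ 5 → UCB k (fun d : StepProfile L b B => deriv d.φ) →
      UCB (k + 1) (fun d : StepProfile L b B => deriv d.φ) := fun k hk h =>
    ((hW.of_le hk).comp (fun d => d.differentiable_φ hb) h).congr fun d x => d.deriv_φ hb x
  exact hstep 4 le_rfl (hstep 3 (by norm_num) (hstep 2 (by norm_num) (hstep 1 (by norm_num)
    (hstep 0 (by norm_num) h0))))

theorem ucb_chemPotential (hL : 0 < L) (hb : b < 0) :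
    UCB 4 (fun d : StepProfile L b B => chemPotential L d.u) :=
  (Admissible.ucb_chemPotential hL hb).reindex
    fun d : StepProfile L b B => (⟨d.u, d.adm⟩ : {u // Admissible L b B u})

/-- The chemical potential as a function of the height. -/
def pot (d : StepProfile L b B) (α : ℝ) : ℝ := chemPotential L d.u (d.φ α)

theorem ucb_pot (hL : 0 < L) (hb : b < 0) : UCB 4 (fun d : StepProfile L b B => d.pot) :=
  (ucb_chemPotential hL hb).comp (fun d => d.differentiable_φ hb) ((ucb_deriv_φ hb).of_le (by norm_num))

theorem ucb_vOne (hb : b < 0) : UCB 4 (fun d : StepProfile L b B => vOne L d.φ) := by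
  have h1 := ((ucb_deriv_φ (L := L) (B := B) hb).of_le (by norm_num : 4 ≤ 5)).inv
    (exists_le_abs_deriv_φ hb)
  refine (((ucb_deriv_φ hb).deriv.mul (h1.mul h1)).const_mul (c := fun _ => -(1 / L))
    ⟨_, fun _ => le_rfl⟩).congr fun d x => ?_
  rw [vOne, iteratedDeriv_succ, iteratedDeriv_one, mul_comm L, div_mul_eq_div_div]
  ring

/-- The discrete chemical potential as a function of the height. -/
def discretePot (d : StepProfile L b B) (α : ℝ) : ℝ :=
  discreteChem L d.a (fun j => d.φ (α - j * d.a)) 0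

theorem nodal_add (d : StepProfile L b B) (i j : ℤ) :
    nodal d.N d.φ (i + j) = d.φ (node d.N i - j * d.a) := by
  have : (0 : ℝ) < d.N := by exact_mod_cast d.one_le
  rw [nodal, node, node, a]
  congr 1
  push_cast
  field_simp
  ring

theorem discreteChem_nodal (d : StepProfile L b B) (i : ℤ) :
    discreteChem L d.a (nodal d.N d.φ) i = d.discretePot (node d.N i) := by
  have h0 : nodal d.N d.φ i = d.φ (node d.N i - (0 : ℤ) * d.a) := by simpa using d.nodal_add i 0
  simp only [discretePot, discreteChem, sub_eq_add_neg (i : ℤ), nodal_add, h0, zero_add, zero_sub]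

theorem nodes_per (hb : b < 0) (d : StepProfile L b B) (α : ℝ) (n : ℤ) :
    d.φ (α - (n + d.N : ℤ) * d.a) = d.φ (α - n * d.a) + L := by
  have h1 := d.φ_per hb (α - (n + d.N : ℤ) * d.a)
  have h2 : α - (n + d.N : ℤ) * d.a + 1 = α - n * d.a := by
    have := d.mul_a; push_cast; linarith
  rw [h2] at h1
  linarith

theorem nodes_strictMono (hb : b < 0) (d : StepProfile L b B) (α : ℝ) :
    StrictMono fun n : ℤ => d.φ (α - n * d.a) := fun m n hmn => by
  have hanti : StrictAnti d.φ := strictAnti_of_deriv_neg fun x => by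
    rw [d.deriv_φ hb]; exact one_div_neg.2 (d.deriv_u_neg hb _)
  apply hanti
  have : (m : ℝ) < n := by exact_mod_cast hmn
  have := mul_lt_mul_of_pos_right this d.a_pos
  linarith

theorem discretePot_eq (hL : 0 < L) (hb : b < 0) (d : StepProfile L b B) (α : ℝ) :
    d.discretePot α =
      -(2 / L) * (d.a * ∑ r ∈ Finset.Ico 1 d.N,
        Real.pi / L * Real.cot (Real.pi * (d.φ (α + r * d.a) - d.φ α) / L))
      + cdiff d.a (fun y => 1 / cdiff d.a d.φ y) α
      + cdiff d.a (fun y => 1 / cdiff d.a d.φ y ^ 3) α := by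
  have ha := d.a_pos.ne'
  rw [discretePot, discreteChem_eq hL d.one_le (d.nodes_per hb α) (d.nodes_strictMono hb α)]
  congr 1
  · congr 1
    · congr 2
      have href := Finset.sum_Ico_reflect (fun r : ℕ => Real.pi / L *
        Real.cot (Real.pi * (d.φ (α + r * d.a) - d.φ α) / L)) 1 (Nat.le_succ d.N)
      simp only [Nat.add_sub_cancel_left, Nat.add_sub_cancel] at href
      rw [← href]
      refine Finset.sum_congr rfl fun r hr => ?_
      rw [Finset.mem_Ico] at hr
      have h1 := d.φ_per hb (α - r * d.a)
      have h2 : α + ((d.N - r : ℕ) : ℝ) * d.a = α - r * d.a + 1 := by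
        rw [Nat.cast_sub hr.2.le]; have := d.mul_a; linarith
      rw [h2, h1]
      have h3 := cot_add_int_mul L hL.ne' (d.φ (α - r * d.a) - d.φ α) (-1)
      push_cast at h3
      rw [show d.φ (α - r * d.a) - L - d.φ α = d.φ (α - r * d.a) - d.φ α + -1 * L by ring, h3]
      simp
    · simp only [cdiff]
      rw [show α + d.a / 2 + d.a / 2 = α + d.a by ring, show α + d.a / 2 - d.a / 2 = α by ring,
        show α - d.a / 2 + d.a / 2 = α by ring, show α - d.a / 2 - d.a / 2 = α - d.a by ring]
      simp only [zero_add, zero_sub, Int.cast_one, Int.cast_zero, Int.cast_neg, one_mul, zero_mul,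
        sub_zero, neg_mul, sub_neg_eq_add]
      rw [one_div_div, one_div_div, ← neg_sub (d.φ (α + d.a)) (d.φ α), ← neg_sub (d.φ α) (d.φ (α - d.a)),
        one_div_neg_eq_neg_one_div, one_div_neg_eq_neg_one_div]
      field_simp
      ring
  · simp only [cdiff]
    rw [show α + d.a / 2 + d.a / 2 = α + d.a by ring, show α + d.a / 2 - d.a / 2 = α by ring,
      show α - d.a / 2 + d.a / 2 = α by ring, show α - d.a / 2 - d.a / 2 = α - d.a by ring]
    simp only [zero_add, zero_sub, Int.cast_one, Int.cast_zero, Int.cast_neg, one_mul, zero_mul,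
      sub_zero, neg_mul, sub_neg_eq_add]
    rw [div_pow, div_pow, one_div_div, one_div_div, ← neg_sub (d.φ (α + d.a)) (d.φ α),
      ← neg_sub (d.φ α) (d.φ (α - d.a)), Odd.neg_pow (by decide), Odd.neg_pow (by decide), div_neg, div_neg]
    field_simp
    ring

theorem deriv_inv_deriv_φ (hb : b < 0) (d : StepProfile L b B) (α : ℝ) :
    deriv (fun y => 1 / deriv d.φ y) α = deriv (deriv d.u) (d.φ α) / deriv d.u (d.φ α) ∧
    deriv (fun y => 1 / deriv d.φ y ^ 3) α
      = 3 * deriv d.u (d.φ α) * deriv (deriv d.u) (d.φ α) := by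
  have h1 : (fun y => 1 / deriv d.φ y) = fun y => deriv d.u (d.φ y) := by
    ext y; rw [d.deriv_φ hb, one_div_one_div]
  have h2 : (fun y => 1 / deriv d.φ y ^ 3) = fun y => deriv d.u (d.φ y) ^ 3 := by
    ext y; rw [← one_div_pow, d.deriv_φ hb, one_div_one_div]
  have h3 : HasDerivAt (fun y => deriv d.u (d.φ y))
      (deriv (deriv d.u) (d.φ α) * (1 / deriv d.u (d.φ α))) α :=
    (d.adm.cb.1 (d.φ α)).hasDerivAt.comp α (d.hasDerivAt_φ hb α)
  have := (d.deriv_u_neg hb (d.φ α)).ne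
  constructor
  · rw [h1, h3.deriv]; ring
  · rw [h2]; refine (h3.pow 3).deriv.trans ?_; field_simp; norm_num; ring

theorem exists_expansion (hL : 0 < L) (hb : b < 0) :
    ∃ (w e : StepProfile L b B → ℝ → ℝ), UCB 2 w ∧ (∃ C, ∀ d α, |e d α| ≤ C) ∧
      ∀ d α, d.discretePot α = d.pot α + d.a * vOne L d.φ α + d.a ^ 2 * w d α + d.a ^ 4 * e d α := by
  have hφ := fun d : StepProfile L b B => d.differentiable_φ hb
  have hφ' := ucb_deriv_φ (L := L) (B := B) hb
  have ha := fun d : StepProfile L b B => d.a_pos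
  obtain ⟨K, C, hK, hKs, hC⟩ := cot_sum_consistency hL hφ hφ' (exists_deriv_φ_le hb)
    (fun d => d.φ_per hb)
  have hc := exists_le_abs_deriv_φ (L := L) (B := B) hb
  have hw1 := ucb_cdiff_sub_deriv_of_close ha (ucb_inv_cdiff_sub ha hφ hφ' hc) (hφ'.inv hc)
  have hc3 : ∃ c > 0, ∀ (d : StepProfile L b B) x, c ≤ |deriv d.φ x ^ 3| := by
    obtain ⟨c, hc0, hc⟩ := hc
    exact ⟨c ^ 3, by positivity, fun d x => by
      rw [abs_pow]; exact pow_le_pow_left₀ hc0.le (hc d x) 3⟩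
  have hw2 := ucb_cdiff_sub_deriv_of_close ha (ucb_inv_cube_cdiff_sub ha hφ hφ' hc)
    ((hφ'.pow 3).inv hc3)
  refine ⟨_, fun d α => (d.discretePot α - (d.pot α + d.a * vOne L d.φ α + d.a ^ 2 *
    ((cdiff d.a (fun y => 1 / cdiff d.a d.φ y) α - deriv (fun y => 1 / deriv d.φ y) α) / d.a ^ 2
    + (cdiff d.a (fun y => 1 / cdiff d.a d.φ y ^ 3) α - deriv (fun y => 1 / deriv d.φ y ^ 3) α) / d.a ^ 2)))
      / d.a ^ 4,
    hw1.add hw2, ⟨2 / L * C, fun d α => ?_⟩, fun d α => ?_⟩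
  · have hint := integral_kernel_eq_hilb (α := α) hL (d.adm.cb.of_le (by norm_num)) d.adm.deriv_per
      (d.hasDerivAt_φ hb) (hφ'.continuous d) (d.deriv_u_neg hb) (d.φ_per hb) (hK.continuous (d, α))
      (hKs d α)
    have h1 := hC d α d.N d.one_le
    obtain ⟨h2, h3⟩ := d.deriv_inv_deriv_φ hb α
    have ha' := d.a_pos
    rw [hint] at h1
    simp only [← a_def] at h1
    rw [abs_div, abs_of_pos (by positivity : 0 < d.a ^ 4), div_le_iff₀ (by positivity)]
    rw [discretePot_eq hL hb, h2, h3, pot, d.adm.chemPotential_eq hL, vOne]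
    have hne := (d.deriv_u_neg hb (d.φ α)).ne
    have hne' : deriv d.φ α ≠ 0 := by
      rw [d.deriv_φ hb]; exact one_div_ne_zero hne
    calc _ = |-(2 / L) * (d.a * ∑ r ∈ Finset.Ico 1 d.N,
            Real.pi / L * Real.cot (Real.pi * (d.φ (α + r * d.a) - d.φ α) / L)
          - (Real.pi * hilb L (deriv d.u) (d.φ α)
            + d.a * (iteratedDeriv 2 d.φ α / (2 * deriv d.φ α ^ 2))))| := by
          congr 1
          field_simp
          ring
      _ ≤ _ := by
          rw [abs_mul, abs_neg, abs_of_pos (by positivity : 0 < 2 / L), mul_assoc]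
          exact mul_le_mul_of_nonneg_left h1 (by positivity)
  · have := d.a_pos.ne'
    field_simp
    ring

theorem stepVelocity_eq (d : StepProfile L b B) (i : ℤ) :
    stepVelocity L d.a (nodal d.N d.φ) i
      = -cdiff d.a (fun y => cdiff d.a d.discretePot y / cdiff d.a d.φ y) (node d.N i) := by
  have ha := d.a_pos.ne'
  have h0 : nodal d.N d.φ i = d.φ (node d.N i) := rfl
  have h1 : nodal d.N d.φ (i + 1) = d.φ (node d.N i - d.a) := by
    simpa using d.nodal_add i 1
  have h2 : nodal d.N d.φ (i - 1) = d.φ (node d.N i + d.a) := by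
    simpa [← sub_eq_add_neg] using d.nodal_add i (-1)
  have hn : ∀ j : ℤ, node d.N (i + j) = node d.N i - j * d.a := fun j => by
    have : (0 : ℝ) < d.N := by exact_mod_cast d.one_le
    rw [node, node, a]; push_cast; field_simp; ring
  have h3 : node d.N (i + 1) = node d.N i - d.a := by simpa using hn 1
  have h4 : node d.N (i - 1) = node d.N i + d.a := by simpa [← sub_eq_add_neg] using hn (-1)
  rw [stepVelocity, discreteChem_nodal, discreteChem_nodal, discreteChem_nodal, h0, h1, h2, h3, h4]
  set α := node d.N i
  simp only [cdiff]
  rw [show α + d.a / 2 + d.a / 2 = α + d.a by ring, show α + d.a / 2 - d.a / 2 = α by ring,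
    show α - d.a / 2 + d.a / 2 = α by ring, show α - d.a / 2 - d.a / 2 = α - d.a by ring,
    div_div_div_cancel_right₀ ha, div_div_div_cancel_right₀ ha,
    ← neg_sub (d.discretePot α) (d.discretePot (α - d.a)), ← neg_sub (d.φ α) (d.φ (α - d.a)),
    ← neg_sub (d.discretePot (α + d.a)) (d.discretePot α), ← neg_sub (d.φ (α + d.a)) (d.φ α),
    neg_div_neg_eq, neg_div_neg_eq]
  ring

theorem rZero_eq (hb : b < 0) (d : StepProfile L b B) (α : ℝ) :
    rZero L d.φ α = -deriv (fun y => deriv (vOne L d.φ) y / deriv d.φ y) α := by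
  have h1 := ((ucb_vOne (L := L) (B := B) hb).deriv.differentiable d α).hasDerivAt
  have h2 := ((ucb_deriv_φ (L := L) (B := B) hb).differentiable d α).hasDerivAt
  have h3 : deriv d.φ α ≠ 0 := by
    rw [d.deriv_φ hb]; exact one_div_ne_zero (d.deriv_u_neg hb _).ne
  have h4 : deriv (fun y => deriv (vOne L d.φ) y / deriv d.φ y) α = _ := (h1.div h2 h3).deriv
  rw [rZero, h4, iteratedDeriv_succ, iteratedDeriv_one, iteratedDeriv_succ,
    iteratedDeriv_one]
  field_simp
  ring

theorem deriv_pot_div (hL : 0 < L) (hb : b < 0) (d : StepProfile L b B) (α : ℝ) :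
    deriv (fun y => deriv d.pot y / deriv d.φ y) α
      = iteratedDeriv 2 (chemPotential L d.u) (d.φ α) / deriv d.u (d.φ α) := by
  have hμ := ucb_chemPotential (L := L) (B := B) hL hb
  have h1 : (fun y => deriv d.pot y / deriv d.φ y) = fun y => deriv (chemPotential L d.u) (d.φ y) := by
    ext y
    have h2 : HasDerivAt d.pot _ y :=
      (hμ.differentiable d (d.φ y)).hasDerivAt.comp y (d.hasDerivAt_φ hb y)
    rw [h2.deriv, d.deriv_φ hb, mul_div_cancel_right₀]
    exact one_div_ne_zero (d.deriv_u_neg hb _).ne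
  have h3 := (hμ.deriv.differentiable d (d.φ α)).hasDerivAt.comp α (d.hasDerivAt_φ hb α)
  rw [h1, iteratedDeriv_succ, iteratedDeriv_one]
  refine h3.deriv.trans ?_
  ring

/-- Consistency of the step-flow equations with the continuum model. -/
theorem consistency (hL : 0 < L) (hb : b < 0) :
    ∃ C, ∀ (d : StepProfile L b B),
      (∀ α, |d.discretePot α| ≤ C) ∧ (∀ α, |rZero L d.φ α| ≤ C) ∧
      ∀ i, |-(iteratedDeriv 2 (chemPotential L d.u) (nodal d.N d.φ i) / deriv d.u (nodal d.N d.φ i))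
        - (stepVelocity L d.a (nodal d.N d.φ) i - rZero L d.φ (node d.N i) * d.a)| ≤ C * d.a ^ 2 := by
  have hφ := fun d : StepProfile L b B => d.differentiable_φ hb
  have hφ' := ucb_deriv_φ (L := L) (B := B) hb
  have ha := fun d : StepProfile L b B => d.a_pos
  have hc := exists_le_abs_deriv_φ (L := L) (B := B) hb
  obtain ⟨w, e, hw, he, hexp⟩ := exists_expansion (B := B) hL hb
  obtain ⟨Ce, hCe⟩ := id he
  obtain ⟨Cw, hCw⟩ := hw.bound
  obtain ⟨Cv, hCv⟩ := (ucb_vOne (L := L) (B := B) hb).bound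
  obtain ⟨Cf, hCf⟩ := (ucb_pot (L := L) (B := B) hL hb).bound
  obtain ⟨C1, hC1⟩ := bounded_cdiff_div_cdiff_sub ha hφ hφ' hc (ucb_pot (B := B) hL hb)
  obtain ⟨C2, hC2⟩ := bounded_cdiff_div_cdiff_sub ha hφ hφ' hc (ucb_vOne (B := B) hb)
  obtain ⟨C3, hC3⟩ := bounded_cdiff_div_cdiff ha hφ hφ' hc hw
  obtain ⟨C4, hC4⟩ := bounded_cdiff_div_cdiff_of_bound ha hφ hc he
  obtain ⟨C5, hC5⟩ := (((ucb_vOne (L := L) (B := B) hb).deriv).div (hφ'.of_le (by norm_num)) hc).deriv.bound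
  refine ⟨max (max (Cf + Cv + Cw + Ce) C5) (C1 + C2 + C3 + C4), fun d => ⟨fun α => ?_, fun α => ?_,
    fun i => ?_⟩⟩
  · refine le_trans ?_ ((le_max_left _ _).trans (le_max_left _ _))
    have h0 := d.a_pos
    have h1 := d.a_le_one
    have hCw0 := (abs_nonneg _).trans (hCw d α)
    have e1 : |d.a * vOne L d.φ α| ≤ Cv := by
      rw [abs_mul, abs_of_pos h0]
      exact (mul_le_of_le_one_left (abs_nonneg _) h1).trans (hCv d α)
    have e2 : |d.a ^ 2 * w d α| ≤ Cw := by
      rw [abs_mul, abs_of_pos (by positivity)]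
      exact (mul_le_of_le_one_left (abs_nonneg _) (pow_le_one₀ h0.le h1)).trans (hCw d α)
    have e3 : |d.a ^ 4 * e d α| ≤ Ce := by
      rw [abs_mul, abs_of_pos (by positivity)]
      exact (mul_le_of_le_one_left (abs_nonneg _) (pow_le_one₀ h0.le h1)).trans (hCe d α)
    have e4 := hCf d α
    rw [hexp]
    rw [abs_le] at *
    constructor <;> linarith [e1.1, e1.2, e2.1, e2.2, e3.1, e3.2, e4.1, e4.2]
  · refine le_trans ?_ ((le_max_right _ _).trans (le_max_left _ _))
    rw [d.rZero_eq hb, abs_neg]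
    exact hC5 d α
  · refine le_trans ?_ (mul_le_mul_of_nonneg_right (le_max_right _ _) (sq_nonneg _))
    have h0 := d.a_pos
    have h1 := d.a_le_one
    have hn : nodal d.N d.φ i = d.φ (node d.N i) := rfl
    rw [stepVelocity_eq, hn, ← d.deriv_pot_div hL hb, d.rZero_eq hb]
    set α := node d.N i
    have hsplit : cdiff d.a (fun y => cdiff d.a d.discretePot y / cdiff d.a d.φ y) α
        = cdiff d.a (fun y => cdiff d.a d.pot y / cdiff d.a d.φ y) α
        + d.a * cdiff d.a (fun y => cdiff d.a (vOne L d.φ) y / cdiff d.a d.φ y) α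
        + d.a ^ 2 * cdiff d.a (fun y => cdiff d.a (w d) y / cdiff d.a d.φ y) α
        + d.a ^ 4 * cdiff d.a (fun y => cdiff d.a (e d) y / cdiff d.a d.φ y) α := by
      have e1 : d.discretePot = fun α => d.pot α + d.a * vOne L d.φ α + d.a ^ 2 * w d α
          + d.a ^ 4 * e d α := funext (hexp d)
      rw [e1]
      simp only [cdiff_add, cdiff_const_mul, add_div, mul_div_assoc]
    rw [hsplit]
    have b1 := hC1 d α
    have b2 := hC2 d α
    have b3 := hC3 d α
    have b4 := hC4 d α
    have hC20 := (abs_nonneg _).trans b2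
    rw [abs_div, abs_of_pos (by positivity : 0 < d.a ^ 2), div_le_iff₀ (by positivity)] at b1 b2
    set P := cdiff d.a (fun y => cdiff d.a d.pot y / cdiff d.a d.φ y) α
    set P' := deriv (fun y => deriv d.pot y / deriv d.φ y) α
    set V := cdiff d.a (fun y => cdiff d.a (vOne L d.φ) y / cdiff d.a d.φ y) α
    set V' := deriv (fun y => deriv (vOne L d.φ) y / deriv d.φ y) α
    set W := cdiff d.a (fun y => cdiff d.a (w d) y / cdiff d.a d.φ y) α
    set E := cdiff d.a (fun y => cdiff d.a (e d) y / cdiff d.a d.φ y) α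
    have e0 : -P' - (-(P + d.a * V + d.a ^ 2 * W + d.a ^ 4 * E) - -V' * d.a)
        = (P - P') + d.a * (V - V') + d.a ^ 2 * W + d.a ^ 2 * (d.a ^ 2 * E) := by ring
    rw [e0]
    have f2 : |d.a * (V - V')| ≤ C2 * d.a ^ 2 := by
      rw [abs_mul, abs_of_pos h0]
      exact (mul_le_of_le_one_left (abs_nonneg _) h1).trans b2
    have f3 : |d.a ^ 2 * W| ≤ C3 * d.a ^ 2 := by
      rw [abs_mul, abs_of_pos (by positivity : 0 < d.a ^ 2), mul_comm]
      exact mul_le_mul_of_nonneg_right b3 (by positivity)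
    have f4 : |d.a ^ 2 * (d.a ^ 2 * E)| ≤ C4 * d.a ^ 2 := by
      rw [abs_mul, abs_of_pos (by positivity : 0 < d.a ^ 2), mul_comm]
      exact mul_le_mul_of_nonneg_right b4 (by positivity)
    refine (abs_add_le _ _).trans ((add_le_add ((abs_add_le _ _).trans
      (add_le_add ((abs_add_le _ _).trans (add_le_add b1 f2)) f3)) f4).trans_eq ?_)
    ring

end StepProfile

/-! ### The discrete energy -/

theorem sum_Icc_one_eq (N : ℕ) (F : ℤ → ℝ) :
    ∑ i ∈ Finset.Icc (1 : ℤ) N, F i = ∑ r ∈ Finset.range N, F (1 + r) := by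
  refine Finset.sum_nbij' (fun j => (j - 1).toNat) (fun r => 1 + r) ?_ ?_ ?_ ?_ ?_
  · intro j hj; rw [Finset.mem_Icc] at hj; rw [Finset.mem_range]; omega
  · intro r hr; rw [Finset.mem_range] at hr; rw [Finset.mem_Icc]; omega
  · intro j hj; rw [Finset.mem_Icc] at hj; simp; omega
  · intro r _; simp
  · intro j hj
    rw [Finset.mem_Icc] at hj
    congr 1
    have : (((j - 1).toNat : ℕ) : ℤ) = j - 1 := Int.toNat_of_nonneg (by omega)
    omega

theorem sum_range_shift {N : ℕ} {F : ℤ → ℝ} (hF : ∀ i, F (i + N) = F i) (i : ℤ) :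
    ∑ r ∈ Finset.range N, F (i + r) = ∑ i ∈ Finset.Icc (1 : ℤ) N, F i := by
  have hstep : ∀ i : ℤ, ∑ r ∈ Finset.range N, F (i + 1 + r) = ∑ r ∈ Finset.range N, F (i + r) := by
    intro i
    have h1 := Finset.sum_range_succ (fun r : ℕ => F (i + r)) N
    rw [Finset.sum_range_succ', hF] at h1
    push_cast at h1
    simp only [add_zero] at h1
    have h2 := add_right_cancel h1
    rw [← h2]
    exact Finset.sum_congr rfl fun r _ => by congr 1; ring
  have hper : Function.Periodic (fun i : ℤ => ∑ r ∈ Finset.range N, F (i + r)) 1 := hstep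
  have := hper.int_mul (i - 1) 1
  simp only [mul_one] at this
  rw [sum_Icc_one_eq, ← this]
  exact Finset.sum_congr rfl fun r _ => by congr 1; push_cast; ring

theorem sum_Icc_shift {N : ℕ} {F : ℤ → ℝ} (hF : ∀ i, F (i + N) = F i) (k : ℤ) :
    ∑ i ∈ Finset.Icc (1 : ℤ) N, F (i + k) = ∑ i ∈ Finset.Icc (1 : ℤ) N, F i := by
  rw [sum_Icc_one_eq, ← sum_range_shift hF (1 + k)]
  exact Finset.sum_congr rfl fun r _ => by congr 1; ring

section

variable {L : ℝ} {N : ℕ} {y : ℤ → ℝ}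

theorem sum_cot_pairs (hL : 0 < L) (hN : 1 ≤ N) (hper : ∀ n, y (n + N) = y n + L) (i : ℤ) :
    ∑ r ∈ Finset.Ico 1 N, Real.cot (Real.pi * (y (i + r) - y i) / L)
      = ∑ j ∈ Finset.Icc (1 : ℤ) N, Real.cot (Real.pi * (y j - y i) / L) := by
  have h := sum_range_shift (N := N) (F := fun j => Real.cot (Real.pi * (y j - y i) / L))
    (fun j => by
      rw [hper]
      have := cot_add_int_mul L hL.ne' (y j - y i) 1
      rw [← this]; push_cast; ring_nf) i
  rw [← h, Finset.range_eq_Ico, Finset.sum_eq_sum_Ico_succ_bot (by omega : 0 < N)]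
  simp [Real.cot_eq_cos_div_sin]

theorem sum_pairs_antisymm {c : ℤ → ℤ → ℝ} (hc : ∀ i j, c j i = -c i j) (v : ℤ → ℝ) (N : ℕ) :
    ∑ i ∈ Finset.Icc (1 : ℤ) N, ∑ j ∈ Finset.Icc (i + 1) (N : ℤ), c i j * (v j - v i)
      = -∑ i ∈ Finset.Icc (1 : ℤ) N, v i * ∑ j ∈ Finset.Icc (1 : ℤ) N, c i j := by
  have h1 : ∑ i ∈ Finset.Icc (1 : ℤ) N, ∑ j ∈ Finset.Icc (i + 1) (N : ℤ), c i j * v j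
      = ∑ j ∈ Finset.Icc (1 : ℤ) N, ∑ i ∈ Finset.Icc (1 : ℤ) (j - 1), c i j * v j :=
    Finset.sum_comm' fun i j => by simp only [Finset.mem_Icc]; omega
  have h2 : ∀ i ∈ Finset.Icc (1 : ℤ) N, ∑ j ∈ Finset.Icc (1 : ℤ) N, c i j
      = ∑ j ∈ Finset.Icc (1 : ℤ) (i - 1), c i j + ∑ j ∈ Finset.Icc (i + 1) (N : ℤ), c i j := by
    intro i hi
    rw [Finset.mem_Icc] at hi
    have hii : c i i = 0 := by linarith [hc i i]
    have e : Finset.Icc (1 : ℤ) N = Finset.Icc 1 (i - 1) ∪ ({i} ∪ Finset.Icc (i + 1) (N : ℤ)) := by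
      ext j; simp only [Finset.mem_Icc, Finset.mem_union, Finset.mem_singleton]; omega
    rw [e, Finset.sum_union, Finset.sum_union, Finset.sum_singleton, hii, zero_add]
    · rw [Finset.disjoint_left]; intro j; simp only [Finset.mem_Icc, Finset.mem_singleton]; omega
    · rw [Finset.disjoint_left]; intro j
      simp only [Finset.mem_Icc, Finset.mem_union, Finset.mem_singleton]; omega
  simp only [mul_sub, Finset.sum_sub_distrib]
  rw [h1, ← Finset.sum_neg_distrib, ← Finset.sum_sub_distrib]
  refine Finset.sum_congr rfl fun i hi => ?_
  rw [h2 i hi, ← Finset.sum_mul, ← Finset.sum_mul, Finset.sum_congr rfl fun j _ => hc i j,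
    Finset.sum_neg_distrib]
  ring

theorem sub_mem_Ioo_of_lt (hmono : StrictMono y) (hper : ∀ n, y (n + N) = y n + L)
    {i j : ℤ} (hi : 1 ≤ i) (hij : i < j) (hj : j ≤ N) : y j - y i ∈ Ioo 0 L := by
  have h1 := hmono hij
  have h2 := hmono (show j < i + N by omega)
  rw [hper] at h2
  exact ⟨by linarith, by linarith⟩

/-- The gradient of the discrete energy is `a` times the discrete chemical potential. -/
theorem hasDerivWithinAt_discreteEnergy {x : ℝ → ℤ → ℝ} {v : ℤ → ℝ} {s : Set ℝ} {t : ℝ}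
    (hL : 0 < L) (hN : 1 ≤ N) (hper : ∀ n, x t (n + N) = x t n + L) (hmono : StrictMono (x t))
    (hv : ∀ i, v (i + N) = v i) (hx : ∀ i, HasDerivWithinAt (fun τ => x τ i) (v i) s t) :
    HasDerivWithinAt (fun τ => discreteEnergy L N (x τ))
      (∑ i ∈ Finset.Icc (1 : ℤ) N, 1 / (N : ℝ) * (discreteChem L (1 / (N : ℝ)) (x t) i * v i)) s t := by
  have hN0 : (0 : ℝ) < N := by exact_mod_cast hN
  set a := 1 / (N : ℝ) with ha
  have ha0 : a ≠ 0 := by positivity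
  have hpi := Real.pi_pos
  set y := x t with hy
  set c : ℤ → ℤ → ℝ := fun i j => Real.cot (Real.pi * (y j - y i) / L) with hc
  have hcanti : ∀ i j, c j i = -c i j := fun i j => by
    rw [hc]; simp only; rw [← cot_neg]; congr 1; ring
  have hgap : ∀ i : ℤ, 0 < y (i + 1) - y i := fun i => sub_pos.2 (hmono (by omega))
  have h1 : HasDerivWithinAt (fun τ => ∑ i ∈ Finset.Icc (1 : ℤ) N, ∑ j ∈ Finset.Icc (i + 1) (N : ℤ),
      2 / L * Real.log |Real.sin (Real.pi / L * (x τ j - x τ i))|)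
      (∑ i ∈ Finset.Icc (1 : ℤ) N, ∑ j ∈ Finset.Icc (i + 1) (N : ℤ),
        2 / L * (Real.pi / L * (c i j * (v j - v i)))) s t := by
    refine HasDerivWithinAt.fun_sum fun i hi => HasDerivWithinAt.fun_sum fun j hj => ?_
    rw [Finset.mem_Icc] at hi hj
    have hm := sub_mem_Ioo_of_lt hmono hper hi.1 (show i < j by omega) hj.2
    have hsin : Real.sin (Real.pi / L * (x t j - x t i)) ≠ 0 :=
      (Real.sin_pos_of_pos_of_lt_pi (by have := hm.1; positivity) (by
        rw [div_mul_eq_mul_div, div_lt_iff₀ hL]; exact mul_lt_mul_of_pos_left hm.2 hpi)).ne'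
    have := ((((hx j).sub (hx i)).const_mul (Real.pi / L)).sin.log hsin).const_mul (2 / L)
    simp only [Real.log_abs]
    refine this.congr_deriv ?_
    simp only [hc, Real.cot_eq_cos_div_sin, Pi.sub_apply]
    rw [show Real.pi * (y j - y i) / L = Real.pi / L * (x t j - x t i) by rw [hy]; ring]
    field_simp
  have h2 : HasDerivWithinAt (fun τ => ∑ i ∈ Finset.Icc (1 : ℤ) N,
      (-Real.log |(x τ i - x τ (i + 1)) / a| + a ^ 2 / 2 * (1 / (x τ i - x τ (i + 1)) ^ 2)))
      (∑ i ∈ Finset.Icc (1 : ℤ) N,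
        (1 / (y (i + 1) - y i) + a ^ 2 / (y (i + 1) - y i) ^ 3) * (v i - v (i + 1))) s t := by
    refine HasDerivWithinAt.fun_sum fun i _ => ?_
    have hne : x t i - x t (i + 1) ≠ 0 := by have := hgap i; rw [hy] at this; linarith
    have hne' : y (i + 1) - y i ≠ 0 := (hgap i).ne'
    have hd := (hx i).sub (hx (i + 1))
    have e1 := ((hd.div_const a).log (div_ne_zero hne ha0)).neg
    have e2 := ((hd.pow 2).fun_inv (pow_ne_zero 2 hne)).const_mul (a ^ 2 / 2)
    simp only [Real.log_abs, one_div]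
    refine (e1.add e2).congr_deriv ?_
    have e3 : x t i - x t (i + 1) = -(y (i + 1) - y i) := by rw [hy]; ring
    simp only [Pi.sub_apply, Pi.pow_apply]
    rw [e3]
    set g := y (i + 1) - y i
    field_simp
    ring
  have h3 := (h1.const_mul (a ^ 2)).add (h2.const_mul a)
  refine h3.congr_deriv ?_
  have e1 : ∑ i ∈ Finset.Icc (1 : ℤ) N, ∑ j ∈ Finset.Icc (i + 1) (N : ℤ),
        2 / L * (Real.pi / L * (c i j * (v j - v i)))
      = -∑ i ∈ Finset.Icc (1 : ℤ) N, 2 / L * (Real.pi / L *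
        (v i * ∑ j ∈ Finset.Icc (1 : ℤ) N, c i j)) := by
    simp only [← Finset.mul_sum]
    rw [sum_pairs_antisymm hcanti]
    ring
  have hyp : ∀ i : ℤ, y (i + N + 1) = y (i + 1) + L := fun i => by
    rw [show i + N + 1 = i + 1 + N by ring, hper]
  have e2 : ∑ i ∈ Finset.Icc (1 : ℤ) N,
        (1 / (y (i + 1) - y i) + a ^ 2 / (y (i + 1) - y i) ^ 3) * (v i - v (i + 1))
      = ∑ i ∈ Finset.Icc (1 : ℤ) N, ((1 / (y (i + 1) - y i) - 1 / (y i - y (i - 1)))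
        + (a ^ 2 / (y (i + 1) - y i) ^ 3 - a ^ 2 / (y i - y (i - 1)) ^ 3)) * v i := by
    have e3 := sum_Icc_shift (N := N) (F := fun i => (1 / (y i - y (i - 1))
      + a ^ 2 / (y i - y (i - 1)) ^ 3) * v i) (fun i => by
        have h4 := hper (i - 1)
        rw [hper, hv, show i + (N : ℤ) - 1 = i - 1 + N by ring, h4]
        ring_nf) 1
    simp only [add_sub_cancel_right] at e3
    simp only [mul_sub, Finset.sum_sub_distrib]
    rw [e3, ← Finset.sum_sub_distrib]
    exact Finset.sum_congr rfl fun i _ => by ring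
  rw [e1, e2, ← Finset.sum_neg_distrib, Finset.mul_sum, Finset.mul_sum, ← Finset.sum_add_distrib]
  refine Finset.sum_congr rfl fun i _ => ?_
  rw [discreteChem_eq hL hN hper hmono, ← Finset.mul_sum, sum_cot_pairs hL hN hper]
  ring

theorem discreteChem_periodic {a : ℝ} (hL : 0 < L) (hN : 1 ≤ N) (hper : ∀ n, y (n + N) = y n + L)
    (hmono : StrictMono y) (i : ℤ) : discreteChem L a y (i + N) = discreteChem L a y i := by
  have h : ∀ k : ℤ, y (i + N + k) = y (i + k) + L := fun k => by
    rw [show i + N + k = i + k + N by ring, hper]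
  have h' : y (i + N - 1) = y (i - 1) + L := by simpa [← sub_eq_add_neg] using h (-1)
  simp only [discreteChem_eq hL hN hper hmono, h, h', hper, add_sub_add_right_eq_sub]

theorem sum_mul_stepVelocity {a : ℝ} (ha : a ≠ 0) (hL : 0 < L) (hN : 1 ≤ N)
    (hper : ∀ n, y (n + N) = y n + L) (hmono : StrictMono y) :
    ∑ i ∈ Finset.Icc (1 : ℤ) N, a * (discreteChem L a y i * stepVelocity L a y i)
      = -∑ i ∈ Finset.Icc (1 : ℤ) N, (discreteChem L a y (i + 1) - discreteChem L a y i) ^ 2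
        / (y (i + 1) - y i) := by
  set f := discreteChem L a y with hf
  have hfper : ∀ i, f (i + N) = f i := discreteChem_periodic hL hN hper hmono
  have hgap : ∀ i : ℤ, y (i + 1) - y i ≠ 0 := fun i => (sub_pos.2 (hmono (by omega))).ne'
  have e := sum_Icc_shift (N := N) (F := fun i => f i * ((f i - f (i - 1)) / (y i - y (i - 1))))
    (fun i => by
      have h4 := hper (i - 1)
      have h5 := hfper (i - 1)
      rw [hper, hfper, show i + (N : ℤ) - 1 = i - 1 + N by ring, h4, h5]
      ring_nf) 1
  simp only [add_sub_cancel_right] at e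
  have e2 : ∀ i, a * (f i * stepVelocity L a y i)
      = f i * ((f (i + 1) - f i) / (y (i + 1) - y i)) - f i * ((f i - f (i - 1)) / (y i - y (i - 1))) := by
    intro i
    rw [stepVelocity, ← hf]
    field_simp
  simp only [e2, Finset.sum_sub_distrib]
  rw [← e, ← Finset.sum_sub_distrib, ← Finset.sum_neg_distrib]
  refine Finset.sum_congr rfl fun i _ => ?_
  ring

end

namespace StepProfile

variable {L b B : ℝ}

/-- The velocity of the level sets of the continuum solution. -/
def levelVelocity (d : StepProfile L b B) (i : ℤ) : ℝ :=
  -(iteratedDeriv 2 (chemPotential L d.u) (nodal d.N d.φ i) / deriv d.u (nodal d.N d.φ i))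

theorem nodal_per (hb : b < 0) (d : StepProfile L b B) (n : ℤ) :
    nodal d.N d.φ (n + d.N) = nodal d.N d.φ n + L := by
  have h1 := d.nodes_per hb (node d.N 0) n
  have e : ∀ m : ℤ, nodal d.N d.φ m = d.φ (node d.N 0 - m * d.a) := fun m => by
    simpa using d.nodal_add 0 m
  rw [e, e, h1]

theorem nodal_strictMono (hb : b < 0) (d : StepProfile L b B) : StrictMono (nodal d.N d.φ) := by
  have e : nodal d.N d.φ = fun m : ℤ => d.φ (node d.N 0 - m * d.a) := funext fun m => by
    simpa using d.nodal_add 0 m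
  rw [e]
  exact d.nodes_strictMono hb _

theorem chemPotential_per (hL : 0 < L) (d : StepProfile L b B) (x : ℝ) :
    chemPotential L d.u (x + L) = chemPotential L d.u x := by
  have h1 : ∀ y, deriv d.u (x + L - y) = deriv d.u (x - y) := fun y => by
    rw [show x + L - y = x - y + L by ring, d.adm.deriv_per]
  rw [d.adm.chemPotential_eq hL, d.adm.chemPotential_eq hL, hilb, hilb]
  simp only [h1, d.adm.deriv_per, deriv_periodic d.adm.deriv_per]

theorem levelVelocity_per (hL : 0 < L) (hb : b < 0) (d : StepProfile L b B) (i : ℤ) :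
    d.levelVelocity (i + d.N) = d.levelVelocity i := by
  have h : ∀ x, iteratedDeriv 2 (chemPotential L d.u) (x + L)
      = iteratedDeriv 2 (chemPotential L d.u) x := fun x => by
    rw [iteratedDeriv_succ, iteratedDeriv_one]
    exact deriv_periodic (deriv_periodic (d.chemPotential_per hL)) x
  rw [levelVelocity, levelVelocity, nodal_per hb, h, d.adm.deriv_per]

theorem nodal_gap_le (hb : b < 0) (d : StepProfile L b B) (i : ℤ) :
    |b| * (nodal d.N d.φ (i + 1) - nodal d.N d.φ i) ≤ d.a := by
  have h1 : nodal d.N d.φ (i + 1) = d.φ (node d.N i - d.a) := by simpa using d.nodal_add i 1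
  have h2 : nodal d.N d.φ i = d.φ (node d.N i) := rfl
  have h3 := sub_le_of_deriv_le d.adm.diff d.adm.slope (d.nodal_strictMono hb (lt_add_one i)).le
  rw [h1, h2, d.inv, d.inv, ← h1, ← h2] at h3
  rw [abs_of_neg hb]
  linarith

/-- Consistency and the energy-dissipation inequalities for the level sets of a profile. -/
theorem energy_estimates (hL : 0 < L) (hb : b < 0) :
    ∃ C, ∀ (d : StepProfile L b B),
      (∀ i, |rZero L d.φ (node d.N i)| ≤ C ∧
        |d.levelVelocity i - (stepVelocity L d.a (nodal d.N d.φ) i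
          - rZero L d.φ (node d.N i) * d.a)| ≤ C * d.a ^ 2) ∧
      ∑ i ∈ Finset.Icc (1 : ℤ) d.N, d.a * (discreteChem L d.a (nodal d.N d.φ) i * d.levelVelocity i)
        + ∑ i ∈ Finset.Icc (1 : ℤ) d.N,
          (discreteChem L d.a (nodal d.N d.φ) (i + 1) - discreteChem L d.a (nodal d.N d.φ) i) ^ 2
            / (nodal d.N d.φ (i + 1) - nodal d.N d.φ i) ≤ C * d.a ∧
      ∑ i ∈ Finset.Icc (1 : ℤ) d.N, d.a * (discreteChem L d.a (nodal d.N d.φ) i * d.levelVelocity i)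
        + |b| * (d.a * ∑ i ∈ Finset.Icc (1 : ℤ) d.N,
          ((discreteChem L d.a (nodal d.N d.φ) (i + 1) - discreteChem L d.a (nodal d.N d.φ) i)
            / d.a) ^ 2) ≤ C * d.a := by
  obtain ⟨C₀, hC⟩ := consistency (B := B) hL hb
  set C₁ := max C₀ 0
  have hC₁ : 0 ≤ C₁ := le_max_right _ _
  refine ⟨max C₁ (2 * C₁ ^ 2), fun d => ?_⟩
  obtain ⟨hf, hr, hR⟩ := hC d
  have ha := d.a_pos
  have ha1 := d.a_le_one
  set f := discreteChem L d.a (nodal d.N d.φ) with hfdef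
  set x := nodal d.N d.φ with hx
  have hper := d.nodal_per hb
  have hmono := d.nodal_strictMono hb
  have hf' : ∀ i, |f i| ≤ C₁ := fun i => by
    rw [hfdef, d.discreteChem_nodal]; exact (hf _).trans (le_max_left _ _)
  have hr' : ∀ i, |rZero L d.φ (node d.N i)| ≤ C₁ := fun i => (hr _).trans (le_max_left _ _)
  have hR' : ∀ i, |d.levelVelocity i - (stepVelocity L d.a x i
          - rZero L d.φ (node d.N i) * d.a)| ≤ C₁ * d.a ^ 2 := fun i =>
    (hR i).trans (mul_le_mul_of_nonneg_right (le_max_left _ _) (sq_nonneg _))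
  have hgap : ∀ i : ℤ, 0 < x (i + 1) - x i := fun i => sub_pos.2 (hmono (by omega))
  have hterm : ∀ i, d.a * (f i * d.levelVelocity i)
      ≤ d.a * (f i * stepVelocity L d.a x i) + d.a * (2 * C₁ ^ 2 * d.a) := by
    intro i
    rw [← mul_add]
    refine mul_le_mul_of_nonneg_left ?_ ha.le
    have h1 : |d.levelVelocity i - stepVelocity L d.a x i| ≤ 2 * C₁ * d.a := by
      have e : d.levelVelocity i - stepVelocity L d.a x i
          = (d.levelVelocity i - (stepVelocity L d.a x i - rZero L d.φ (node d.N i) * d.a))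
            - rZero L d.φ (node d.N i) * d.a := by ring
      rw [e]
      refine (abs_sub _ _).trans ((add_le_add (hR' i) ?_).trans
        (show C₁ * d.a ^ 2 + C₁ * d.a ≤ _ by nlinarith [mul_nonneg hC₁ ha.le]))
      rw [abs_mul, abs_of_pos ha]
      exact mul_le_mul_of_nonneg_right (hr' i) ha.le
    have h2 : |f i * (d.levelVelocity i - stepVelocity L d.a x i)| ≤ C₁ * (2 * C₁ * d.a) := by
      rw [abs_mul]; exact mul_le_mul (hf' i) h1 (abs_nonneg _) hC₁
    have := (abs_le.1 h2).2
    nlinarith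
  have hsum : ∑ i ∈ Finset.Icc (1 : ℤ) d.N, d.a * (f i * d.levelVelocity i)
      + ∑ i ∈ Finset.Icc (1 : ℤ) d.N, (f (i + 1) - f i) ^ 2 / (x (i + 1) - x i)
      ≤ 2 * C₁ ^ 2 * d.a := by
    have h1 := Finset.sum_le_sum fun i (_ : i ∈ Finset.Icc (1 : ℤ) d.N) => hterm i
    rw [Finset.sum_add_distrib, sum_mul_stepVelocity ha.ne' hL d.one_le hper hmono,
      Finset.sum_const, Int.card_Icc, nsmul_eq_mul] at h1
    simp only [add_sub_cancel_right, Int.toNat_natCast] at h1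
    have h2 : (d.N : ℝ) * (d.a * (2 * C₁ ^ 2 * d.a)) = 2 * C₁ ^ 2 * d.a := by
      rw [← mul_assoc, d.mul_a, one_mul]
    rw [h2] at h1
    linarith
  have hmax : 2 * C₁ ^ 2 * d.a ≤ max C₁ (2 * C₁ ^ 2) * d.a :=
    mul_le_mul_of_nonneg_right (le_max_right _ _) ha.le
  refine ⟨fun i => ⟨(hr' i).trans (le_max_left _ _), (hR' i).trans
    (mul_le_mul_of_nonneg_right (le_max_left _ _) (sq_nonneg _))⟩, hsum.trans hmax,
    le_trans ?_ (hsum.trans hmax)⟩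
  refine add_le_add_right ?_ _
  rw [← mul_assoc, Finset.mul_sum]
  refine Finset.sum_le_sum fun i _ => ?_
  have h1 := d.nodal_gap_le hb i
  have h2 := hgap i
  rw [div_pow, le_div_iff₀ h2]
  calc |b| * d.a * ((f (i + 1) - f i) ^ 2 / d.a ^ 2) * (x (i + 1) - x i)
      = (f (i + 1) - f i) ^ 2 / d.a * (|b| * (x (i + 1) - x i)) := by field_simp
    _ ≤ (f (i + 1) - f i) ^ 2 / d.a * d.a := by gcongr
    _ = _ := by field_simp

end StepProfile

/-! ### Primitives of locally integrable functions and weak derivatives -/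

/-- `f` is a primitive of the locally integrable function `g`. -/
structure IsPrimitive (f g : ℝ → ℝ) : Prop where
  loc : LocallyIntegrable g
  eq : ∀ x, f x = f 0 + ∫ y in (0 : ℝ)..x, g y

theorem _root_.MeasureTheory.LocallyIntegrable.intervalIntegrable' {g : ℝ → ℝ}
    (hg : LocallyIntegrable g) (a b : ℝ) : IntervalIntegrable g volume a b :=
  intervalIntegrable_iff.mpr
    ((hg.integrableOn_isCompact isCompact_uIcc).mono_set uIoc_subset_uIcc)

theorem IsPrimitive.ae_hasDerivAt {f g : ℝ → ℝ} (h : IsPrimitive f g) :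
    ∀ᵐ x, HasDerivAt f (g x) x := by
  filter_upwards [_root_.LocallyIntegrable.ae_hasDerivAt_integral h.loc] with x hx
  rw [show f = fun x => f 0 + ∫ y in (0 : ℝ)..x, g y from funext h.eq]
  exact (hx 0).const_add _

theorem IsPrimitive.sub_eq {f g : ℝ → ℝ} (h : IsPrimitive f g) (a b : ℝ) :
    f b - f a = ∫ y in a..b, g y := by
  rw [h.eq b, h.eq a, ← intervalIntegral.integral_interval_sub_left
    (h.loc.intervalIntegrable' 0 b) (h.loc.intervalIntegrable' 0 a)]
  ring

theorem IsPrimitive.absolutelyContinuous {f g : ℝ → ℝ} (h : IsPrimitive f g) (a b : ℝ) :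
    AbsolutelyContinuousOnInterval f a b := by
  have h1 := (h.loc.intervalIntegrable' a b).absolutelyContinuousOnInterval_intervalIntegral
    (c := a) left_mem_uIcc
  have h2 : f = fun x => f a + ∫ y in a..x, g y := by
    funext x
    have := h.sub_eq a x
    linarith
  rw [h2]
  exact (contDiffOn_const (n := 1)).absolutelyContinuousOnInterval.fun_add h1

theorem IsPrimitive.continuous {f g : ℝ → ℝ} (h : IsPrimitive f g) : Continuous f := by
  rw [show f = fun x => f 0 + ∫ y in (0 : ℝ)..x, g y from funext h.eq]
  exact continuous_const.add
    (intervalIntegral.continuous_primitive (fun a b => h.loc.intervalIntegrable' a b) 0)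

theorem IsPrimitive.integral_mul {f g ψ : ℝ → ℝ} (h : IsPrimitive f g) (hψ : ContDiff ℝ 1 ψ)
    (a b : ℝ) : ∫ x in a..b, ψ x * g x
      = ψ b * f b - ψ a * f a - ∫ x in a..b, deriv ψ x * f x := by
  rw [← AbsolutelyContinuousOnInterval.integral_mul_deriv_eq_deriv_mul
    (hψ.contDiffOn.absolutelyContinuousOnInterval) (h.absolutelyContinuous a b)]
  refine intervalIntegral.integral_congr_ae ?_
  filter_upwards [h.ae_hasDerivAt] with x hx _
  rw [hx.deriv]

theorem IsPrimitive.of_hasDerivAt {f g : ℝ → ℝ} (h : ∀ x, HasDerivAt f (g x) x)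
    (hg : Continuous g) : IsPrimitive f g :=
  ⟨hg.locallyIntegrable, fun x => by
    rw [intervalIntegral.integral_eq_sub_of_hasDerivAt (fun y _ => h y)
      (hg.intervalIntegrable _ _)]
    ring⟩

theorem IsPrimitive.mul_contDiff {f g ψ : ℝ → ℝ} (h : IsPrimitive f g) (hψ : ContDiff ℝ 1 ψ) :
    IsPrimitive (fun x => ψ x * f x) (fun x => ψ x * g x + deriv ψ x * f x) := by
  have h1 : LocallyIntegrable (fun x => ψ x * g x) := by
    rw [locallyIntegrable_iff]
    intro K hK
    exact (h.loc.integrableOn_isCompact hK).continuousOn_mul hψ.continuous.continuousOn hK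
  have h2 : Continuous (fun x => deriv ψ x * f x) :=
    (hψ.continuous_deriv le_rfl).mul h.continuous
  refine ⟨h1.add h2.locallyIntegrable, fun x => ?_⟩
  rw [intervalIntegral.integral_add (h1.intervalIntegrable' 0 x) (h2.intervalIntegrable 0 x),
    h.integral_mul hψ]
  ring

theorem IsPrimitive.add {f g f' g' : ℝ → ℝ} (h : IsPrimitive f g) (h' : IsPrimitive f' g') :
    IsPrimitive (fun x => f x + f' x) (fun x => g x + g' x) :=
  ⟨h.loc.add h'.loc, fun x => by
    rw [intervalIntegral.integral_add (h.loc.intervalIntegrable' 0 x)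
      (h'.loc.intervalIntegrable' 0 x), h.eq x, h'.eq x]
    ring⟩

theorem exists_bound_of_hasCompactSupport {ψ : ℝ → ℝ} (hc : HasCompactSupport ψ) :
    ∃ R > 0, ∀ x, R ≤ |x| → ψ x = 0 := by
  obtain ⟨R, hR⟩ := hc.isBounded.subset_ball 0
  refine ⟨max R 1, by positivity, fun x hx => ?_⟩
  by_contra h
  have := hR (subset_tsupport ψ h)
  rw [mem_ball_zero_iff, Real.norm_eq_abs] at this
  linarith [le_max_left R 1]

theorem integral_eq_interval {f : ℝ → ℝ} {R : ℝ} (h : ∀ x, R ≤ |x| → f x = 0) :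
    ∫ x, f x = ∫ x in -R..R, f x := by
  rw [intervalIntegral.integral_eq_integral_of_support_subset]
  intro x hx
  by_contra h'
  refine hx (h x ?_)
  by_contra h2
  push Not at h2
  exact h' ⟨(abs_lt.1 h2).1, (abs_lt.1 h2).2.le⟩

theorem IsPrimitive.integral_mul_test {f g ψ : ℝ → ℝ} (h : IsPrimitive f g)
    (hψ : ContDiff ℝ (⊤ : ℕ∞) ψ) (hc : HasCompactSupport ψ) :
    ∫ x, f x * deriv ψ x = -∫ x, g x * ψ x := by
  obtain ⟨R, hR, hR'⟩ := exists_bound_of_hasCompactSupport hc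
  obtain ⟨S, hS, hS'⟩ := exists_bound_of_hasCompactSupport hc.deriv
  have hm : 0 < max R S := lt_max_of_lt_left hR
  rw [integral_eq_interval (R := max R S) (fun x hx => by rw [hS' x (le_trans (le_max_right _ _) hx), mul_zero]),
    integral_eq_interval (R := max R S) (fun x hx => by rw [hR' x (le_trans (le_max_left _ _) hx), mul_zero])]
  have := h.integral_mul (hψ.of_le (by exact_mod_cast le_top)) (-(max R S)) (max R S)
  rw [hR' _ (by rw [abs_of_pos hm]; exact le_max_left _ _),
    hR' _ (by rw [abs_neg, abs_of_pos hm]; exact le_max_left _ _)] at this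
  simp only [mul_comm (g _), mul_comm (f _)]
  linarith

/-- A locally integrable function with vanishing distributional derivative is constant. -/
theorem ae_const_of_integral_mul_deriv_eq_zero {w : ℝ → ℝ} (hw : LocallyIntegrable w)
    (h : ∀ ψ : ℝ → ℝ, ContDiff ℝ (⊤ : ℕ∞) ψ → HasCompactSupport ψ →
      ∫ x, w x * deriv ψ x = 0) : ∃ c, ∀ᵐ x, w x = c := by
  let χ0 : ContDiffBump (0 : ℝ) := ⟨1, 2, by norm_num, by norm_num⟩
  set χ : ℝ → ℝ := χ0.normed volume with hχ
  have hχs : ContDiff ℝ (⊤ : ℕ∞) χ := χ0.contDiff_normed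
  have hχc : HasCompactSupport χ := χ0.hasCompactSupport_normed
  have hχi : ∫ x, χ x = 1 := χ0.integral_normed
  refine ⟨∫ x, w x * χ x, ?_⟩
  have hint : ∀ ψ : ℝ → ℝ, ContDiff ℝ (⊤ : ℕ∞) ψ → HasCompactSupport ψ →
      Integrable (fun x => w x * ψ x) := fun ψ hψ hc => by
    have := hw.integrable_smul_left_of_hasCompactSupport hψ.continuous hc
    simpa [mul_comm] using this
  refine ae_eq_of_integral_contDiff_smul_eq hw (continuous_const.locallyIntegrable) ?_
  intro ψ hψ hc
  set I := ∫ x, ψ x with hI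
  set θ' : ℝ → ℝ := fun x => ψ x - I * χ x with hθ'
  have hψi : Integrable ψ := hψ.continuous.integrable_of_hasCompactSupport hc
  have hχint : Integrable χ := hχs.continuous.integrable_of_hasCompactSupport hχc
  obtain ⟨R, hR, hR'⟩ := exists_bound_of_hasCompactSupport hc
  obtain ⟨S, hS, hS'⟩ := exists_bound_of_hasCompactSupport hχc
  set m := max R S
  have hm : 0 < m := lt_max_of_lt_left hR
  have hz : ∀ x, m ≤ |x| → θ' x = 0 := fun x hx => by
    simp only [hθ']
    rw [hR' x (le_trans (le_max_left _ _) hx), hS' x (le_trans (le_max_right _ _) hx)]; ring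
  have hθs : ContDiff ℝ (⊤ : ℕ∞) θ' := hψ.sub (contDiff_const.mul hχs)
  have htot : ∫ x in -m..m, θ' x = 0 := by
    rw [← integral_eq_interval hz]
    simp only [hθ']
    rw [integral_sub hψi (hχint.const_mul _), integral_const_mul, hχi, ← hI]; ring
  set θ : ℝ → ℝ := fun x => ∫ y in -m..x, θ' y with hθ
  have hd : ∀ x, HasDerivAt θ (θ' x) x := fun x =>
    intervalIntegral.integral_hasDerivAt_right (hθs.continuous.intervalIntegrable _ _)
      (hθs.continuous.stronglyMeasurableAtFilter _ _) hθs.continuous.continuousAt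
  have hdd : deriv θ = θ' := funext fun x => (hd x).deriv
  have hθsm : ContDiff ℝ (⊤ : ℕ∞) θ := by
    rw [contDiff_infty_iff_deriv]
    exact ⟨fun x => (hd x).differentiableAt, by rw [hdd]; exact hθs⟩
  have hθc : HasCompactSupport θ := by
    refine HasCompactSupport.intro (isCompact_Icc (a := -m) (b := m)) fun x hx => ?_
    simp only [hθ]
    rcases le_or_gt x (-m) with h1 | h1
    · refine (intervalIntegral.integral_congr (g := fun _ => 0) fun y hy => ?_).trans (by simp)
      rw [uIcc_of_ge h1] at hy
      refine hz y (le_trans ?_ (neg_le_abs y))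
      linarith [hy.2]
    · have h2 : m < x := by
        by_contra h2
        exact hx ⟨h1.le, not_lt.1 h2⟩
      rw [← intervalIntegral.integral_add_adjacent_intervals (b := m)
        (hθs.continuous.intervalIntegrable _ _) (hθs.continuous.intervalIntegrable _ _), htot, zero_add]
      refine (intervalIntegral.integral_congr (g := fun _ => 0) fun y hy => ?_).trans (by simp)
      rw [uIcc_of_le h2.le] at hy
      exact hz y (le_trans hy.1 (le_abs_self y))
  have h0 := h θ hθsm hθc
  rw [hdd] at h0
  have h3 : ∫ x, w x * θ' x = (∫ x, w x * ψ x) - I * ∫ x, w x * χ x := by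
    rw [← integral_const_mul, ← integral_sub (hint ψ hψ hc) ((hint χ hχs hχc).const_mul _)]
    congr 1; funext x; simp only [hθ']; ring
  simp only [smul_eq_mul]
  rw [integral_mul_const, ← hI]
  simp only [mul_comm (ψ _)]
  linarith

theorem IsWeakDeriv.test_succ {u w w' : ℝ → ℝ} {j : ℕ} (h : IsWeakDeriv j u w)
    (h' : IsWeakDeriv (j + 1) u w') {ψ : ℝ → ℝ} (hψ : ContDiff ℝ (⊤ : ℕ∞) ψ)
    (hc : HasCompactSupport ψ) : ∫ x, w x * deriv ψ x = -∫ x, w' x * ψ x := by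
  have h1 := h'.2.2 ψ hψ hc
  have h2 := h.2.2 (deriv ψ) ((contDiff_infty_iff_deriv.1 hψ).2) hc.deriv
  rw [iteratedDeriv_succ'] at h1
  rw [h1, pow_succ] at h2
  have : ((-1 : ℝ) ^ j) ≠ 0 := pow_ne_zero _ (by norm_num)
  apply mul_left_cancel₀ this
  linarith

theorem IsWeakDeriv.exists_primitive {u w w' : ℝ → ℝ} {j : ℕ} (h : IsWeakDeriv j u w)
    (h' : IsWeakDeriv (j + 1) u w') : ∃ W, IsPrimitive W w' ∧ w =ᵐ[volume] W := by
  set P : ℝ → ℝ := fun x => ∫ y in (0 : ℝ)..x, w' y with hP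
  have hPp : IsPrimitive P w' := ⟨h'.2.1, fun x => by simp [hP]⟩
  obtain ⟨c, hc⟩ := ae_const_of_integral_mul_deriv_eq_zero
    (w := fun x => w x - P x) (h.2.1.sub hPp.continuous.locallyIntegrable) (fun ψ hψ hψc => by
      have h1 := h.test_succ h' hψ hψc
      have h2 := hPp.integral_mul_test hψ hψc
      have hd := (contDiff_infty_iff_deriv.1 hψ).2
      have i1 : Integrable (fun x => w x * deriv ψ x) := by
        simpa [mul_comm] using
          h.2.1.integrable_smul_left_of_hasCompactSupport hd.continuous hψc.deriv
      have i2 : Integrable (fun x => P x * deriv ψ x) := by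
        simpa [mul_comm] using hPp.continuous.locallyIntegrable.integrable_smul_left_of_hasCompactSupport
            hd.continuous hψc.deriv
      simp only [sub_mul]
      rw [integral_sub i1 i2, h1, h2]; ring)
  refine ⟨fun x => c + P x, ⟨h'.2.1, fun x => by simp [hP]⟩, ?_⟩
  filter_upwards [hc] with x hx
  linarith

theorem IsWeakDeriv.ae_eq_self {u w : ℝ → ℝ} (h : IsWeakDeriv 0 u w) : w =ᵐ[volume] u := by
  refine ae_eq_of_integral_contDiff_smul_eq h.2.1 h.1 fun ψ hψ hc => ?_
  have := h.2.2 ψ hψ hc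
  simp only [iteratedDeriv_zero, pow_zero, one_mul] at this
  simp only [smul_eq_mul, mul_comm (ψ _)]
  exact this.symm

/-- Weak derivatives of a continuous function are classical below the top order. -/
theorem contDiff_of_isWeakDeriv {u : ℝ → ℝ} (hu : Continuous u) {w : ℕ → ℝ → ℝ} {k : ℕ}
    (h : ∀ j ≤ k + 1, IsWeakDeriv j u (w j)) :
    ContDiff ℝ k u ∧ (∀ j ≤ k, w j =ᵐ[volume] iteratedDeriv j u) ∧
      IsPrimitive (iteratedDeriv k u) (w (k + 1)) := by
  induction k with
  | zero =>
    obtain ⟨W, hW, hW'⟩ := (h 0 (by norm_num)).exists_primitive (h 1 (by norm_num))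
    have h0 := (h 0 (by norm_num)).ae_eq_self
    have : u = W := (hu.ae_eq_iff_eq volume hW.continuous).1 (h0.symm.trans hW')
    refine ⟨by exact_mod_cast contDiff_zero.2 hu, fun j hj => ?_, ?_⟩
    · rw [Nat.le_zero.1 hj, iteratedDeriv_zero]; exact h0
    · rw [iteratedDeriv_zero, this]; exact hW
  | succ k ih =>
    obtain ⟨h1, h2, h3⟩ := ih fun j hj => h j (by omega)
    obtain ⟨W, hW, hW'⟩ := (h (k + 1) (by omega)).exists_primitive (h (k + 2) (by omega))
    have hd : ∀ x, HasDerivAt (iteratedDeriv k u) (W x) x := fun x => by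
      rw [show iteratedDeriv k u = fun x => iteratedDeriv k u 0 + ∫ y in (0 : ℝ)..x, W y from
        funext fun x => by
          rw [h3.eq x]
          congr 1
          exact intervalIntegral.integral_congr_ae (hW'.mono fun y hy _ => hy)]
      exact (intervalIntegral.integral_hasDerivAt_right (hW.continuous.intervalIntegrable _ _)
        (hW.continuous.stronglyMeasurableAtFilter _ _) hW.continuous.continuousAt).const_add _
    have hdd : iteratedDeriv (k + 1) u = W := by
      rw [iteratedDeriv_succ]; exact funext fun x => (hd x).deriv
    refine ⟨?_, fun j hj => ?_, by rw [hdd]; exact hW⟩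
    · rw [contDiff_nat_iff_iteratedDeriv] at h1 ⊢
      refine ⟨fun m hm => ?_, fun m hm => ?_⟩
      · rcases Nat.lt_or_ge m (k + 1) with h' | h'
        · exact h1.1 m (by omega)
        · rw [show m = k + 1 by omega, hdd]; exact hW.continuous
      · rcases Nat.lt_or_ge m k with h' | h'
        · exact h1.2 m h'
        · rw [show m = k by omega]; exact fun x => (hd x).differentiableAt
    · rcases Nat.lt_or_ge j (k + 1) with h' | h'
      · exact h2 j (by omega)
      · rw [show j = k + 1 by omega, hdd]; exact hW'

theorem MemSobolevLoc.isWeakDeriv {k : ℕ} {u : ℝ → ℝ} (hu : MemSobolevLoc k u) {j : ℕ}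
    (hj : j ≤ k) : IsWeakDeriv j u (weakDeriv j u) := by
  obtain ⟨g, hg, -⟩ := hu j hj
  have : ∃ g, IsWeakDeriv j u g := ⟨g, hg⟩
  rw [weakDeriv, dif_pos this]
  exact this.choose_spec

theorem MemSobolevStar.regular {L : ℝ} {k : ℕ} {u : ℝ → ℝ} (hu : MemSobolevStar L (k + 1) u) :
    ContDiff ℝ k u ∧ IsPrimitive (iteratedDeriv k u) (weakDeriv (k + 1) u) :=
  have h := contDiff_of_isWeakDeriv hu.1 (w := fun j => weakDeriv j u) (k := k)
    fun _ hj => hu.2.1.isWeakDeriv hj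
  ⟨h.1, h.2.2⟩

theorem lintegral_weakDeriv_le (L : ℝ) (k : ℕ) (u : ℝ → ℝ) :
    ∫⁻ x in Icc 0 L, ‖weakDeriv k u x‖ₑ ^ 2 ≤ sobolevNorm L k u ^ 2 := by
  have h1 : sobolevNorm L k u ^ 2
      = ∑ j ∈ Finset.range (k + 1), ∫⁻ x in Icc 0 L, ‖weakDeriv j u x‖ₑ ^ 2 := by
    rw [sobolevNorm, ← ENNReal.rpow_natCast, ← ENNReal.rpow_mul]
    norm_num
  rw [h1]
  exact Finset.single_le_sum (f := fun j => ∫⁻ x in Icc 0 L, ‖weakDeriv j u x‖ₑ ^ 2)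
    (fun _ _ => zero_le) (Finset.self_mem_range_succ k)

/-! ### Fourier coefficients on a period -/

/-- The frequency `2πk/L`. -/
def freq (L : ℝ) (k : ℤ) : ℝ := 2 * Real.pi * k / L

/-- The exponential `e^{2πikx/L}`. -/
def expo (L : ℝ) (k : ℤ) (x : ℝ) : ℂ := Complex.exp (((freq L k * x : ℝ) : ℂ) * Complex.I)

/-- The Fourier coefficient of a real function on `[0, L]`. -/
def fc (L : ℝ) (f : ℝ → ℝ) (k : ℤ) : ℂ :=
  ((1 / L : ℝ) : ℂ) * ∫ x in (0 : ℝ)..L, expo L (-k) x * (f x : ℂ)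

variable {L : ℝ}

theorem freq_neg (k : ℤ) : freq L (-k) = -freq L k := by
  rw [freq, freq]; push_cast; ring

theorem freq_zero : freq L 0 = 0 := by simp [freq]

theorem norm_expo (k : ℤ) (x : ℝ) : ‖expo L k x‖ = 1 := Complex.norm_exp_ofReal_mul_I _

theorem hasDerivAt_expo (k : ℤ) (x : ℝ) :
    HasDerivAt (expo L k) ((freq L k : ℂ) * Complex.I * expo L k x) x := by
  have h1 : HasDerivAt (fun x : ℝ => ((freq L k * x : ℝ) : ℂ) * Complex.I)
      (((freq L k * 1 : ℝ) : ℂ) * Complex.I) x :=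
    (((hasDerivAt_id x).const_mul (freq L k)).ofReal_comp).mul_const _
  refine (h1.cexp).congr_deriv ?_
  rw [expo, mul_one, mul_comm]

theorem contDiff_expo (k : ℤ) : ContDiff ℝ (⊤ : ℕ∞) (expo L k) := by
  unfold expo
  refine ContDiff.cexp (ContDiff.mul ?_ contDiff_const)
  exact Complex.ofRealCLM.contDiff.comp (contDiff_const.mul contDiff_id)

theorem continuous_expo (k : ℤ) : Continuous (expo L k) := (contDiff_expo k).continuous

theorem expo_period (hL : 0 < L) (k : ℤ) : expo L k L = 1 := by
  rw [expo, freq, div_mul_cancel₀ _ hL.ne']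
  have := Complex.exp_int_mul_two_pi_mul_I k
  rw [← this]
  congr 1; push_cast; ring

theorem expo_zero (k : ℤ) : expo L k 0 = 1 := by simp [expo]

theorem fourier_eq_expo (k : ℤ) (x : ℝ) : fourier k (x : AddCircle L) = expo L k x := by
  rw [fourier_coe_apply, expo, freq]
  congr 1; push_cast; ring

theorem fc_eq_fourierCoeffOn (hL : 0 < L) (f : ℝ → ℝ) (k : ℤ) :
    fc L f k = fourierCoeffOn hL (fun x => (f x : ℂ)) k := by
  rw [fourierCoeffOn_eq_integral, fc, Complex.real_smul, sub_zero]
  simp only [fourier_eq_expo, smul_eq_mul]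

theorem intervalIntegrable_expo_mul {f : ℝ → ℝ} {a b : ℝ} (hf : IntervalIntegrable f volume a b)
    (k : ℤ) : IntervalIntegrable (fun x => expo L k x * (f x : ℂ)) volume a b :=
  IntervalIntegrable.continuousOn_mul (by
    rw [intervalIntegrable_iff] at hf ⊢; exact hf.ofReal) (continuous_expo k).continuousOn

theorem fc_add {f g : ℝ → ℝ} (hf : IntervalIntegrable f volume 0 L)
    (hg : IntervalIntegrable g volume 0 L) (k : ℤ) :
    fc L (fun x => f x + g x) k = fc L f k + fc L g k := by
  rw [fc, fc, fc, ← mul_add, ← intervalIntegral.integral_add (intervalIntegrable_expo_mul hf _)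
    (intervalIntegrable_expo_mul hg _)]
  simp only [Complex.ofReal_add, mul_add]

theorem fc_const_mul (c : ℝ) (f : ℝ → ℝ) (k : ℤ) : fc L (fun x => c * f x) k = c * fc L f k := by
  rw [fc, fc, mul_left_comm]
  congr 1
  rw [← intervalIntegral.integral_const_mul]
  congr 1; funext x; push_cast; ring

theorem fc_sub {f g : ℝ → ℝ} (hf : IntervalIntegrable f volume 0 L)
    (hg : IntervalIntegrable g volume 0 L) (k : ℤ) :
    fc L (fun x => f x - g x) k = fc L f k - fc L g k := by
  rw [fc, fc, fc, ← mul_sub, ← intervalIntegral.integral_sub (intervalIntegrable_expo_mul hf _)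
    (intervalIntegrable_expo_mul hg _)]
  simp only [Complex.ofReal_sub, mul_sub]

theorem hasSum_sq_fc (hL : 0 < L) {f : ℝ → ℝ} (hf : MemLp f 2 (volume.restrict (Ioc 0 L))) :
    HasSum (fun k => ‖fc L f k‖ ^ 2) (1 / L * ∫ x in (0 : ℝ)..L, f x ^ 2) := by
  have := hasSum_sq_fourierCoeffOn hL (f := fun x => (f x : ℂ)) hf.ofReal
  simp only [← fc_eq_fourierCoeffOn, Complex.norm_real, sq_abs, Real.norm_eq_abs, sub_zero,
    smul_eq_mul] at this
  rw [one_div]; exact this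

theorem _root_.MeasureTheory.MemLp.intervalIntegrable_of_two {f : ℝ → ℝ} (hL : 0 < L)
    (hf : MemLp f 2 (volume.restrict (Ioc 0 L))) : IntervalIntegrable f volume 0 L := by
  rw [intervalIntegrable_iff_integrableOn_Ioc_of_le hL.le]
  exact hf.integrable (by norm_num)

theorem hasSum_re_fc_mul (hL : 0 < L) {f g : ℝ → ℝ} (hf : MemLp f 2 (volume.restrict (Ioc 0 L)))
    (hg : MemLp g 2 (volume.restrict (Ioc 0 L))) :
    HasSum (fun k => (fc L f k * (starRingEnd ℂ) (fc L g k)).re)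
      (1 / L * ∫ x in (0 : ℝ)..L, f x * g x) := by
  have h1 := hasSum_sq_fc hL (hf.add hg)
  have h2 := hasSum_sq_fc hL (hf.sub hg)
  have h3 := (h1.sub h2).mul_left (1 / 4)
  have i1 : IntervalIntegrable (fun x => (f x + g x) ^ 2) volume 0 L := by
    rw [intervalIntegrable_iff_integrableOn_Ioc_of_le hL.le]; exact (hf.add hg).integrable_sq
  have i2 : IntervalIntegrable (fun x => (f x - g x) ^ 2) volume 0 L := by
    rw [intervalIntegrable_iff_integrableOn_Ioc_of_le hL.le]; exact (hf.sub hg).integrable_sq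
  have e3 : ∀ k, (fc L f k * (starRingEnd ℂ) (fc L g k)).re
      = 1 / 4 * (‖fc L (f + g) k‖ ^ 2 - ‖fc L (f - g) k‖ ^ 2) := fun k => by
    have e1 : fc L (f + g) k = fc L f k + fc L g k :=
      fc_add (hf.intervalIntegrable_of_two hL) (hg.intervalIntegrable_of_two hL) k
    have e2 : fc L (f - g) k = fc L f k - fc L g k :=
      fc_sub (hf.intervalIntegrable_of_two hL) (hg.intervalIntegrable_of_two hL) k
    rw [e1, e2, ← Complex.normSq_eq_norm_sq, ← Complex.normSq_eq_norm_sq, Complex.normSq_apply,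
      Complex.normSq_apply, Complex.mul_re, Complex.conj_re, Complex.conj_im, Complex.add_re,
      Complex.add_im, Complex.sub_re, Complex.sub_im]
    ring
  have e4 : 1 / L * ∫ x in (0 : ℝ)..L, f x * g x = 1 / 4 * ((1 / L * ∫ x in (0 : ℝ)..L, (f + g) x ^ 2)
      - 1 / L * ∫ x in (0 : ℝ)..L, (f - g) x ^ 2) := by
    rw [← mul_sub]
    simp only [Pi.add_apply, Pi.sub_apply]
    rw [← intervalIntegral.integral_sub i1 i2, mul_left_comm]
    congr 1
    rw [← intervalIntegral.integral_const_mul]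
    congr 1; funext x; ring
  rw [e4]
  simp only [e3]
  exact h3

theorem integral_re_im {F : ℝ → ℂ} {a b : ℝ} (hF : IntervalIntegrable F volume a b) :
    ∫ x in a..b, F x = ((∫ x in a..b, (F x).re : ℝ) : ℂ) + ((∫ x in a..b, (F x).im : ℝ) : ℂ) * Complex.I := by
  apply Complex.ext
  · have := (Complex.reCLM.intervalIntegral_comp_comm hF)
    simp at this ⊢
    exact this.symm
  · have := (Complex.imCLM.intervalIntegral_comp_comm hF)
    simp at this ⊢
    exact this.symm

theorem IsPrimitive.integral_mul_complex {f g : ℝ → ℝ} {ψ : ℝ → ℂ} (h : IsPrimitive f g)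
    (hψ : ContDiff ℝ 1 ψ) (a b : ℝ) : ∫ x in a..b, ψ x * (g x : ℂ)
      = ψ b * f b - ψ a * f a - ∫ x in a..b, deriv ψ x * (f x : ℂ) := by
  have hg := h.loc.intervalIntegrable' a b
  have hgc : IntervalIntegrable (fun x => (g x : ℂ)) volume a b := by
    rw [intervalIntegrable_iff] at hg ⊢; exact hg.ofReal
  have hd := hψ.continuous_deriv le_rfl
  have hfc : Continuous fun x => (f x : ℂ) := Complex.continuous_ofReal.comp h.continuous
  have hre : ∀ x, HasDerivAt (fun x => (ψ x).re) (deriv ψ x).re x := fun x =>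
    Complex.reCLM.hasFDerivAt.comp_hasDerivAt x (hψ.differentiable one_ne_zero x).hasDerivAt
  have him : ∀ x, HasDerivAt (fun x => (ψ x).im) (deriv ψ x).im x := fun x =>
    Complex.imCLM.hasFDerivAt.comp_hasDerivAt x (hψ.differentiable one_ne_zero x).hasDerivAt
  have h1 := h.integral_mul (ψ := fun x => (ψ x).re) (Complex.reCLM.contDiff.comp hψ) a b
  have h2 := h.integral_mul (ψ := fun x => (ψ x).im) (Complex.imCLM.contDiff.comp hψ) a b
  rw [integral_re_im (hgc.continuousOn_mul hψ.continuous.continuousOn),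
    integral_re_im (F := fun x => deriv ψ x * (f x : ℂ)) ((hd.mul hfc).intervalIntegrable a b)]
  simp only [Complex.re_mul_ofReal, Complex.im_mul_ofReal]
  rw [h1, h2]
  simp only [(hre _).deriv, (him _).deriv]
  apply Complex.ext <;> simp

theorem IsPrimitive.fc_eq {f g : ℝ → ℝ} (h : IsPrimitive f g) (hL : 0 < L) (hper : f L = f 0)
    (k : ℤ) : fc L g k = (freq L k : ℂ) * Complex.I * fc L f k := by
  rw [fc, fc, h.integral_mul_complex ((contDiff_expo _).of_le (by exact_mod_cast le_top)), hper, expo_period hL, expo_zero,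
    sub_self, zero_sub]
  simp only [(hasDerivAt_expo _ _).deriv, mul_assoc]
  simp only [intervalIntegral.integral_const_mul, freq_neg]
  push_cast; ring

theorem hasSum_fourier (hL : 0 < L) {v : ℝ → ℝ} (hv : Continuous v) (hper : ∀ x, v (x + L) = v x)
    (hs : Summable (fc L v)) (x : ℝ) : HasSum (fun k => fc L v k * expo L k x) (v x : ℂ) := by
  have : Fact (0 < L) := ⟨hL⟩
  have hp : Function.Periodic (fun x => (v x : ℂ)) L := fun x => by simp only [hper]
  have hc : Continuous hp.lift := by
    refine continuous_quot_lift _ ?_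
    exact Complex.continuous_ofReal.comp hv
  let F : C(AddCircle L, ℂ) := ⟨hp.lift, hc⟩
  have hF : ∀ k, fourierCoeff F k = fc L v k := fun k => by
    rw [fourierCoeff_eq_intervalIntegral _ _ 0, fc, Complex.real_smul, zero_add]
    simp only [fourier_eq_expo, smul_eq_mul]
    rfl
  have h1 := has_pointwise_sum_fourier_series_of_summable (f := F) (by
    rw [show fourierCoeff F = fc L v from funext hF]; exact hs) (x : AddCircle L)
  simp only [hF, fourier_eq_expo, smul_eq_mul] at h1
  exact h1

/-! ### Regularity from decay of Fourier coefficients -/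

theorem hasDerivAt_fourier {c : ℤ → ℂ} (h0 : Summable (fun k => ‖c k‖))
    (h1 : Summable (fun k => |freq L k| * ‖c k‖)) (x : ℝ) :
    HasDerivAt (fun x => (∑' k, c k * expo L k x).re)
      (∑' k, (freq L k : ℂ) * Complex.I * c k * expo L k x).re x := by
  have hd := hasDerivAt_tsum (u := fun k => |freq L k| * ‖c k‖)
    (g := fun k x => c k * expo L k x)
    (g' := fun k x => (freq L k : ℂ) * Complex.I * c k * expo L k x) (y₀ := 0) h1
    (fun k y => ((hasDerivAt_expo k y).const_mul (c k)).congr_deriv (by ring))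
    (fun k y => by
      rw [norm_mul, norm_expo, mul_one, norm_mul, norm_mul, Complex.norm_I, mul_one,
        Complex.norm_real, Real.norm_eq_abs])
    (by simpa [expo_zero] using h0.of_norm) x
  exact Complex.reCLM.hasFDerivAt.comp_hasDerivAt x hd

theorem pow_mul_norm_freq_mul (c : ℂ) (j : ℕ) (k : ℤ) :
    |freq L k| ^ j * ‖(freq L k : ℂ) * Complex.I * c‖ = |freq L k| ^ (j + 1) * ‖c‖ := by
  rw [norm_mul, norm_mul, Complex.norm_I, mul_one, Complex.norm_real, Real.norm_eq_abs]; ring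

theorem CB.of_fourier {c : ℤ → ℂ} {n : ℕ} {B : ℝ}
    (hs : ∀ j ≤ n, Summable (fun k => |freq L k| ^ j * ‖c k‖))
    (hB : ∀ j ≤ n, ∑' k, |freq L k| ^ j * ‖c k‖ ≤ B) :
    CB n B (fun x => (∑' k, c k * expo L k x).re) := by
  have key : ∀ c : ℤ → ℂ, Summable (fun k => ‖c k‖) → ∑' k, ‖c k‖ ≤ B →
      Continuous (fun x => (∑' k, c k * expo L k x).re) ∧
        ∀ x, |(∑' k, c k * expo L k x).re| ≤ B := by
    intro c hc hcB
    have hn : ∀ k x, ‖c k * expo L k x‖ = ‖c k‖ := fun k x => by rw [norm_mul, norm_expo, mul_one]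
    refine ⟨Complex.continuous_re.comp (continuous_tsum
      (fun k => continuous_const.mul (continuous_expo k)) hc fun k x => (hn k x).le), fun x => ?_⟩
    refine (Complex.abs_re_le_norm _).trans ((norm_tsum_le_tsum_norm ?_).trans ?_)
    · simpa only [hn] using hc
    · simpa only [hn] using hcB
  induction n generalizing c with
  | zero =>
    have := key c (by simpa using hs 0 le_rfl) (by simpa using hB 0 le_rfl)
    exact this
  | succ n ih =>
    have h0 := key c (by simpa using hs 0 (by omega)) (by simpa using hB 0 (by omega))
    refine CB.of_hasDerivAt (g' := fun x => (∑' k, (freq L k : ℂ) * Complex.I * c k * expo L k x).re)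
      (hasDerivAt_fourier (by simpa using hs 0 (by omega)) (by simpa using hs 1 (by omega))) h0.2
      (ih (fun j hj => by simpa only [pow_mul_norm_freq_mul] using hs (j + 1) (by omega))
        (fun j hj => by simpa only [pow_mul_norm_freq_mul] using hB (j + 1) (by omega)))

theorem freq_ne_zero (hL : 0 < L) {k : ℤ} (hk : k ≠ 0) : freq L k ≠ 0 := by
  rw [freq]
  have : (k : ℝ) ≠ 0 := by exact_mod_cast hk
  have := Real.pi_pos
  positivity

theorem le_abs_freq (hL : 0 < L) {k : ℤ} (hk : k ≠ 0) : 2 * Real.pi / L ≤ |freq L k| := by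
  have h1 : (1 : ℝ) ≤ |(k : ℝ)| := by exact_mod_cast Int.one_le_abs hk
  have := Real.pi_pos
  rw [freq, abs_div, abs_mul, abs_of_pos hL, abs_of_pos (by positivity : 0 < 2 * Real.pi)]
  rw [div_le_div_iff_of_pos_right hL]
  nlinarith

theorem summable_inv_freq_sq : Summable (fun k => (freq L k ^ 2)⁻¹) := by
  have h1 : Summable (fun k : ℤ => 1 / (k : ℝ) ^ 2) := by
    exact Real.summable_one_div_int_pow.2 (by norm_num)
  refine (h1.mul_left (L ^ 2 / (2 * Real.pi) ^ 2)).congr fun k => ?_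
  rw [freq, div_pow, inv_div, mul_pow]
  rw [div_mul_div_comm, mul_one, mul_pow, mul_pow]

theorem exists_coeff_bound (hL : 0 < L) : ∃ D, 0 ≤ D ∧ ∀ (k : ℤ) (r : ℝ) (j : ℕ), 0 ≤ r → j ≤ 6 →
    (k = 0 → 1 ≤ j) → |freq L k| ^ j * r ≤ D * (freq L k ^ 14 * r ^ 2 + (freq L k ^ 2)⁻¹) := by
  set w := 2 * Real.pi / L with hw
  have hw0 : 0 < w := by have := Real.pi_pos; positivity
  refine ⟨max 1 w⁻¹ ^ 6, by positivity, fun k r j hr hj hk => ?_⟩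
  by_cases h0 : k = 0
  · rw [h0, freq_zero, abs_zero, zero_pow (by have := hk h0; omega)]
    simp
  · set y := |freq L k| with hy
    have hyw : w ≤ y := le_abs_freq hL h0
    have hy0 : 0 < y := hw0.trans_le hyw
    have e1 : freq L k ^ 14 = y ^ 14 := by
      rw [hy, show 14 = 2 * 7 by norm_num, pow_mul, pow_mul, sq_abs]
    have e2 : freq L k ^ 2 = y ^ 2 := by rw [hy, sq_abs]
    rw [e1, e2]
    have h1 : y ^ j ≤ max 1 w⁻¹ ^ 6 * y ^ 6 := by
      have h2 : 1 ≤ max 1 w⁻¹ * y := by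
        calc (1 : ℝ) = w⁻¹ * w := by field_simp
          _ ≤ max 1 w⁻¹ * y := by gcongr; exact le_max_right _ _
      calc y ^ j ≤ (max 1 w⁻¹ * y) ^ j := by
            gcongr
            nlinarith [le_max_left 1 w⁻¹]
        _ ≤ (max 1 w⁻¹ * y) ^ 6 := pow_le_pow_right₀ h2 hj
        _ = _ := by rw [mul_pow]
    have h2 : y ^ 6 * r ≤ y ^ 14 * r ^ 2 + (y ^ 2)⁻¹ := by
      have h3 : y ^ 6 * r = (y ^ 7 * r) * y⁻¹ := by field_simp
      have h4 : (y ^ 2)⁻¹ = (y⁻¹) ^ 2 := by rw [inv_pow]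
      rw [h3, h4]
      nlinarith [sq_nonneg (y ^ 7 * r - y⁻¹), sq_nonneg (y ^ 7 * r), sq_nonneg (y⁻¹)]
    calc y ^ j * r ≤ max 1 w⁻¹ ^ 6 * y ^ 6 * r := by gcongr
      _ = max 1 w⁻¹ ^ 6 * (y ^ 6 * r) := by ring
      _ ≤ _ := by gcongr

/-- A periodic function with finite energy of order seven has six bounded derivatives. -/
theorem exists_CB_of_energy (hL : 0 < L) (E : ℝ) : ∃ B, ∀ v : ℝ → ℝ, Continuous v →
    (∀ x, v (x + L) = v x) → Summable (fun k => freq L k ^ 14 * ‖fc L v k‖ ^ 2) →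
    ∑' k, freq L k ^ 14 * ‖fc L v k‖ ^ 2 ≤ E → Differentiable ℝ v ∧ CB 5 B (deriv v) := by
  obtain ⟨D, hD0, hD⟩ := exists_coeff_bound hL
  have hq := summable_inv_freq_sq (L := L)
  refine ⟨D * (E + ∑' k, (freq L k ^ 2)⁻¹), fun v hv hper hs hE => ?_⟩
  set c := fc L v with hc
  have hb : Summable (fun k => D * (freq L k ^ 14 * ‖c k‖ ^ 2 + (freq L k ^ 2)⁻¹)) :=
    (hs.add hq).mul_left D
  have hbt : ∑' k, D * (freq L k ^ 14 * ‖c k‖ ^ 2 + (freq L k ^ 2)⁻¹)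
      ≤ D * (E + ∑' k, (freq L k ^ 2)⁻¹) := by
    rw [tsum_mul_left, hs.tsum_add hq]; gcongr
  have hs1 : ∀ j, 1 ≤ j → j ≤ 6 → Summable (fun k => |freq L k| ^ j * ‖c k‖) := fun j h1 h6 =>
    Summable.of_nonneg_of_le (fun k => by positivity)
      (fun k => hD k _ j (norm_nonneg _) h6 fun _ => h1) hb
  have ht1 : ∀ j, 1 ≤ j → j ≤ 6 → ∑' k, |freq L k| ^ j * ‖c k‖ ≤ D * (E + ∑' k, (freq L k ^ 2)⁻¹) :=
    fun j h1 h6 => le_trans ((hs1 j h1 h6).tsum_le_tsum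
      (fun k => hD k _ j (norm_nonneg _) h6 fun _ => h1) hb) hbt
  have hs0 : Summable (fun k => ‖c k‖) := by
    have h2 : Summable (fun k : ℤ => if k = 0 then ‖c 0‖ else 0) :=
      summable_of_ne_finset_zero (s := {0}) fun k hk => by simp at hk; simp [hk]
    refine Summable.of_nonneg_of_le (fun k => norm_nonneg _) (fun k => ?_) (hb.add h2)
    by_cases hk : k = 0
    · rw [if_pos hk, hk]
      have : (0 : ℝ) ≤ D * (freq L 0 ^ 14 * ‖c 0‖ ^ 2 + (freq L 0 ^ 2)⁻¹) := by
        simp [freq_zero]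
      linarith
    · rw [if_neg hk, add_zero]
      simpa using hD k ‖c k‖ 0 (norm_nonneg _) (by norm_num) (fun h => absurd h hk)
  have hsum := hasSum_fourier hL hv hper hs0.of_norm
  have hveq : v = fun x => (∑' k, c k * expo L k x).re := by
    funext x; rw [(hsum x).tsum_eq, Complex.ofReal_re]
  have hd : ∀ x, HasDerivAt v (∑' k, (freq L k : ℂ) * Complex.I * c k * expo L k x).re x := by
    intro x
    have := hasDerivAt_fourier (L := L) hs0 (by simpa using hs1 1 le_rfl (by norm_num)) x
    rwa [← hveq] at this
  refine ⟨fun x => (hd x).differentiableAt, ?_⟩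
  rw [show deriv v = _ from funext fun x => (hd x).deriv]
  refine CB.of_fourier (fun j hj => ?_) fun j hj => ?_
  · simpa only [pow_mul_norm_freq_mul] using hs1 (j + 1) (by omega) (by omega)
  · simpa only [pow_mul_norm_freq_mul] using ht1 (j + 1) (by omega) (by omega)

/-! ### The Hilbert transform as a Fourier multiplier -/

section Multiplier

variable {L : ℝ}

/-- The multiplier of the periodic Hilbert transform. -/
def hilbMult (L : ℝ) (k : ℤ) : ℂ :=
  ((1 / L : ℝ) : ℂ) * ∫ y in (0 : ℝ)..L, (expo L (-k) y - 1) * (Real.cot (Real.pi * y / L) : ℂ)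

theorem expo_add (k : ℤ) (x y : ℝ) : expo L k (x + y) = expo L k x * expo L k y := by
  rw [expo, expo, expo, ← Complex.exp_add]; congr 1; push_cast; ring

theorem expo_index_add (k l : ℤ) (x : ℝ) : expo L (k + l) x = expo L k x * expo L l x := by
  rw [expo, expo, expo, ← Complex.exp_add, freq, freq, freq]; congr 1; push_cast; ring

theorem expo_periodic (hL : 0 < L) (k : ℤ) (x : ℝ) : expo L k (x + L) = expo L k x := by
  rw [expo_add, expo_period hL, mul_one]

theorem norm_expo_sub_one_le (k : ℤ) (y : ℝ) : ‖expo L k y - 1‖ ≤ |freq L k| * |y| := by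
  have := Real.norm_exp_I_mul_ofReal_sub_one_le (x := freq L k * y)
  rw [expo, mul_comm _ Complex.I, ← abs_mul]
  exact this

theorem norm_multiplier_integrand_le (hL : 0 < L) (k : ℤ) {y : ℝ} (hy : y ∈ Ioc 0 L) :
    ‖(expo L k y - 1) * (Real.cot (Real.pi * y / L) : ℂ)‖ ≤ |freq L k| * (L / Real.pi) := by
  have h1 : ‖expo L k y - 1‖ ≤ |freq L k| * min y (L - y) := by
    rcases min_cases y (L - y) with ⟨h, -⟩ | ⟨h, -⟩
    · rw [h]
      have := norm_expo_sub_one_le (L := L) k y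
      rwa [abs_of_pos hy.1] at this
    · rw [h]
      have := norm_expo_sub_one_le (L := L) k (y - L)
      rw [abs_of_nonpos (by linarith [hy.2] : y - L ≤ 0), neg_sub, ← expo_periodic hL k (y - L), sub_add_cancel] at this
      exact this
  rw [norm_mul, Complex.norm_real, Real.norm_eq_abs]
  calc ‖expo L k y - 1‖ * |Real.cot (Real.pi * y / L)|
      ≤ |freq L k| * min y (L - y) * |Real.cot (Real.pi * y / L)| := by gcongr
    _ = |freq L k| * (min y (L - y) * |Real.cot (Real.pi * y / L)|) := by ring
    _ ≤ _ := by gcongr; exact abs_cot_mul_min_le hL hy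

theorem measurable_cot_scaled : Measurable fun y : ℝ => (Real.cot (Real.pi * y / L) : ℂ) :=
  Complex.measurable_ofReal.comp (measurable_cot.comp (by fun_prop))

theorem intervalIntegrable_multiplier (hL : 0 < L) (k : ℤ) :
    IntervalIntegrable (fun y => (expo L k y - 1) * (Real.cot (Real.pi * y / L) : ℂ)) volume 0 L := by
  rw [intervalIntegrable_iff_integrableOn_Ioc_of_le hL.le]
  refine Measure.integrableOn_of_bounded (M := |freq L k| * (L / Real.pi)) (by simp) ?_ ?_
  · exact (((continuous_expo k).measurable.sub_const 1).mul measurable_cot_scaled).aestronglyMeasurable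
  · exact (ae_restrict_iff' measurableSet_Ioc).2
      (Eventually.of_forall fun y hy => norm_multiplier_integrand_le hL k hy)

theorem integral_expo (hL : 0 < L) (k : ℤ) :
    ∫ y in (0 : ℝ)..L, expo L k y = if k = 0 then (L : ℂ) else 0 := by
  split_ifs with h
  · simp [h, expo, freq_zero]
  · have h1 : ((freq L k : ℂ) * Complex.I) ≠ 0 :=
      mul_ne_zero (by exact_mod_cast freq_ne_zero hL h) Complex.I_ne_zero
    have h2 := intervalIntegral.integral_eq_sub_of_hasDerivAt
      (fun x _ => hasDerivAt_expo (L := L) k x)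
      ((continuous_const.mul (continuous_expo k)).intervalIntegrable 0 L)
    rw [intervalIntegral.integral_const_mul, expo_period hL, expo_zero, sub_self] at h2
    exact (mul_eq_zero.1 h2).resolve_left h1

theorem expo_neg_one_sub_one_mul_cot (hL : 0 < L) {y : ℝ} (hy : y ∈ Ioo 0 L) :
    (expo L (-1) y - 1) * (Real.cot (Real.pi * y / L) : ℂ) = -Complex.I * (expo L (-1) y + 1) := by
  set θ : ℝ := Real.pi * y / L with hθ
  have hθ0 : 0 < θ := by have := Real.pi_pos; have := hy.1; positivity
  have hθ1 : θ < Real.pi := by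
    rw [hθ, div_lt_iff₀ hL]; exact mul_lt_mul_of_pos_left hy.2 Real.pi_pos
  have hs : (Real.sin θ : ℂ) ≠ 0 := by exact_mod_cast (Real.sin_pos_of_pos_of_lt_pi hθ0 hθ1).ne'
  have he : expo L (-1) y = (Real.cos θ - Real.sin θ * Complex.I) ^ 2 := by
    have h1 : (Real.cos θ - Real.sin θ * Complex.I : ℂ) = Complex.exp (-(θ : ℂ) * Complex.I) := by
      rw [Complex.exp_mul_I, Complex.cos_neg, Complex.sin_neg]; push_cast; ring
    rw [h1, ← Complex.exp_nat_mul, expo, freq, hθ]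
    congr 1; push_cast; ring
  have hsc : (Real.sin θ : ℂ) ^ 2 + (Real.cos θ : ℂ) ^ 2 = 1 := by
    exact_mod_cast Real.sin_sq_add_cos_sq θ
  rw [he, Real.cot_eq_cos_div_sin]
  push_cast at hs hsc ⊢
  set s := Complex.sin θ
  set c := Complex.cos θ
  have hI := Complex.I_sq
  rw [← mul_div_assoc, div_eq_iff hs]
  linear_combination (c - Complex.I * s) * hsc + (-c * s ^ 2 + s ^ 3 * Complex.I) * hI

theorem hilbMult_sub (hL : 0 < L) (k : ℤ) : hilbMult L (k + 1) - hilbMult L k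
    = -Complex.I * ((if k = 0 then 1 else 0) + (if k + 1 = 0 then 1 else 0)) := by
  have h1 : ∫ y in (0 : ℝ)..L, ((expo L (-(k + 1)) y - 1) * (Real.cot (Real.pi * y / L) : ℂ)
      - (expo L (-k) y - 1) * (Real.cot (Real.pi * y / L) : ℂ))
      = ∫ y in (0 : ℝ)..L, -Complex.I * (expo L (-(k + 1)) y + expo L (-k) y) := by
    refine intervalIntegral.integral_congr_Ioo_of_le hL.le fun y hy => ?_
    have h2 := expo_neg_one_sub_one_mul_cot hL hy
    have h3 : expo L (-(k + 1)) y = expo L (-k) y * expo L (-1) y := by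
      rw [← expo_index_add]; congr 1; ring
    simp only [h3]
    linear_combination expo L (-k) y * h2
  rw [hilbMult, hilbMult, ← mul_sub, ← intervalIntegral.integral_sub
    (intervalIntegrable_multiplier hL _) (intervalIntegrable_multiplier hL _), h1,
    intervalIntegral.integral_const_mul, intervalIntegral.integral_add
      ((continuous_expo _).intervalIntegrable _ _) ((continuous_expo _).intervalIntegrable _ _),
    integral_expo hL, integral_expo hL]
  have hLc : (L : ℂ) ≠ 0 := by exact_mod_cast hL.ne'
  simp only [neg_eq_zero]
  push_cast
  split_ifs <;> field_simp <;> ring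

theorem hilbMult_zero : hilbMult L 0 = 0 := by simp [hilbMult, expo, freq_zero]

theorem norm_hilbMult_le (hL : 0 < L) (k : ℤ) : ‖hilbMult L k‖ ≤ 1 := by
  have hpos : ∀ n : ℕ, hilbMult L (n + 1) = -Complex.I := by
    intro n
    induction n with
    | zero =>
      have := hilbMult_sub hL 0
      rw [hilbMult_zero] at this
      simpa using this
    | succ n ih =>
      have := hilbMult_sub hL (n + 1)
      rw [ih, if_neg (by omega), if_neg (by omega)] at this
      push_cast
      linear_combination this
  have hneg : ∀ n : ℕ, hilbMult L (-(n + 1)) = Complex.I := by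
    intro n
    induction n with
    | zero =>
      have := hilbMult_sub hL (-1)
      rw [if_neg (by omega), if_pos (by omega), show (-1 : ℤ) + 1 = 0 by norm_num,
        hilbMult_zero] at this
      push_cast
      simp only [zero_add] at this ⊢
      linear_combination -this
    | succ n ih =>
      have := hilbMult_sub hL (-((n + 1 : ℕ) + 1))
      rw [if_neg (by omega), if_neg (by omega),
        show -(((n + 1 : ℕ) : ℤ) + 1) + 1 = -((n : ℤ) + 1) by push_cast; ring, ih] at this
      linear_combination -this
  rcases lt_trichotomy k 0 with h | h | h
  · obtain ⟨n, rfl⟩ : ∃ n : ℕ, k = -(n + 1) := ⟨(-k - 1).toNat, by omega⟩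
    rw [hneg, Complex.norm_I]
  · rw [h, hilbMult_zero]; simp
  · obtain ⟨n, rfl⟩ : ∃ n : ℕ, k = n + 1 := ⟨(k - 1).toNat, by omega⟩
    rw [hpos, norm_neg, Complex.norm_I]

theorem integral_expo_shift (hL : 0 < L) {v : ℝ → ℝ}
    (hper : ∀ x, v (x + L) = v x) (k : ℤ) (y : ℝ) :
    ∫ x in (0 : ℝ)..L, expo L (-k) x * (v (x - y) : ℂ)
      = expo L (-k) y * ∫ x in (0 : ℝ)..L, expo L (-k) x * (v x : ℂ) := by
  have hp : Function.Periodic (fun x => expo L (-k) x * (v x : ℂ)) L := fun x => by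
    simp only [expo_periodic hL, hper]
  have h1 : ∫ x in (0 : ℝ)..L, expo L (-k) x * (v (x - y) : ℂ)
      = ∫ x in (0 : ℝ)..L, expo L (-k) y * (expo L (-k) (x - y) * (v (x - y) : ℂ)) := by
    congr 1; funext x
    rw [← mul_assoc, ← expo_add, add_sub_cancel]
  rw [h1, intervalIntegral.integral_const_mul,
    intervalIntegral.integral_comp_sub_right (fun x => expo L (-k) x * (v x : ℂ))]
  congr 1
  have := hp.intervalIntegral_add_eq (0 - y) 0
  rw [show L - y = 0 - y + L by ring, this, zero_add]

theorem fc_hilb (hL : 0 < L) {B : ℝ} {v : ℝ → ℝ} (hv : CB 1 B v) (hper : ∀ x, v (x + L) = v x)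
    (k : ℤ) : fc L (hilb L v) k = hilbMult L k * fc L v k := by
  set K : ℝ → ℝ → ℂ := fun x y => expo L (-k) x *
    (((v (x - y) - v x) * Real.cot (Real.pi * y / L) : ℝ) : ℂ) with hK
  have hmeas : Measurable (Function.uncurry K) := by
    have := hv.continuous.measurable
    have := measurable_cot
    have := (continuous_expo (L := L) (-k)).measurable
    simp only [hK, Function.uncurry_def]
    fun_prop
  have hint : Integrable (Function.uncurry K)
      ((volume.restrict (uIoc 0 L)).prod (volume.restrict (uIoc 0 L))) := by
    rw [uIoc_of_le hL.le]
    refine Integrable.of_bound hmeas.aestronglyMeasurable (B * (L / Real.pi)) ?_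
    rw [Measure.prod_restrict, ae_restrict_iff' (measurableSet_Ioc.prod measurableSet_Ioc)]
    refine Eventually.of_forall fun z hz => ?_
    simp only [Function.uncurry_def, hK]
    rw [norm_mul, norm_expo, one_mul, Complex.norm_real]
    exact abs_hilb_integrand_le hL hv hper z.1 hz.2
  have h1 : ∀ x, expo L (-k) x * (hilb L v x : ℂ)
      = ((1 / L : ℝ) : ℂ) * ∫ y in (0 : ℝ)..L, K x y := fun x => by
    simp only [hilb, hK]
    rw [intervalIntegral.integral_const_mul, intervalIntegral.integral_ofReal]
    push_cast; ring
  have h2 : ∀ y, ∫ x in (0 : ℝ)..L, K x y = (expo L (-k) y - 1) * (Real.cot (Real.pi * y / L) : ℂ)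
      * ∫ x in (0 : ℝ)..L, expo L (-k) x * (v x : ℂ) := fun y => by
    have e1 : ∀ x, K x y = (expo L (-k) x * (v (x - y) : ℂ) - expo L (-k) x * (v x : ℂ))
        * (Real.cot (Real.pi * y / L) : ℂ) := fun x => by
      simp only [hK]; push_cast; ring
    have hvc : Continuous fun x => (v x : ℂ) := Complex.continuous_ofReal.comp hv.continuous
    have i1 : IntervalIntegrable (fun x => expo L (-k) x * (v (x - y) : ℂ)) volume 0 L :=
      ((continuous_expo _).mul (hvc.comp (continuous_id.sub continuous_const))).intervalIntegrable _ _
    have i2 : IntervalIntegrable (fun x => expo L (-k) x * (v x : ℂ)) volume 0 L :=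
      ((continuous_expo _).mul hvc).intervalIntegrable _ _
    simp only [e1]
    rw [intervalIntegral.integral_mul_const, intervalIntegral.integral_sub i1 i2, integral_expo_shift hL hper]
    ring
  rw [fc]
  simp only [h1]
  have h3 : ∫ x in (0 : ℝ)..L, ∫ y in (0 : ℝ)..L, K x y = ∫ y in (0 : ℝ)..L, ∫ x in (0 : ℝ)..L, K x y := by
    rw [uIoc_of_le hL.le] at hint
    simp only [intervalIntegral.integral_of_le hL.le]
    exact integral_integral_swap hint
  rw [intervalIntegral.integral_const_mul, h3]
  simp only [h2]
  rw [intervalIntegral.integral_mul_const, fc, hilbMult]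
  ring

end Multiplier

/-! ### Weighted Leibniz estimates -/

section Weights

variable {n : ℕ} {ω : ℕ → ℝ} {f g : ℝ → ℝ} {K K' x : ℝ}

/-- The derivatives of `f` at `x` up to order `n` are bounded by `K` times the weights `ω`. -/
def WeightBound (n : ℕ) (ω : ℕ → ℝ) (K : ℝ) (f : ℝ → ℝ) (x : ℝ) : Prop :=
  ∀ j ≤ n, |iteratedDeriv j f x| ≤ K * ω j

/-- Weights that dominate the products in the Leibniz formula. -/
structure IsWeight (n : ℕ) (ω : ℕ → ℝ) : Prop where
  one_le : ∀ j, 1 ≤ ω j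
  mul_le : ∀ i j, i + j ≤ n → ω i * ω j ≤ ω (i + j)

theorem IsWeight.nonneg (hω : IsWeight n ω) (j : ℕ) : 0 ≤ ω j := zero_le_one.trans (hω.one_le j)

theorem WeightBound.const_nonneg (hω : IsWeight n ω) (h : WeightBound n ω K f x) : 0 ≤ K := by
  have := (abs_nonneg _).trans (h 0 (Nat.zero_le _))
  exact nonneg_of_mul_nonneg_left this (zero_lt_one.trans_le (hω.one_le 0))

theorem exists_weightBound_inv (n : ℕ) (K c : ℝ) (hc : 0 < c) : ∃ K', ∀ (ω : ℕ → ℝ) (f : ℝ → ℝ) (x : ℝ),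
    IsWeight n ω → ContDiff ℝ n f → (∀ y, c ≤ |f y|) → WeightBound n ω K f x →
      WeightBound n ω K' (fun y => 1 / f y) x := by
  have key : ∀ m ≤ n, ∃ K', 0 ≤ K' ∧ ∀ (ω : ℕ → ℝ) (f : ℝ → ℝ) (x : ℝ), IsWeight n ω → ContDiff ℝ n f →
      (∀ y, c ≤ |f y|) → WeightBound n ω K f x → WeightBound m ω K' (fun y => 1 / f y) x := by
    intro m
    induction m with
    | zero =>
      intro _
      refine ⟨1 / c, by positivity, fun ω f x hω hf hfc hb j hj => ?_⟩
      rw [Nat.le_zero.1 hj, iteratedDeriv_zero, abs_div, abs_one]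
      calc 1 / |f x| ≤ 1 / c * 1 := by rw [mul_one]; exact one_div_le_one_div_of_le hc (hfc x)
        _ ≤ _ := by gcongr; exact hω.one_le 0
    | succ m ih =>
      intro hm
      obtain ⟨K', hK'0, hK'⟩ := ih (by omega)
      refine ⟨max K' (2 ^ (m + 1) * (|K| * K') / c), le_max_of_le_left hK'0,
        fun ω f x hω hf hfc hb j hj => ?_⟩
      have hprev := hK' ω f x hω hf hfc hb
      rcases Nat.lt_or_ge j (m + 1) with hj' | hj'
      · refine (hprev j (by omega)).trans ?_
        gcongr
        · exact hω.nonneg j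
        · exact le_max_left _ _
      obtain rfl : j = m + 1 := by omega
      have hne : ∀ y, f y ≠ 0 := fun y h => by have := hfc y; rw [h, abs_zero] at this; linarith
      have hQ : ContDiff ℝ n (fun y => 1 / f y) := contDiff_const.div hf hne
      have hjn : ((m + 1 : ℕ) : WithTop ℕ∞) ≤ n := by exact_mod_cast hm
      have hzero : iteratedDeriv (m + 1) (fun y => f y * (1 / f y)) x = 0 := by
        rw [show (fun y => f y * (1 / f y)) = fun _ => (1 : ℝ) from
          funext fun y => mul_one_div_cancel (hne y), iteratedDeriv_const]
        simp
      rw [iteratedDeriv_fun_mul (hf.of_le hjn).contDiffAt (hQ.of_le hjn).contDiffAt,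
        Finset.sum_range_succ'] at hzero
      simp only [Nat.choose_zero_right, Nat.cast_one, one_mul, iteratedDeriv_zero, Nat.sub_zero] at hzero
      have hK : 0 ≤ K := hb.const_nonneg hω
      have hsum : |∑ i ∈ Finset.range (m + 1), ((m + 1).choose (i + 1) : ℝ) *
          iteratedDeriv (i + 1) f x * iteratedDeriv (m + 1 - (i + 1)) (fun y => 1 / f y) x|
          ≤ 2 ^ (m + 1) * (|K| * K' * ω (m + 1)) := by
        refine (Finset.abs_sum_le_sum_abs _ _).trans ?_
        calc _ ≤ ∑ i ∈ Finset.range (m + 1), ((m + 1).choose (i + 1) : ℝ) * (|K| * K' * ω (m + 1)) := by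
              refine Finset.sum_le_sum fun i hi => ?_
              have hi' := Finset.mem_range.1 hi
              rw [mul_assoc, _root_.abs_mul, Nat.abs_cast]
              refine mul_le_mul_of_nonneg_left ?_ (Nat.cast_nonneg _)
              rw [_root_.abs_mul, abs_of_nonneg hK]
              calc _ ≤ (K * ω (i + 1)) * (K' * ω (m + 1 - (i + 1))) :=
                    mul_le_mul (hb _ (by omega)) (hprev _ (by omega)) (abs_nonneg _)
                      (mul_nonneg hK (hω.nonneg _))
                _ = K * K' * (ω (i + 1) * ω (m + 1 - (i + 1))) := by ring
                _ ≤ K * K' * ω (m + 1) := by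
                    refine mul_le_mul_of_nonneg_left ?_ (mul_nonneg hK hK'0)
                    have := hω.mul_le (i + 1) (m + 1 - (i + 1)) (by omega)
                    rwa [show i + 1 + (m + 1 - (i + 1)) = m + 1 by omega] at this
          _ ≤ 2 ^ (m + 1) * (|K| * K' * ω (m + 1)) := by
              rw [← Finset.sum_mul]
              refine mul_le_mul_of_nonneg_right ?_ (mul_nonneg (by positivity) (hω.nonneg _))
              have h2 : ∑ i ∈ Finset.range (m + 1 + 1), (m + 1).choose i = 2 ^ (m + 1) :=
                Nat.sum_range_choose (m + 1)
              rw [Finset.sum_range_succ'] at h2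
              exact_mod_cast (by omega : ∑ i ∈ Finset.range (m + 1), (m + 1).choose (i + 1) ≤ 2 ^ (m + 1))
      set S := ∑ i ∈ Finset.range (m + 1), ((m + 1).choose (i + 1) : ℝ) *
          iteratedDeriv (i + 1) f x * iteratedDeriv (m + 1 - (i + 1)) (fun y => 1 / f y) x
      set q := iteratedDeriv (m + 1) (fun y => 1 / f y) x
      have h1 : |f x| * |q| = |S| := by
        rw [← _root_.abs_mul, show f x * q = -S by linarith, abs_neg]
      have h2 : c * |q| ≤ 2 ^ (m + 1) * (|K| * K' * ω (m + 1)) := by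
        calc c * |q| ≤ |f x| * |q| := by gcongr; exact hfc x
          _ = |S| := h1
          _ ≤ _ := hsum
      calc |q| ≤ 2 ^ (m + 1) * (|K| * K') / c * ω (m + 1) := by
            rw [div_mul_eq_mul_div, le_div_iff₀ hc]; linarith
        _ ≤ _ := by
            gcongr
            · exact hω.nonneg _
            · exact le_max_right _ _
  obtain ⟨K', -, hK'⟩ := key n le_rfl
  exact ⟨K', hK'⟩

theorem WeightBound.add (hf : WeightBound n ω K f x)
    (hg : WeightBound n ω K' g x) (hfc : ContDiff ℝ n f) (hgc : ContDiff ℝ n g) :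
    WeightBound n ω (K + K') (fun x => f x + g x) x := fun j hj => by
  have hjn : ((j : ℕ) : WithTop ℕ∞) ≤ n := by exact_mod_cast hj
  rw [iteratedDeriv_fun_add (hfc.of_le hjn).contDiffAt (hgc.of_le hjn).contDiffAt, add_mul]
  exact (abs_add_le _ _).trans (add_le_add (hf j hj) (hg j hj))

theorem WeightBound.const_mul (c : ℝ) (hf : WeightBound n ω K f x) :
    WeightBound n ω (|c| * K) (fun x => c * f x) x := fun j hj => by
  rw [iteratedDeriv_const_mul_field, _root_.abs_mul, mul_assoc]
  exact mul_le_mul_of_nonneg_left (hf j hj) (abs_nonneg c)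

end Weights

/-- The weights `1, …, 1, 1 + s, 1 + s + t` used for a function with five bounded derivatives. -/
def topWeight (s t : ℝ) (j : ℕ) : ℝ := if j ≤ 5 then 1 else if j = 6 then 1 + |s| else 1 + |s| + |t|

theorem isWeight_topWeight (s t : ℝ) : IsWeight 7 (topWeight s t) where
  one_le j := by
    unfold topWeight
    have := abs_nonneg s; have := abs_nonneg t
    split_ifs <;> linarith
  mul_le i j hij := by
    unfold topWeight
    have := abs_nonneg s; have := abs_nonneg t
    split_ifs <;> first | omega | nlinarith

/-- The diffusion coefficient `3p + 1/p`. -/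
def diffCoeff (p : ℝ → ℝ) (x : ℝ) : ℝ := 3 * p x + 1 / p x

theorem diffCoeff_le {p : ℝ → ℝ} {x : ℝ} (hp : p x < 0) : diffCoeff p x ≤ -3 := by
  rw [diffCoeff, ← sub_nonneg]
  have : -3 - (3 * p x + 1 / p x) = (3 * p x ^ 2 + 3 * p x + 1) / (-p x) := by
    have := hp.ne
    field_simp; ring
  rw [this]
  exact div_nonneg (by nlinarith [sq_nonneg (2 * p x + 1)]) (by linarith)

theorem contDiff_diffCoeff {p : ℝ → ℝ} {n : WithTop ℕ∞} (hp : ContDiff ℝ n p) (h0 : ∀ x, p x ≠ 0) :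
    ContDiff ℝ n (diffCoeff p) :=
  (contDiff_const.mul hp).add (contDiff_const.div hp h0)

theorem weightBound_of_CB {B : ℝ} {p : ℝ → ℝ} (hp : CB 5 B p) (x : ℝ) :
    WeightBound 7 (topWeight (iteratedDeriv 6 p x) (iteratedDeriv 7 p x)) (B + 1) p x := by
  intro j hj
  have hB := hp.nonneg
  have h6 := abs_nonneg (iteratedDeriv 6 p x)
  have h7 := abs_nonneg (iteratedDeriv 7 p x)
  unfold topWeight
  split_ifs with h1 h2
  · have := hp.iteratedDeriv_bound h1 x; linarith
  · rw [h2]; nlinarith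
  · rw [show j = 7 by omega]; nlinarith

theorem exists_weightBound_diffCoeff (b B : ℝ) (hb : b < 0) : ∃ K, ∀ (p : ℝ → ℝ) (x : ℝ), CB 5 B p →
    ContDiff ℝ 7 p → (∀ y, p y ≤ b) →
    WeightBound 7 (topWeight (iteratedDeriv 6 p x) (iteratedDeriv 7 p x)) K (diffCoeff p) x := by
  obtain ⟨K', hK'⟩ := exists_weightBound_inv 7 (B + 1) (-b) (by linarith)
  refine ⟨|3| * (B + 1) + K', fun p x hp hc hpb => ?_⟩
  have h1 := weightBound_of_CB hp x
  have h0 : ∀ y, p y ≠ 0 := fun y => ((hpb y).trans_lt hb).ne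
  have h2 := hK' _ p x (isWeight_topWeight _ _) hc (fun y => by
    have := hpb y; rw [abs_of_neg (by linarith)]; linarith) h1
  exact (h1.const_mul 3).add h2 (contDiff_const.mul hc) (contDiff_const.div hc h0)

/-- The remainder in the seventh derivative of `∫ (3p + 1/p) dp`. -/
def leibnizTail (p : ℝ → ℝ) (x : ℝ) : ℝ :=
  ∑ i ∈ Finset.range 6, ((6 : ℕ).choose (i + 1) : ℝ) *
    (iteratedDeriv (i + 1) (diffCoeff p) x * iteratedDeriv (6 - i) p x)

/-- The derivative of `leibnizTail`. -/
def leibnizTail' (p : ℝ → ℝ) (x : ℝ) : ℝ :=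
  ∑ i ∈ Finset.range 6, ((6 : ℕ).choose (i + 1) : ℝ) *
    (iteratedDeriv (i + 2) (diffCoeff p) x * iteratedDeriv (6 - i) p x +
      iteratedDeriv (i + 1) (diffCoeff p) x * iteratedDeriv (7 - i) p x)

theorem hasDerivAt_iteratedDeriv {f : ℝ → ℝ} {n : ℕ} (hf : ContDiff ℝ n f) {j : ℕ} (hj : j < n) (x : ℝ) :
    HasDerivAt (iteratedDeriv j f) (iteratedDeriv (j + 1) f x) x := by
  rw [iteratedDeriv_succ]
  exact ((hf.differentiable_iteratedDeriv j (by exact_mod_cast hj)) x).hasDerivAt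

theorem hasDerivAt_leibnizTail {p : ℝ → ℝ} (hp : ContDiff ℝ 7 p) (h0 : ∀ x, p x ≠ 0) (x : ℝ) :
    HasDerivAt (leibnizTail p) (leibnizTail' p x) x := by
  have hW : ContDiff ℝ (7 : ℕ) (diffCoeff p) := contDiff_diffCoeff hp h0
  refine HasDerivAt.fun_sum fun i hi => ?_
  have hi' := Finset.mem_range.1 hi
  refine HasDerivAt.const_mul _ ?_
  have h1 := hasDerivAt_iteratedDeriv hW (j := i + 1) (by omega) x
  have h2 := hasDerivAt_iteratedDeriv (n := 7) hp (j := 6 - i) (by omega) x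
  rw [show 6 - i + 1 = 7 - i by omega] at h2
  exact h1.mul h2

theorem continuous_leibnizTail' {p : ℝ → ℝ} (hp : ContDiff ℝ 7 p) (h0 : ∀ x, p x ≠ 0) :
    Continuous (leibnizTail' p) := by
  have hW : ContDiff ℝ (7 : ℕ) (diffCoeff p) := contDiff_diffCoeff hp h0
  have h1 : ∀ j ≤ 7, Continuous (iteratedDeriv j (diffCoeff p)) := fun j hj =>
    hW.continuous_iteratedDeriv j (by exact_mod_cast hj)
  have h2 : ∀ j ≤ 7, Continuous (iteratedDeriv j p) := fun j hj =>
    hp.continuous_iteratedDeriv j (by exact_mod_cast hj)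
  refine continuous_finsetSum _ fun i hi => ?_
  have hi' := Finset.mem_range.1 hi
  exact continuous_const.mul (((h1 _ (by omega)).mul (h2 _ (by omega))).add
    ((h1 _ (by omega)).mul (h2 _ (by omega))))

theorem iteratedDeriv_diffCoeff_mul {p : ℝ → ℝ} (hp : ContDiff ℝ 7 p) (h0 : ∀ x, p x ≠ 0) (x : ℝ) :
    iteratedDeriv 6 (fun x => diffCoeff p x * deriv p x) x
      = diffCoeff p x * iteratedDeriv 7 p x + leibnizTail p x := by
  have hW : ContDiff ℝ (7 : ℕ) (diffCoeff p) := contDiff_diffCoeff hp h0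
  have hp' : ContDiff ℝ (6 : ℕ) (deriv p) := by
    have : ContDiff ℝ ((6 : WithTop ℕ∞) + 1) p := by norm_num; exact hp
    exact (contDiff_succ_iff_deriv.1 this).2.2
  rw [iteratedDeriv_fun_mul (n := 6) (hW.of_le (by norm_num)).contDiffAt hp'.contDiffAt,
    Finset.sum_range_succ', leibnizTail]
  simp only [← iteratedDeriv_succ']
  rw [add_comm]
  congr 1
  · simp
  · refine Finset.sum_congr rfl fun i hi => ?_
    have hi' := Finset.mem_range.1 hi
    rw [show 6 - (i + 1) + 1 = 6 - i by omega, mul_assoc]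

/-- The lower order part of the eighth derivative of `∫ (3p + 1/p) dp`. -/
def lowerOrder (p : ℝ → ℝ) (x : ℝ) : ℝ :=
  deriv (diffCoeff p) x * iteratedDeriv 7 p x + leibnizTail' p x

theorem exists_lowerOrder_bound (b B : ℝ) (hb : b < 0) : ∃ K, 0 ≤ K ∧ ∀ (p : ℝ → ℝ) (x : ℝ), CB 5 B p →
    ContDiff ℝ 7 p → (∀ y, p y ≤ b) → |diffCoeff p x| ≤ K ∧
    lowerOrder p x ^ 2 ≤ K * (1 + iteratedDeriv 6 p x ^ 2 + iteratedDeriv 7 p x ^ 2) := by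
  obtain ⟨K, hK⟩ := exists_weightBound_diffCoeff b B hb
  set K1 := |K| * (|B| + 1) with hK1
  refine ⟨|K| + 3 * (K1 + ∑ i ∈ Finset.range 6, ((6 : ℕ).choose (i + 1) : ℝ) * (K1 + K1)) ^ 2, by positivity,
    fun p x hp hc hpb => ?_⟩
  have hW := hK p x hp hc hpb
  have h1 := weightBound_of_CB hp x
  have hω := isWeight_topWeight (iteratedDeriv 6 p x) (iteratedDeriv 7 p x)
  set s := iteratedDeriv 6 p x
  set t := iteratedDeriv 7 p x with ht
  have hK0 : 0 ≤ K := hW.const_nonneg hω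
  have hB0 := hp.nonneg
  have hm : ∀ i j m, i + j = m → m ≤ 8 → 1 ≤ i → 1 ≤ j →
      |iteratedDeriv i (diffCoeff p) x * iteratedDeriv j p x| ≤ K1 * (1 + |s| + |t|) := by
    intro i j m hij hm hi hj
    have hi' := hW i (by omega)
    have hj' := h1 j (by omega)
    have hprod : topWeight s t i * topWeight s t j ≤ 1 + |s| + |t| := by
      unfold topWeight
      have := abs_nonneg s; have := abs_nonneg t
      split_ifs <;> first | omega | nlinarith
    rw [_root_.abs_mul, hK1, abs_of_nonneg hK0, abs_of_nonneg hB0]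
    calc _ ≤ (K * topWeight s t i) * ((B + 1) * topWeight s t j) :=
          mul_le_mul hi' hj' (abs_nonneg _) (mul_nonneg hK0 (hω.nonneg i))
      _ = K * (B + 1) * (topWeight s t i * topWeight s t j) := by ring
      _ ≤ _ := mul_le_mul_of_nonneg_left hprod (mul_nonneg hK0 (by linarith))
  refine ⟨?_, ?_⟩
  · have := hW 0 (by norm_num)
    simp only [iteratedDeriv_zero, topWeight, Nat.zero_le, if_true, mul_one] at this
    have h2 := le_abs_self K
    nlinarith [sq_nonneg (K1 + ∑ i ∈ Finset.range 6, ((6 : ℕ).choose (i + 1) : ℝ) * (K1 + K1))]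
  · set Z := K1 + ∑ i ∈ Finset.range 6, ((6 : ℕ).choose (i + 1) : ℝ) * (K1 + K1) with hZ
    have hb : |lowerOrder p x| ≤ Z * (1 + |s| + |t|) := by
      rw [lowerOrder, hZ, add_mul, Finset.sum_mul]
      refine (abs_add_le _ _).trans (add_le_add ?_ ((Finset.abs_sum_le_sum_abs _ _).trans
        (Finset.sum_le_sum fun i hi => ?_)))
      · have := hm 1 7 8 rfl le_rfl le_rfl (by norm_num)
        rwa [iteratedDeriv_one] at this
      · have hi' := Finset.mem_range.1 hi
        rw [_root_.abs_mul, Nat.abs_cast, mul_assoc]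
        refine mul_le_mul_of_nonneg_left ?_ (Nat.cast_nonneg _)
        rw [add_mul]
        exact (abs_add_le _ _).trans (add_le_add
          (hm _ _ 8 (by omega) le_rfl (by omega) (by omega))
          (hm _ _ 8 (by omega) le_rfl (by omega) (by omega)))
    have h2 : lowerOrder p x ^ 2 ≤ (Z * (1 + |s| + |t|)) ^ 2 := by
      rw [← sq_abs]; gcongr
    have h3 : (1 + |s| + |t|) ^ 2 ≤ 3 * (1 + s ^ 2 + t ^ 2) := by
      rw [← sq_abs s, ← sq_abs t]
      nlinarith [sq_nonneg (1 - |s|), sq_nonneg (1 - |t|), sq_nonneg (|s| - |t|)]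
    calc _ ≤ Z ^ 2 * (1 + |s| + |t|) ^ 2 := by rw [← mul_pow]; exact h2
      _ ≤ Z ^ 2 * (3 * (1 + s ^ 2 + t ^ 2)) := by gcongr
      _ = (3 * Z ^ 2) * (1 + s ^ 2 + t ^ 2) := by ring
      _ ≤ _ := by gcongr; linarith [abs_nonneg K]

/-! ### Energy production -/

/-- The periodic part of a height profile. -/
def perPart (L : ℝ) (u : ℝ → ℝ) (x : ℝ) : ℝ := u x + x / L

/-- The Fourier coefficients of the right-hand side of the evolution equation, multiplied by
those of the height profile: the rate of change of the energy carried by a frequency. -/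
def energyRate (L : ℝ) (u : ℝ → ℝ) (k : ℤ) : ℝ :=
  freq L k ^ 14 * (2 * (fc L (iteratedDeriv 2 (chemPotential L u)) k *
    (starRingEnd ℂ) (fc L (perPart L u) k)).re)

variable {L b B : ℝ} {u : ℝ → ℝ}

theorem iteratedDeriv_periodic {f : ℝ → ℝ} (hper : ∀ x, f (x + L) = f x) (n : ℕ) (x : ℝ) :
    iteratedDeriv n f (x + L) = iteratedDeriv n f x := by
  induction n generalizing x with
  | zero => simpa using hper x
  | succ n ih => rw [iteratedDeriv_succ]; exact deriv_periodic ih x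

theorem fc_iteratedDeriv (hL : 0 < L) {f : ℝ → ℝ} (hper : ∀ x, f (x + L) = f x) {n : ℕ}
    (hf : ContDiff ℝ n f) (k : ℤ) : fc L (iteratedDeriv n f) k
      = ((freq L k : ℂ) * Complex.I) ^ n * fc L f k := by
  induction n with
  | zero => simp
  | succ n ih =>
    have h1 : IsPrimitive (iteratedDeriv n f) (iteratedDeriv (n + 1) f) :=
      IsPrimitive.of_hasDerivAt (fun x => hasDerivAt_iteratedDeriv hf (Nat.lt_succ_self n) x)
        (hf.continuous_iteratedDeriv' (n + 1))
    have h2 := iteratedDeriv_periodic hper n 0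
    rw [zero_add] at h2
    rw [h1.fc_eq hL h2, ih (hf.of_le (by exact_mod_cast Nat.le_succ n))]
    ring

theorem perPart_periodic (hL : 0 < L) (hper : ∀ x, u (x + L) = u x - 1) (x : ℝ) :
    perPart L u (x + L) = perPart L u x := by
  rw [perPart, perPart, hper]; field_simp; ring

theorem hasDerivAt_perPart {x u' : ℝ} (hu : HasDerivAt u u' x) :
    HasDerivAt (perPart L u) (u' + 1 / L) x := hu.add ((hasDerivAt_id x).div_const L)

theorem deriv_perPart (hu : Differentiable ℝ u) : deriv (perPart L u) = fun x => deriv u x + 1 / L :=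
  funext fun x => (hasDerivAt_perPart (hu x).hasDerivAt).deriv

theorem contDiff_perPart {n : WithTop ℕ∞} (hu : ContDiff ℝ n u) : ContDiff ℝ n (perPart L u) :=
  hu.add (contDiff_id.div_const L)

theorem iteratedDeriv_perPart (hu : Differentiable ℝ u) (n : ℕ) :
    iteratedDeriv (n + 2) (perPart L u) = iteratedDeriv (n + 1) (deriv u) := by
  rw [iteratedDeriv_succ', deriv_perPart hu, iteratedDeriv_succ', iteratedDeriv_succ']
  congr 1
  funext x
  rw [deriv_add_const]

/-- The local part of the chemical potential is the derivative of this function of the slope. -/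
def slopePrimitive (p : ℝ → ℝ) (x : ℝ) : ℝ := 3 / 2 * p x ^ 2 + Real.log (p x)

theorem hasDerivAt_slopePrimitive {p : ℝ → ℝ} (hp : Differentiable ℝ p) (h0 : ∀ x, p x ≠ 0) (x : ℝ) :
    HasDerivAt (slopePrimitive p) (diffCoeff p x * deriv p x) x := by
  have h1 := (((hp x).hasDerivAt.pow 2).const_mul (3 / 2)).add ((hp x).hasDerivAt.log (h0 x))
  refine h1.congr_deriv ?_
  rw [diffCoeff]
  have := h0 x
  field_simp
  ring

/-- The density of the seventh derivative of the local part of the chemical potential. -/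
def localDensity (u g : ℝ → ℝ) (x : ℝ) : ℝ := diffCoeff (deriv u) x * g x + lowerOrder (deriv u) x

theorem isPrimitive_localDensity (hu : ContDiff ℝ 8 u) (h0 : ∀ x, deriv u x ≠ 0) {g : ℝ → ℝ}
    (hg : IsPrimitive (iteratedDeriv 8 u) g) :
    IsPrimitive (iteratedDeriv 7 (slopePrimitive (deriv u))) (localDensity u g) := by
  have hp : ContDiff ℝ 7 (deriv u) := by
    have : ContDiff ℝ ((7 : WithTop ℕ∞) + 1) u := by norm_num; exact hu
    exact (contDiff_succ_iff_deriv.1 this).2.2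
  have hW := contDiff_diffCoeff hp h0
  have h1 : iteratedDeriv 7 (slopePrimitive (deriv u)) = fun x =>
      diffCoeff (deriv u) x * iteratedDeriv 8 u x + leibnizTail (deriv u) x := by
    rw [iteratedDeriv_succ', show deriv (slopePrimitive (deriv u)) = _ from
      funext fun x => (hasDerivAt_slopePrimitive (hp.differentiable (by norm_num)) h0 x).deriv]
    funext x
    rw [iteratedDeriv_diffCoeff_mul hp h0, iteratedDeriv_succ' (n := 7)]
  have h2 := (hg.mul_contDiff (hW.of_le (by norm_num))).add (IsPrimitive.of_hasDerivAt
    (hasDerivAt_leibnizTail hp h0) (continuous_leibnizTail' hp h0))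
  rw [h1]
  have h3 : (localDensity u g) = fun x => diffCoeff (deriv u) x * g x
      + deriv (diffCoeff (deriv u)) x * iteratedDeriv 8 u x + leibnizTail' (deriv u) x := by
    funext x
    rw [localDensity, lowerOrder, iteratedDeriv_succ' (n := 7)]; ring
  rw [h3]
  exact h2

theorem fc_chemPotential (hL : 0 < L) (hb : b < 0) (hu : Admissible L b B u) (hu8 : ContDiff ℝ 8 u)
    (k : ℤ) : fc L (iteratedDeriv 2 (chemPotential L u)) k = -(freq L k : ℂ) ^ 2 *
      (-((2 * Real.pi / L : ℝ) : ℂ) * (hilbMult L k * fc L (deriv u) k) +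
        (freq L k : ℂ) * Complex.I * fc L (slopePrimitive (deriv u)) k) := by
  have h0 : ∀ x, deriv u x ≠ 0 := fun x => ((hu.slope x).trans_lt hb).ne
  have hp : ContDiff ℝ 7 (deriv u) := by
    have : ContDiff ℝ ((7 : WithTop ℕ∞) + 1) u := by norm_num; exact hu8
    exact (contDiff_succ_iff_deriv.1 this).2.2
  have hH : CB 4 (B * (L / Real.pi)) (hilb L (deriv u)) := CB.hilb hL hu.cb hu.deriv_per
  have hGd := hasDerivAt_slopePrimitive (hp.differentiable (by norm_num)) h0
  have hGc : Continuous fun x => diffCoeff (deriv u) x * deriv (deriv u) x :=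
    (contDiff_diffCoeff hp h0).continuous.mul (hp.continuous_deriv (by norm_num))
  have e1 : chemPotential L u = fun x => -(2 * Real.pi / L) * hilb L (deriv u) x
      + diffCoeff (deriv u) x * deriv (deriv u) x := funext fun x => hu.chemPotential_eq hL x
  have hcd : ContDiff ℝ 2 (chemPotential L u) := by
    rw [e1]
    refine (contDiff_const.mul (hH.contDiff.of_le (by norm_num))).add
      (((contDiff_diffCoeff hp h0).of_le (by norm_num)).mul ?_)
    have : ContDiff ℝ ((6 : WithTop ℕ∞) + 1) (deriv u) := by norm_num; exact hp
    exact ((contDiff_succ_iff_deriv.1 this).2.2).of_le (by norm_num)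
  have hHper : ∀ x, hilb L (deriv u) (x + L) = hilb L (deriv u) x := fun x => by
    simp only [hilb, show ∀ y, x + L - y = (x - y) + L from fun y => by ring, hu.deriv_per]
  have hdper := deriv_periodic hu.deriv_per
  have hper : ∀ x, chemPotential L u (x + L) = chemPotential L u x := fun x => by
    rw [e1]
    simp only [hHper, diffCoeff, hu.deriv_per, hdper]
  have i1 : IntervalIntegrable (fun x => -(2 * Real.pi / L) * hilb L (deriv u) x) volume 0 L :=
    (continuous_const.mul hH.continuous).intervalIntegrable _ _
  rw [fc_iteratedDeriv hL hper (n := 2) hcd, mul_pow, Complex.I_sq, e1,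
    fc_add i1 (hGc.intervalIntegrable _ _),
    fc_const_mul, fc_hilb hL (hu.cb.of_le (by norm_num)) hu.deriv_per,
    (IsPrimitive.of_hasDerivAt hGd hGc).fc_eq hL (by
      have := hu.deriv_per 0
      rw [zero_add] at this
      rw [slopePrimitive, slopePrimitive, this])]
  push_cast
  ring

theorem freq_mul_fc_deriv (hL : 0 < L) (hu : Admissible L b B u) (k : ℤ) :
    (freq L k : ℂ) * fc L (deriv u) k = (freq L k : ℂ) * ((freq L k : ℂ) * Complex.I * fc L (perPart L u) k) := by
  by_cases hk : k = 0
  · simp [hk, freq_zero]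
  have hc := hu.cb.continuous
  have hpp : IsPrimitive (perPart L u) (fun x => deriv u x + 1 / L) :=
    IsPrimitive.of_hasDerivAt (fun x => hasDerivAt_perPart (hu.diff x).hasDerivAt)
      (hc.add continuous_const)
  have hper := perPart_periodic hL hu.per 0
  rw [zero_add] at hper
  rw [← hpp.fc_eq hL hper, fc_add (hc.intervalIntegrable _ _) (continuous_const.intervalIntegrable _ _)]
  have : fc L (fun _ => 1 / L) k = 0 := by
    rw [fc, intervalIntegral.integral_mul_const, integral_expo hL, if_neg (by simpa using hk)]
    simp
  rw [this, add_zero]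

theorem exists_absorb (A A' : ℝ) (hA : 0 ≤ A) (hA' : 0 ≤ A') : ∃ C, 0 ≤ C ∧ ∀ y : ℝ, 0 ≤ y →
    A * y ^ 16 + A' * y ^ 17 ≤ 4 * y ^ 18 + C * y ^ 14 := by
  set R := A + A' + 1 with hR
  refine ⟨A * R ^ 2 + A' * R ^ 3, by positivity, fun y hy => ?_⟩
  rcases le_total y R with h | h
  · have h1 : y ^ 16 ≤ R ^ 2 * y ^ 14 := by
      calc y ^ 16 = y ^ 2 * y ^ 14 := by ring
        _ ≤ _ := by gcongr
    have h2 : y ^ 17 ≤ R ^ 3 * y ^ 14 := by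
      calc y ^ 17 = y ^ 3 * y ^ 14 := by ring
        _ ≤ _ := by gcongr
    have h3 : 0 ≤ y ^ 18 := by positivity
    nlinarith [mul_le_mul_of_nonneg_left h1 hA, mul_le_mul_of_nonneg_left h2 hA']
  · have h1 : 1 ≤ y := by linarith
    have h2 : y ^ 16 ≤ y ^ 17 := pow_le_pow_right₀ h1 (by norm_num)
    have h3 : (A + A') * y ^ 17 ≤ y ^ 18 := by
      calc (A + A') * y ^ 17 ≤ y * y ^ 17 := by gcongr; linarith
        _ = y ^ 18 := by ring
    have h4 : 0 ≤ y ^ 18 := by positivity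
    have h5 : 0 ≤ (A * R ^ 2 + A' * R ^ 3) * y ^ 14 := by positivity
    nlinarith [mul_le_mul_of_nonneg_left h2 hA]

theorem memLp_of_continuous {f : ℝ → ℝ} (hf : Continuous f) :
    MemLp f 2 (volume.restrict (Ioc 0 L)) := by
  obtain ⟨C, hC⟩ := (isCompact_Icc (a := (0 : ℝ)) (b := L)).exists_bound_of_continuousOn hf.continuousOn
  exact MemLp.of_bound hf.aestronglyMeasurable C ((ae_restrict_iff' measurableSet_Ioc).2
    (Eventually.of_forall fun x hx => hC x (Ioc_subset_Icc_self hx)))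

theorem energyRate_eq (hL : 0 < L) (hb : b < 0) (hu : Admissible L b B u) (hu8 : ContDiff ℝ 8 u)
    {g : ℝ → ℝ} (hg : IsPrimitive (iteratedDeriv 8 u) g) (k : ℤ) :
    energyRate L u k = 2 * (fc L (localDensity u g) k * (starRingEnd ℂ) (fc L g k)).re +
      4 * Real.pi / L * freq L k ^ 17 * (Complex.I * hilbMult L k).re * ‖fc L (perPart L u) k‖ ^ 2 := by
  have h0 : ∀ x, deriv u x ≠ 0 := fun x => ((hu.slope x).trans_lt hb).ne
  have hp : ContDiff ℝ 7 (deriv u) := by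
    have : ContDiff ℝ ((7 : WithTop ℕ∞) + 1) u := by norm_num; exact hu8
    exact (contDiff_succ_iff_deriv.1 this).2.2
  have hGc : ContDiff ℝ (7 : ℕ) (slopePrimitive (deriv u)) :=
    (contDiff_const.mul (hp.pow 2)).add (hp.log h0)
  have hGper : ∀ x, slopePrimitive (deriv u) (x + L) = slopePrimitive (deriv u) x := fun x => by
    rw [slopePrimitive, slopePrimitive, hu.deriv_per]
  have hvper := perPart_periodic hL hu.per
  have hI2 := Complex.I_sq
  have eD : fc L (localDensity u g) k = (freq L k : ℂ) ^ 8 * fc L (slopePrimitive (deriv u)) k := by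
    have h7 := iteratedDeriv_periodic hGper 7 0
    rw [zero_add] at h7
    rw [(isPrimitive_localDensity hu8 h0 hg).fc_eq hL h7, fc_iteratedDeriv hL hGper hGc]
    have : ((freq L k : ℂ) * Complex.I) * ((freq L k : ℂ) * Complex.I) ^ 7
        = (freq L k : ℂ) ^ 8 * (Complex.I ^ 2) ^ 4 := by ring
    rw [← mul_assoc, this, hI2]; ring
  have e8 : iteratedDeriv 8 (perPart L u) = iteratedDeriv 8 u := by
    rw [iteratedDeriv_perPart hu.diff 6, ← iteratedDeriv_succ']
  have eg : fc L g k = (freq L k : ℂ) ^ 9 * (Complex.I * fc L (perPart L u) k) := by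
    have h8 := iteratedDeriv_periodic hvper 8 0
    rw [zero_add, e8] at h8
    rw [hg.fc_eq hL h8, ← e8, fc_iteratedDeriv hL hvper (n := 8) (contDiff_perPart hu8)]
    have : ((freq L k : ℂ) * Complex.I) * ((freq L k : ℂ) * Complex.I) ^ 8
        = (freq L k : ℂ) ^ 9 * (Complex.I * (Complex.I ^ 2) ^ 4) := by ring
    rw [← mul_assoc, this, hI2]; ring
  have hkey : (freq L k : ℂ) ^ 14 * (fc L (iteratedDeriv 2 (chemPotential L u)) k *
      (starRingEnd ℂ) (fc L (perPart L u) k)) =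
      fc L (localDensity u g) k * (starRingEnd ℂ) (fc L g k) +
      ((2 * Real.pi / L : ℝ) : ℂ) * (freq L k : ℂ) ^ 17 * (Complex.I * hilbMult L k) *
        (fc L (perPart L u) k * (starRingEnd ℂ) (fc L (perPart L u) k)) := by
    rw [eD, eg, fc_chemPotential hL hb hu hu8]
    simp only [map_mul, map_pow, Complex.conj_ofReal, Complex.conj_I]
    linear_combination ((freq L k : ℂ) ^ 15 * ((2 * Real.pi / L : ℝ) : ℂ) * hilbMult L k *
      (starRingEnd ℂ) (fc L (perPart L u) k)) * freq_mul_fc_deriv hL hu k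
  have hre := congrArg Complex.re hkey
  rw [Complex.mul_conj, Complex.normSq_eq_norm_sq, ← Complex.ofReal_pow, ← Complex.ofReal_pow,
    Complex.re_ofReal_mul, Complex.add_re, Complex.re_mul_ofReal, ← Complex.ofReal_mul,
    Complex.re_ofReal_mul] at hre
  rw [energyRate]
  simp only [mul_assoc] at hre ⊢
  linear_combination 2 * hre

theorem hasSum_energy (hL : 0 < L) (hu : Differentiable ℝ u) (hper : ∀ x, u (x + L) = u x - 1) {n : ℕ}
    (hu' : ContDiff ℝ (n + 1 : ℕ) u) {g : ℝ → ℝ} (hg : IsPrimitive (iteratedDeriv (n + 1) u) g)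
    (hn : 1 ≤ n) (hg2 : MemLp g 2 (volume.restrict (Ioc 0 L))) :
    HasSum (fun k => freq L k ^ (2 * (n + 2)) * ‖fc L (perPart L u) k‖ ^ 2)
      (1 / L * ∫ x in (0 : ℝ)..L, g x ^ 2) := by
  obtain ⟨m, rfl⟩ : ∃ m, n = m + 1 := ⟨n - 1, by omega⟩
  have e : iteratedDeriv (m + 1 + 1) (perPart L u) = iteratedDeriv (m + 1 + 1) u := by
    rw [iteratedDeriv_perPart hu m, ← iteratedDeriv_succ']
  have hvper := perPart_periodic hL hper
  have h8 := iteratedDeriv_periodic hvper (m + 1 + 1) 0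
  rw [zero_add, e] at h8
  have key : ∀ k, freq L k ^ (2 * (m + 1 + 2)) * ‖fc L (perPart L u) k‖ ^ 2 = ‖fc L g k‖ ^ 2 := by
    intro k
    rw [hg.fc_eq hL h8, ← e, fc_iteratedDeriv hL hvper (contDiff_perPart hu'), norm_mul, norm_mul, norm_mul, norm_pow,
      norm_mul, Complex.norm_I, Complex.norm_real, Real.norm_eq_abs, mul_one, pow_mul, ← sq_abs (freq L k)]
    ring
  simp only [key]
  exact hasSum_sq_fc hL hg2

theorem exists_energyRate_bound (hL : 0 < L) (hb : b < 0) (B E : ℝ) : ∃ C, 0 ≤ C ∧ ∀ u g : ℝ → ℝ,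
    Admissible L b B u → ContDiff ℝ 8 u → IsPrimitive (iteratedDeriv 8 u) g →
    MemLp g 2 (volume.restrict (Ioc 0 L)) →
    ∑' k, freq L k ^ 14 * ‖fc L (perPart L u) k‖ ^ 2 ≤ E →
    (∀ S : Finset ℤ, |∑ k ∈ S, energyRate L u k|
      ≤ C * (1 + ∑' k, freq L k ^ 18 * ‖fc L (perPart L u) k‖ ^ 2)) ∧
    Summable (energyRate L u) ∧ ∑' k, energyRate L u k ≤ C := by
  obtain ⟨K, hK0, hK⟩ := exists_lowerOrder_bound b B hb
  have hpi := Real.pi_pos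
  obtain ⟨C0, hC0, hC⟩ := exists_absorb (K / 2) (4 * Real.pi / L) (by positivity) (by positivity)
  refine ⟨2 * K ^ 2 + 21 + (2 * K * (1 + |E|) + 5 * C0 * |E|), by positivity,
    fun u g hu hu8 hg hg2 hE => ?_⟩
  have hp : ContDiff ℝ 7 (deriv u) := by
    have : ContDiff ℝ ((7 : WithTop ℕ∞) + 1) u := by norm_num; exact hu8
    exact (contDiff_succ_iff_deriv.1 this).2.2
  have h0 : ∀ x, deriv u x ≠ 0 := fun x => ((hu.slope x).trans_lt hb).ne
  set c := fc L (perPart L u) with hcdef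
  set W := diffCoeff (deriv u) with hW
  set p6 := iteratedDeriv 6 (deriv u) with hp6
  set p7 := iteratedDeriv 7 (deriv u) with hp7
  have hWc : Continuous W := (contDiff_diffCoeff hp h0).continuous
  have hp6c : Continuous p6 := hp.continuous_iteratedDeriv 6 (by norm_num)
  have hp7c : Continuous p7 := hp.continuous_iteratedDeriv 7 le_rfl
  have hr : Continuous (lowerOrder (deriv u)) :=
    (((contDiff_diffCoeff hp h0).continuous_deriv (by norm_num)).mul hp7c).add
      (continuous_leibnizTail' hp h0)
  have hKx := fun x => hK (deriv u) x hu.cb hp hu.slope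
  -- Parseval sums
  have hX14 : HasSum (fun k => freq L k ^ 14 * ‖c k‖ ^ 2) (1 / L * ∫ x in (0 : ℝ)..L, p6 x ^ 2) := by
    have h1 : p6 = iteratedDeriv 7 u := by rw [hp6, ← iteratedDeriv_succ']
    rw [h1]
    exact hasSum_energy hL hu.diff hu.per (n := 5) (hu8.of_le (by norm_num))
      (IsPrimitive.of_hasDerivAt (fun x => hasDerivAt_iteratedDeriv (n := 8) hu8 (by norm_num) x)
        (h1 ▸ hp6c)) (by norm_num) (memLp_of_continuous (h1 ▸ hp6c))
  have hX16 : HasSum (fun k => freq L k ^ 16 * ‖c k‖ ^ 2) (1 / L * ∫ x in (0 : ℝ)..L, p7 x ^ 2) := by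
    have h1 : p7 = iteratedDeriv 8 u := by rw [hp7, ← iteratedDeriv_succ']
    rw [h1]
    exact hasSum_energy hL hu.diff hu.per (n := 6) (hu8.of_le (by norm_num))
      (IsPrimitive.of_hasDerivAt (fun x => hasDerivAt_iteratedDeriv (n := 8) hu8 (by norm_num) x)
        (h1 ▸ hp7c)) (by norm_num) (memLp_of_continuous (h1 ▸ hp7c))
  have hY : HasSum (fun k => freq L k ^ 18 * ‖c k‖ ^ 2) (1 / L * ∫ x in (0 : ℝ)..L, g x ^ 2) :=
    hasSum_energy hL hu.diff hu.per (n := 7) hu8 hg (by norm_num) hg2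
  have hD2 : MemLp (localDensity u g) 2 (volume.restrict (Ioc 0 L)) := by
    refine MemLp.add (hg2.of_le_mul (c := K)
      (hWc.aestronglyMeasurable.mul hg2.aestronglyMeasurable) (Eventually.of_forall fun x => ?_))
      (memLp_of_continuous hr)
    rw [norm_mul]
    exact mul_le_mul_of_nonneg_right (hKx x).1 (norm_nonneg _)
  have hDsum := hasSum_sq_fc hL hD2
  have hDg := hasSum_re_fc_mul hL hD2 hg2
  have ig : IntervalIntegrable (fun x => g x ^ 2) volume 0 L := by
    rw [intervalIntegrable_iff_integrableOn_Ioc_of_le hL.le]; exact hg2.integrable_sq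
  have iD : IntervalIntegrable (fun x => localDensity u g x ^ 2) volume 0 L := by
    rw [intervalIntegrable_iff_integrableOn_Ioc_of_le hL.le]; exact hD2.integrable_sq
  have iDg : IntervalIntegrable (fun x => localDensity u g x * g x) volume 0 L := by
    rw [intervalIntegrable_iff_integrableOn_Ioc_of_le hL.le]; exact hD2.integrable_mul hg2
  have i6 : IntervalIntegrable (fun x => p6 x ^ 2) volume 0 L := (hp6c.pow 2).intervalIntegrable _ _
  have i7 : IntervalIntegrable (fun x => p7 x ^ 2) volume 0 L := (hp7c.pow 2).intervalIntegrable _ _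
  set X := 1 / L * ∫ x in (0 : ℝ)..L, p6 x ^ 2 with hX
  set Z := 1 / L * ∫ x in (0 : ℝ)..L, p7 x ^ 2 with hZ
  set Y := 1 / L * ∫ x in (0 : ℝ)..L, g x ^ 2 with hYdef
  have hcomb : ∀ a1 a2 : ℝ, 1 / L * ∫ x in (0 : ℝ)..L, (a1 * g x ^ 2 + a2 * (1 + p6 x ^ 2 + p7 x ^ 2))
      = a1 * Y + a2 * (1 + X + Z) := by
    intro a1 a2
    have i1 : IntervalIntegrable (fun x => 1 + p6 x ^ 2) volume 0 L :=
      (continuous_const.add (hp6c.pow 2)).intervalIntegrable _ _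
    rw [intervalIntegral.integral_add (ig.const_mul a1) ((i1.add i7).const_mul a2),
      intervalIntegral.integral_const_mul, intervalIntegral.integral_const_mul,
      intervalIntegral.integral_add i1 i7,
      intervalIntegral.integral_add (continuous_const.intervalIntegrable _ _) i6]
    simp only [intervalIntegral.integral_const, smul_eq_mul, sub_zero, mul_one]
    rw [hX, hZ, hYdef]
    field_simp
  have icomb : ∀ a1 a2 : ℝ, IntervalIntegrable
      (fun x => a1 * g x ^ 2 + a2 * (1 + p6 x ^ 2 + p7 x ^ 2)) volume 0 L := fun a1 a2 =>
    (ig.const_mul a1).add (((continuous_const.add (hp6c.pow 2)).add (hp7c.pow 2)).intervalIntegrable _ _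
      |>.const_mul a2)
  have hDgle : 1 / L * ∫ x in (0 : ℝ)..L, localDensity u g x * g x ≤ -2 * Y + K / 4 * (1 + X + Z) := by
    rw [← hcomb]
    refine mul_le_mul_of_nonneg_left (intervalIntegral.integral_mono_on hL.le iDg (icomb _ _)
      fun x _ => ?_) (by positivity)
    have h1 := (hKx x).2
    have h2 : W x ≤ -3 := diffCoeff_le ((hu.slope x).trans_lt hb)
    rw [localDensity]
    nlinarith [sq_nonneg (g x - lowerOrder (deriv u) x / 2), mul_nonneg (sub_nonneg.2 h2) (sq_nonneg (g x))]
  have hDDle : 1 / L * ∫ x in (0 : ℝ)..L, localDensity u g x ^ 2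
      ≤ 2 * K ^ 2 * Y + 2 * K * (1 + X + Z) := by
    rw [← hcomb]
    refine mul_le_mul_of_nonneg_left (intervalIntegral.integral_mono_on hL.le iD (icomb _ _)
      fun x _ => ?_) (by positivity)
    have h1 := (hKx x).2
    have h2 : W x ^ 2 ≤ K ^ 2 := sq_le_sq' (abs_le.1 (hKx x).1).1 (abs_le.1 (hKx x).1).2
    rw [localDensity]
    nlinarith [sq_nonneg (W x * g x - lowerOrder (deriv u) x), mul_le_mul_of_nonneg_right h2 (sq_nonneg (g x))]
  -- termwise bounds
  have hy : ∀ (k : ℤ) (n : ℕ), freq L k ^ (2 * n) = |freq L k| ^ (2 * n) := fun k n => by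
    rw [pow_mul, pow_mul, sq_abs]
  have habs : ∀ k, K / 2 * (freq L k ^ 16 * ‖c k‖ ^ 2) + 4 * Real.pi / L * (|freq L k| ^ 17 * ‖c k‖ ^ 2)
      ≤ 4 * (freq L k ^ 18 * ‖c k‖ ^ 2) + C0 * (freq L k ^ 14 * ‖c k‖ ^ 2) := fun k => by
    have h1 := hC |freq L k| (abs_nonneg _)
    rw [← hy k 8, ← hy k 9, ← hy k 7] at h1
    nlinarith [mul_le_mul_of_nonneg_right h1 (sq_nonneg ‖c k‖)]
  have hbd := (hY.mul_left 4).add (hX14.mul_left C0)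
  have hn17 : ∀ k, 0 ≤ |freq L k| ^ 17 * ‖c k‖ ^ 2 := fun k => by positivity
  have hn16 : ∀ k, 0 ≤ freq L k ^ 16 * ‖c k‖ ^ 2 := fun k => by positivity
  have hs17 : Summable (fun k => 4 * Real.pi / L * (|freq L k| ^ 17 * ‖c k‖ ^ 2)) :=
    Summable.of_nonneg_of_le (fun k => mul_nonneg (by positivity) (hn17 k)) (fun k => by
      have := habs k
      have := mul_nonneg (by positivity : 0 ≤ K / 2) (hn16 k)
      linarith) hbd.summable
  have hZ17 : K / 2 * Z + ∑' k, 4 * Real.pi / L * (|freq L k| ^ 17 * ‖c k‖ ^ 2) ≤ 4 * Y + C0 * X :=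
    hasSum_le habs ((hX16.mul_left (K / 2)).add hs17.hasSum) hbd
  have h17nonneg : 0 ≤ ∑' k, 4 * Real.pi / L * (|freq L k| ^ 17 * ‖c k‖ ^ 2) :=
    tsum_nonneg fun k => mul_nonneg (by positivity) (hn17 k)
  set N := ∑' k, 4 * Real.pi / L * (|freq L k| ^ 17 * ‖c k‖ ^ 2) with hN
  have hnl : ∀ k, |4 * Real.pi / L * freq L k ^ 17 * (Complex.I * hilbMult L k).re * ‖c k‖ ^ 2|
      ≤ 4 * Real.pi / L * (|freq L k| ^ 17 * ‖c k‖ ^ 2) := fun k => by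
    have h1 : |(Complex.I * hilbMult L k).re| ≤ 1 := by
      refine (Complex.abs_re_le_norm _).trans ?_
      rw [norm_mul, Complex.norm_I, one_mul]; exact norm_hilbMult_le hL k
    rw [abs_mul, abs_mul, abs_mul, abs_pow, abs_of_nonneg (by positivity : 0 ≤ 4 * Real.pi / L),
      abs_of_nonneg (sq_nonneg ‖c k‖)]
    calc _ ≤ 4 * Real.pi / L * |freq L k| ^ 17 * 1 * ‖c k‖ ^ 2 := by gcongr
      _ = _ := by ring
  have hsnl : Summable (fun k => 4 * Real.pi / L * freq L k ^ 17 * (Complex.I * hilbMult L k).re * ‖c k‖ ^ 2) :=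
    Summable.of_norm_bounded hs17 hnl
  have hER : ∀ k, energyRate L u k = 2 * (fc L (localDensity u g) k * (starRingEnd ℂ) (fc L g k)).re +
      4 * Real.pi / L * freq L k ^ 17 * (Complex.I * hilbMult L k).re * ‖c k‖ ^ 2 := fun k =>
    energyRate_eq hL hb hu hu8 hg k
  have hY0 : 0 ≤ Y := hY.nonneg fun k => by positivity
  have hX0 : 0 ≤ X := hX14.nonneg fun k => by positivity
  have hXE : X ≤ |E| := by rw [hX14.tsum_eq] at hE; exact hE.trans (le_abs_self E)
  have hKX : K * X ≤ K * |E| := by gcongr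
  have hCX : C0 * X ≤ C0 * |E| := by gcongr
  have hCE : 0 ≤ C0 * |E| := by positivity
  have hKE : 0 ≤ K * |E| := by positivity
  rw [hY.tsum_eq]
  have htot := (hDg.mul_left 2).add hsnl.hasSum
  refine ⟨fun S => ?_, ?_, ?_⟩
  · have hterm : ∀ k, |energyRate L u k| ≤ ‖fc L (localDensity u g) k‖ ^ 2 + ‖fc L g k‖ ^ 2
        + 4 * Real.pi / L * (|freq L k| ^ 17 * ‖c k‖ ^ 2) := fun k => by
      rw [hER]
      refine (abs_add_le _ _).trans (add_le_add ?_ (hnl k))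
      have h1 := Complex.abs_re_le_norm (fc L (localDensity u g) k * (starRingEnd ℂ) (fc L g k))
      rw [norm_mul, RCLike.norm_conj] at h1
      rw [abs_mul, abs_two]
      nlinarith [sq_nonneg (‖fc L (localDensity u g) k‖ - ‖fc L g k‖)]
    have hmaj := (hDsum.add (hasSum_sq_fc hL hg2)).add hs17.hasSum
    calc |∑ k ∈ S, energyRate L u k| ≤ ∑ k ∈ S, |energyRate L u k| := Finset.abs_sum_le_sum_abs _ _
      _ ≤ ∑ k ∈ S, (‖fc L (localDensity u g) k‖ ^ 2 + ‖fc L g k‖ ^ 2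
          + 4 * Real.pi / L * (|freq L k| ^ 17 * ‖c k‖ ^ 2)) := Finset.sum_le_sum fun k _ => hterm k
      _ ≤ _ := sum_le_hasSum S (fun k _ => add_nonneg (by positivity)
          (mul_nonneg (by positivity) (hn17 k))) hmaj
      _ ≤ (2 * K ^ 2 * Y + 2 * K * (1 + X + Z)) + Y + N := by gcongr
      _ ≤ _ := by
        have hKZ : K / 2 * Z ≤ 4 * Y + C0 * X := by linarith
        have hNle : N ≤ 4 * Y + C0 * X := by
          have : 0 ≤ K / 2 * Z := mul_nonneg (by positivity) (hX16.nonneg hn16)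
          linarith
        nlinarith [mul_nonneg (sq_nonneg K) hY0, mul_nonneg hKE hY0, mul_nonneg hCE hY0,
          mul_nonneg hK0 hY0, sq_nonneg K]
  · rw [show energyRate L u = _ from funext hER]; exact htot.summable
  · simp only [hER]
    rw [htot.tsum_eq]
    have h1 := (le_abs_self _).trans ((norm_tsum_le_tsum_norm (f := fun k =>
      4 * Real.pi / L * freq L k ^ 17 * (Complex.I * hilbMult L k).re * ‖c k‖ ^ 2) hsnl.norm).trans
      (hsnl.norm.tsum_le_tsum hnl hs17))
    nlinarith [sq_nonneg K]

/-! ### Time-dependent families of profiles -/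

section Families

variable {L b B : ℝ} {F : ℝ → ℝ → ℝ}

theorem abs_slope_sub_deriv_le {f : ℝ → ℝ} (hf : Differentiable ℝ f) (hf' : CB 1 B (deriv f))
    (x : ℝ) {η : ℝ} (hη : 0 < η) : |(f (x + η) - f x) / η - deriv f x| ≤ B * η := by
  obtain ⟨ξ, hξ, hξ'⟩ := exists_deriv_eq_slope f (by linarith : x < x + η)
    hf.continuous.continuousOn hf.differentiableOn
  rw [add_sub_cancel_left] at hξ'
  rw [← hξ']
  refine (abs_sub_le_of_CB hf' ξ x).trans ?_
  refine mul_le_mul_of_nonneg_left ?_ hf'.nonneg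
  rw [abs_of_pos (by linarith [hξ.1])]; linarith [hξ.2]

theorem continuous_deriv_family (hF : ∀ x, Continuous fun s => F s x)
    (hd : ∀ s, Differentiable ℝ (F s)) (hd' : ∀ s, CB 1 B (deriv (F s))) (x : ℝ) :
    Continuous fun s => deriv (F s) x := by
  refine continuous_of_uniform_approx_of_continuous fun U hU => ?_
  obtain ⟨ε, hε, hεU⟩ := Metric.mem_uniformity_dist.1 hU
  have hB : 0 ≤ B := (hd' 0).nonneg
  set η := ε / (2 * (B + 1)) with hη
  have hη0 : 0 < η := by positivity
  refine ⟨fun s => (F s (x + η) - F s x) / η, ((hF _).sub (hF _)).div_const _, fun s => hεU ?_⟩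
  rw [dist_comm, Real.dist_eq]
  refine (abs_slope_sub_deriv_le (hd s) (hd' s) x hη0).trans_lt ?_
  rw [hη, ← mul_div_assoc, div_lt_iff₀ (by positivity)]
  nlinarith

theorem continuous_uncurry_family (hF : ∀ x, Continuous fun s => F s x)
    (hl : ∀ s x y, |F s x - F s y| ≤ B * |x - y|) : Continuous fun z : ℝ × ℝ => F z.1 z.2 := by
  rw [continuous_iff_continuousAt]
  rintro ⟨s, x⟩
  have h1 : Tendsto (fun z : ℝ × ℝ => F z.1 x) (𝓝 (s, x)) (𝓝 (F s x)) :=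
    ((hF x).comp continuous_fst).tendsto (s, x)
  have h2 : Tendsto (fun z : ℝ × ℝ => F z.1 z.2 - F z.1 x) (𝓝 (s, x)) (𝓝 0) := by
    have h3 : Tendsto (fun z : ℝ × ℝ => B * |z.2 - x|) (𝓝 (s, x)) (𝓝 (B * |x - x|)) :=
      (Continuous.tendsto (by fun_prop) (s, x))
    rw [sub_self, abs_zero, mul_zero] at h3
    exact squeeze_zero_norm (fun z => hl z.1 z.2 x) h3
  have := h2.add h1
  simp only [sub_add_cancel, zero_add] at this
  exact this

theorem continuous_hilb_family (hL : 0 < L) (hF : ∀ x, Continuous fun s => F s x)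
    (hd : ∀ s, CB 1 B (F s)) (hper : ∀ s x, F s (x + L) = F s x) (x : ℝ) :
    Continuous fun s => hilb L (F s) x := by
  unfold hilb
  refine continuous_const.mul (intervalIntegral.continuous_of_dominated_interval
    (bound := fun _ => B * (L / Real.pi))
    (fun s => aestronglyMeasurable_hilb_integrand (hd s).continuous x _)
    (fun s => Eventually.of_forall fun y hy => ?_) (by simp)
    (Eventually.of_forall fun y _ => ((hF _).sub (hF _)).mul continuous_const))
  rw [uIoc_of_le hL.le] at hy
  exact abs_hilb_integrand_le hL (hd s) (hper s) x hy

/-- The right-hand side `(-(2π/L) H(h_x) + (3 h_x + 1/h_x) h_xx)_xx` of the evolution equation. -/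
def evolRate (L : ℝ) (u : ℝ → ℝ) : ℝ → ℝ := iteratedDeriv 2 (chemPotential L u)

theorem exists_CB_evolRate (hL : 0 < L) (hb : b < 0) (B : ℝ) :
    ∃ C, 0 ≤ C ∧ ∀ u, Admissible L b B u → CB 2 C (evolRate L u) := by
  obtain ⟨C, hC⟩ := (Admissible.ucb_chemPotential (B := B) hL hb).iteratedDeriv (k := 2) (m := 2)
  exact ⟨|C|, abs_nonneg C, fun u hu => (hC ⟨u, hu⟩).mono (le_abs_self C)⟩

theorem continuous_deriv_profile (hA : ∀ s, Admissible L b B (F s))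
    (hF : ∀ x, Continuous fun s => F s x) (x : ℝ) : Continuous fun s => deriv (F s) x :=
  continuous_deriv_family hF (fun s => (hA s).diff) (fun s => (hA s).cb.of_le (by norm_num)) x

theorem continuous_uncurry_deriv (hA : ∀ s, Admissible L b B (F s))
    (hF : ∀ x, Continuous fun s => F s x) : Continuous fun z : ℝ × ℝ => deriv (F z.1) z.2 :=
  continuous_uncurry_family (F := fun s => deriv (F s)) (continuous_deriv_profile hA hF)
    fun s x y => abs_sub_le_of_CB ((hA s).cb.of_le (by norm_num)) x y

theorem continuous_evolRate (hL : 0 < L) (hb : b < 0) (hA : ∀ s, Admissible L b B (F s))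
    (hF : ∀ x, Continuous fun s => F s x) : Continuous fun z : ℝ × ℝ => evolRate L (F z.1) z.2 := by
  have h1 := continuous_deriv_profile hA hF
  have h2 : ∀ x, Continuous fun s => deriv (deriv (F s)) x := continuous_deriv_family h1
    (fun s => (hA s).cb.1) (fun s => (hA s).cb.2.2.of_le (by norm_num))
  have h3 : ∀ x, Continuous fun s => chemPotential L (F s) x := fun x => by
    simp only [fun s => (hA s).chemPotential_eq hL x]
    exact (continuous_const.mul (continuous_hilb_family hL h1
      (fun s => (hA s).cb.of_le (by norm_num)) (fun s => (hA s).deriv_per) x)).add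
      (((continuous_const.mul (h1 x)).add (continuous_const.div (h1 x)
        fun s => (((hA s).slope x).trans_lt hb).ne)).mul (h2 x))
  obtain ⟨C, hC⟩ := Admissible.ucb_chemPotential (B := B) hL hb
  have hC' : ∀ s, CB 4 C (chemPotential L (F s)) := fun s => hC ⟨F s, hA s⟩
  have h4 := continuous_deriv_family h3 (fun s => (hC' s).1) (fun s => (hC' s).2.2.of_le (by norm_num))
  have h5 := continuous_deriv_family h4 (fun s => (hC' s).2.2.1)
    (fun s => (hC' s).2.2.2.2.of_le (by norm_num))
  have e : ∀ s, evolRate L (F s) = deriv (deriv (chemPotential L (F s))) := fun s => by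
    rw [evolRate, iteratedDeriv_succ, iteratedDeriv_one]
  simp only [e]
  exact continuous_uncurry_family (F := fun s => deriv (deriv (chemPotential L (F s)))) h5
    fun s x y => abs_sub_le_of_CB ((hC' s).2.2.2.2.of_le (by norm_num)) x y

end Families

/-! ### Qualitative properties of strong solutions -/

/-- The energy `∑ λ_k¹⁴ |c_k|²` of order seven of a height profile. -/
def energy (L : ℝ) (u : ℝ → ℝ) : ℝ := ∑' k, freq L k ^ 14 * ‖fc L (perPart L u) k‖ ^ 2

theorem memLp_of_lintegral_le {g : ℝ → ℝ} {L K : ℝ} (hg : LocallyIntegrable g) (hK : 0 ≤ K)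
    (h : ∫⁻ x in Icc 0 L, ‖g x‖ₑ ^ 2 ≤ ENNReal.ofReal K ^ 2) :
    MemLp g 2 (volume.restrict (Ioc 0 L)) ∧ ∫ x in Ioc 0 L, g x ^ 2 ≤ K ^ 2 := by
  have h1 : ∫⁻ x in Ioc 0 L, ‖g x‖ₑ ^ 2 ≤ ENNReal.ofReal K ^ 2 :=
    (lintegral_mono_set Ioc_subset_Icc_self).trans h
  have hm : AEStronglyMeasurable g (volume.restrict (Ioc 0 L)) := hg.aestronglyMeasurable.restrict
  constructor
  · refine ⟨hm, ?_⟩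
    rw [eLpNorm_lt_top_iff_lintegral_rpow_enorm_lt_top (by norm_num) (by norm_num)]
    simp only [ENNReal.toReal_ofNat, ENNReal.rpow_two]
    exact h1.trans_lt (by finiteness)
  · rw [integral_eq_lintegral_of_nonneg_ae (Eventually.of_forall fun x => sq_nonneg _) (hm.pow 2)]
    have h2 : ∫⁻ x in Ioc 0 L, ENNReal.ofReal (g x ^ 2) = ∫⁻ x in Ioc 0 L, ‖g x‖ₑ ^ 2 := by
      congr 1; funext x
      rw [← sq_abs, ENNReal.ofReal_pow (abs_nonneg _), Real.enorm_eq_ofReal_abs]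
    rw [h2]
    refine (ENNReal.toReal_mono (by finiteness) h1).trans ?_
    rw [ENNReal.toReal_pow, ENNReal.toReal_ofReal hK]

theorem MemSobolevStar.hasSum_energy {L K : ℝ} {u : ℝ → ℝ} {n : ℕ} (hL : 0 < L) (hn : 1 ≤ n) (hK : 0 ≤ K)
    (hu : MemSobolevStar L (n + 2) u) (hb : sobolevNorm L (n + 2) u ≤ ENNReal.ofReal K) :
    MemLp (weakDeriv (n + 2) u) 2 (volume.restrict (Ioc 0 L)) ∧
    ∃ X ≤ K ^ 2 / L, HasSum (fun k => freq L k ^ (2 * (n + 2)) * ‖fc L (perPart L u) k‖ ^ 2) X := by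
  obtain ⟨h1, h2⟩ := hu.regular (k := n + 1)
  have h3 := memLp_of_lintegral_le (L := L) h2.loc hK
    ((lintegral_weakDeriv_le L (n + 2) u).trans (by gcongr))
  refine ⟨h3.1, _, ?_, StepFlow.hasSum_energy hL (h1.differentiable (by simp)) hu.2.2 h1 h2 hn h3.1⟩
  rw [intervalIntegral.integral_of_le hL.le, one_div, ← div_eq_inv_mul]
  gcongr
  exact h3.2

/-- Projection of time to `[0, T]`. -/
def clampTime (T s : ℝ) : ℝ := max 0 (min s T)

theorem clampTime_mem {T : ℝ} (hT : 0 ≤ T) (s : ℝ) : clampTime T s ∈ Icc 0 T :=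
  ⟨le_max_left _ _, max_le hT (min_le_right _ _)⟩

theorem clampTime_of_mem {T s : ℝ} (hs : s ∈ Icc 0 T) : clampTime T s = s := by
  rw [clampTime, min_eq_left hs.2, max_eq_right hs.1]

theorem continuous_clampTime (T : ℝ) : Continuous (clampTime T) := by
  unfold clampTime; fun_prop

theorem ContinuousOn.comp_clampTime {T : ℝ} (hT : 0 ≤ T) {f : ℝ → ℝ} (hf : ContinuousOn f (Icc 0 T)) :
    Continuous fun s => f (clampTime T s) :=
  hf.comp_continuous (continuous_clampTime T) (clampTime_mem hT)

theorem le_of_ae_le_Icc {T K : ℝ} (hT : 0 < T) {f : ℝ → ℝ} (hf : Continuous f)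
    (h : ∀ᵐ t ∂(volume.restrict (Icc 0 T)), f t ≤ K) : ∀ t ∈ Icc 0 T, f t ≤ K := by
  have h1 : ∀ t ∈ Ioo 0 T, f t ≤ K := by
    by_contra! hcon
    obtain ⟨t, ht, ht'⟩ := hcon
    have ho : IsOpen (Ioo 0 T ∩ {t | K < f t}) := isOpen_Ioo.inter (isOpen_lt continuous_const hf)
    have hpos := ho.measure_pos volume ⟨t, ht, ht'⟩
    rw [ae_restrict_iff' measurableSet_Icc] at h
    have h0 : volume (Ioo 0 T ∩ {t | K < f t}) = 0 := measure_mono_null (fun s hs => by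
      simp only [mem_compl_iff, mem_ofPred_eq, not_forall]
      exact ⟨Ioo_subset_Icc_self hs.1, not_le.2 hs.2⟩) h
    exact hpos.ne' h0
  intro t ht
  rw [← closure_Ioo hT.ne] at ht
  exact le_on_closure (s := Ioo 0 T) (g := fun _ => K) h1 hf.continuousOn continuousOn_const ht

namespace IsStrongSolution

variable {L T : ℝ} {h : ℝ → ℝ → ℝ}

theorem continuousOn_time {m : ℕ} (hT : 0 < T) (hs : IsStrongSolution L T m h) (x : ℝ) :
    ContinuousOn (fun t => h t x) (Icc 0 T) := by
  obtain ⟨g, -, hg, -⟩ := hs.evolution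
  have h1 := (hg x T ⟨hT.le, le_rfl⟩).1
  have h2 : ContinuousOn (fun t => h 0 x + ∫ s in (0 : ℝ)..t, g s x) (Icc 0 T) := by
    refine continuousOn_const.add ?_
    have h3 : IntegrableOn (fun s => g s x) (uIcc 0 T) := by
      rw [uIcc_of_le hT.le, integrableOn_Icc_iff_integrableOn_Ioc]
      exact (intervalIntegrable_iff_integrableOn_Ioc_of_le hT.le).1 h1
    have := intervalIntegral.continuousOn_primitive_interval h3
    rwa [uIcc_of_le hT.le] at this
  exact h2.congr fun t ht => (hg x t ht).2

theorem abs_le {m : ℕ} (hT : 0 < T) (hs : IsStrongSolution L T m h) :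
    ∃ C, ∀ t ∈ Icc 0 T, ∀ x ∈ Icc 0 L, |h t x| ≤ C := by
  obtain ⟨C, hC⟩ := (isCompact_Icc (a := (0 : ℝ)) (b := T)).exists_bound_of_continuousOn
    (hs.continuousOn_time hT 0)
  refine ⟨C + 1, fun t ht x hx => ?_⟩
  have h1 : StrictAnti (h t) := strictAnti_of_deriv_neg (hs.decreasing t ht)
  have h2 := (hs.cont_mem t ht).2.2 0
  rw [zero_add] at h2
  have h3 := h1.antitone hx.1
  have h4 := h1.antitone hx.2
  have h5 := _root_.abs_le.1 (hC t ht)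
  rw [_root_.abs_le]
  constructor <;> linarith

theorem continuous_fc {m : ℕ} (hL : 0 < L) (hT : 0 < T) (hs : IsStrongSolution L T m h) (k : ℤ) :
    Continuous fun s => fc L (perPart L (h (clampTime T s))) k := by
  obtain ⟨C, hC⟩ := hs.abs_le hT
  unfold fc
  refine continuous_const.mul (intervalIntegral.continuous_of_dominated_interval
    (bound := fun _ => C + 1) (fun s => ?_) (fun s => Eventually.of_forall fun x hx => ?_) (by simp)
    (Eventually.of_forall fun x _ => continuous_const.mul (Complex.continuous_ofReal.comp
      ((ContinuousOn.comp_clampTime hT.le (hs.continuousOn_time hT x)).add continuous_const))))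
  · have := (hs.cont_mem _ (clampTime_mem hT.le s)).1
    exact ((continuous_expo _).mul (Complex.continuous_ofReal.comp
      (this.add (continuous_id.div_const L)))).aestronglyMeasurable
  · rw [uIoc_of_le hL.le] at hx
    rw [norm_mul, norm_expo, one_mul, Complex.norm_real, Real.norm_eq_abs, perPart]
    refine (abs_add_le _ _).trans (add_le_add (hC _ (clampTime_mem hT.le s) x (Ioc_subset_Icc_self hx)) ?_)
    rw [abs_of_nonneg (div_nonneg hx.1.le hL.le), div_le_one hL]
    exact hx.2

theorem exists_energy_bound (hL : 0 < L) (hT : 0 < T) (hs : IsStrongSolution L T 7 h) :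
    ∃ E, ∀ t ∈ Icc 0 T, Summable (fun k => freq L k ^ 14 * ‖fc L (perPart L (h t)) k‖ ^ 2) ∧
      energy L (h t) ≤ E := by
  obtain ⟨K, hK⟩ := hs.linfty
  have hfin : ∀ S : Finset ℤ, ∀ t ∈ Icc 0 T,
      ∑ k ∈ S, freq L k ^ 14 * ‖fc L (perPart L (h (clampTime T t))) k‖ ^ 2 ≤ (K : ℝ) ^ 2 / L := by
    intro S
    refine le_of_ae_le_Icc hT (continuous_finsetSum _ fun k _ =>
      continuous_const.mul ((hs.continuous_fc hL hT k).norm.pow 2)) ?_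
    filter_upwards [hK, ae_restrict_mem measurableSet_Icc] with t ht ht'
    obtain ⟨-, X, hX, hsum⟩ := MemSobolevStar.hasSum_energy (n := 5) (K := K) hL (by norm_num) K.2 ht.1
      (by simpa using ht.2)
    rw [show 2 * (5 + 2) = 14 from rfl] at hsum
    rw [clampTime_of_mem ht']
    exact (sum_le_hasSum (f := fun k => freq L k ^ 14 * ‖fc L (perPart L (h t)) k‖ ^ 2) S
      (fun k _ => by positivity) hsum).trans hX
  refine ⟨(K : ℝ) ^ 2 / L, fun t ht => ?_⟩
  have h1 : ∀ S : Finset ℤ, ∑ k ∈ S, freq L k ^ 14 * ‖fc L (perPart L (h t)) k‖ ^ 2 ≤ (K : ℝ) ^ 2 / L := by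
    intro S
    have := hfin S t ht
    rwa [clampTime_of_mem ht] at this
  have h2 := summable_of_sum_le (f := fun k => freq L k ^ 14 * ‖fc L (perPart L (h t)) k‖ ^ 2)
    (fun k => by positivity) h1
  exact ⟨h2, h2.tsum_le_of_sum_le h1⟩

end IsStrongSolution

/-- Profiles with finite energy and controlled slope are admissible. -/
theorem exists_admissible_of_energy {L : ℝ} (hL : 0 < L) (E : ℝ) : ∃ B, ∀ (b : ℝ) (u : ℝ → ℝ),
    Continuous u → (∀ x, u (x + L) = u x - 1) →
    Summable (fun k => freq L k ^ 14 * ‖fc L (perPart L u) k‖ ^ 2) → energy L u ≤ E →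
    (∀ x, deriv u x ≤ b) → Admissible L b B u := by
  obtain ⟨B, hB⟩ := exists_CB_of_energy hL E
  refine ⟨B + 1 / L, fun b u hu hper hs hE hb => ?_⟩
  obtain ⟨h1, h2⟩ := hB (perPart L u) (hu.add (continuous_id.div_const L)) (perPart_periodic hL hper) hs hE
  have h3 : ∀ x, HasDerivAt u (deriv (perPart L u) x + -(1 / L)) x := fun x => by
    have := (h1 x).hasDerivAt.sub ((hasDerivAt_id x).div_const L)
    rw [← sub_eq_add_neg]
    refine this.congr_of_eventuallyEq (Eventually.of_forall fun y => ?_)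
    simp [perPart]
  refine ⟨fun x => (h3 x).differentiableAt, ?_, hb, hper⟩
  rw [show deriv u = fun x => deriv (perPart L u) x + -(1 / L) from funext fun x => (h3 x).deriv]
  exact h2.add (CB.const (by rw [abs_neg, abs_of_pos (by positivity)]))

theorem IsStrongSolution.exists_admissible {L T : ℝ} {h : ℝ → ℝ → ℝ} (hL : 0 < L) (hT : 0 < T)
    (hs : IsStrongSolution L T 7 h) : ∃ b < 0, ∃ B, ∀ t ∈ Icc 0 T, Admissible L b B (h t) := by
  obtain ⟨E, hE⟩ := hs.exists_energy_bound hL hT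
  obtain ⟨B, hB⟩ := exists_admissible_of_energy hL E
  have hA : ∀ (b : ℝ), ∀ t ∈ Icc 0 T, (∀ x, deriv (h t) x ≤ b) → Admissible L b B (h t) := fun b t ht hb =>
    hB b (h t) (hs.cont_mem t ht).1 (hs.cont_mem t ht).2.2 (hE t ht).1 (hE t ht).2 hb
  have hA0 : ∀ s, Admissible L 0 B (h (clampTime T s)) := fun s =>
    hA 0 _ (clampTime_mem hT.le s) fun x => (hs.decreasing _ (clampTime_mem hT.le s) x).le
  have hc := continuous_uncurry_deriv hA0 fun x => ContinuousOn.comp_clampTime hT.le (hs.continuousOn_time hT x)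
  obtain ⟨z, hz, hmax⟩ := (isCompact_Icc.prod isCompact_Icc :
    IsCompact (Icc (0 : ℝ) T ×ˢ Icc (0 : ℝ) L)).exists_isMaxOn
      ⟨(0, 0), ⟨⟨le_rfl, hT.le⟩, ⟨le_rfl, hL.le⟩⟩⟩ hc.continuousOn
  refine ⟨_, hs.decreasing _ (clampTime_mem hT.le z.1) z.2, B, fun t ht => hA _ t ht fun x => ?_⟩
  obtain ⟨y, hy, hxy⟩ : ∃ y ∈ Ico (0 : ℝ) (0 + L), deriv (h t) x = deriv (h t) y :=
    Function.Periodic.exists_mem_Ico (f := deriv (h t)) (fun x => by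
      have := (hA0 t).deriv_per x
      rwa [clampTime_of_mem ht] at this) hL x 0
  rw [hxy]
  have := hmax (show ((t, y) : ℝ × ℝ) ∈ Icc (0 : ℝ) T ×ˢ Icc (0 : ℝ) L from
    ⟨ht, by rw [zero_add] at hy; exact Ico_subset_Icc_self hy⟩)
  simpa only [mem_ofPred_eq, clampTime_of_mem ht] using this

/-! ### The energy identity -/

section FourierEvolution

variable {L : ℝ} {G : ℝ → ℝ → ℝ}

theorem continuous_fc_family (hG : Continuous fun z : ℝ × ℝ => G z.1 z.2) (k : ℤ) :
    Continuous fun s => fc L (G s) k := by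
  unfold fc
  refine continuous_const.mul (intervalIntegral.continuous_parametric_intervalIntegral_of_continuous' ?_ _ _)
  exact ((continuous_expo _).comp continuous_snd).mul (Complex.continuous_ofReal.comp hG)

theorem fc_add_integral (hG : Continuous fun z : ℝ × ℝ => G z.1 z.2) {v : ℝ → ℝ} (hv : Continuous v)
    (t : ℝ) (k : ℤ) : fc L (fun x => v x + ∫ s in (0 : ℝ)..t, G s x) k
      = fc L v k + ∫ s in (0 : ℝ)..t, fc L (G s) k := by
  have h1 : Continuous fun x => ∫ s in (0 : ℝ)..t, G s x :=
    intervalIntegral.continuous_parametric_intervalIntegral_of_continuous'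
      (f := fun x s => G s x) (hG.comp continuous_swap) _ _
  rw [fc_add (hv.intervalIntegrable _ _) (h1.intervalIntegrable _ _)]
  congr 1
  simp only [fc]
  rw [intervalIntegral.integral_const_mul]
  congr 1
  have h2 : Continuous fun z : ℝ × ℝ => expo L (-k) z.1 * (G z.2 z.1 : ℂ) :=
    ((continuous_expo _).comp continuous_fst).mul (Complex.continuous_ofReal.comp (hG.comp continuous_swap))
  have h3 : ∀ x, expo L (-k) x * ((∫ s in (0 : ℝ)..t, G s x : ℝ) : ℂ)
      = ∫ s in (0 : ℝ)..t, expo L (-k) x * (G s x : ℂ) := fun x => by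
    rw [intervalIntegral.integral_const_mul, intervalIntegral.integral_ofReal]
  simp only [h3]
  refine intervalIntegral_intervalIntegral_swap ?_
  exact (h2.continuousOn.integrableOn_compact (isCompact_uIcc.prod isCompact_uIcc)).mono_set
    (prod_mono uIoc_subset_uIcc uIoc_subset_uIcc)

theorem norm_sq_integral {c₀ : ℂ} {c' : ℝ → ℂ} (hc : Continuous c') (t : ℝ) :
    ‖c₀ + ∫ s in (0 : ℝ)..t, c' s‖ ^ 2 = ‖c₀‖ ^ 2 +
      ∫ s in (0 : ℝ)..t, 2 * (c' s * (starRingEnd ℂ) (c₀ + ∫ r in (0 : ℝ)..s, c' r)).re := by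
  set c : ℝ → ℂ := fun s => c₀ + ∫ r in (0 : ℝ)..s, c' r with hcdef
  have hd : ∀ s, HasDerivAt c (c' s) s := fun s =>
    (intervalIntegral.integral_hasDerivAt_right (hc.intervalIntegrable _ _)
      (hc.stronglyMeasurableAtFilter _ _) hc.continuousAt).const_add _
  have hcc : Continuous c := continuous_iff_continuousAt.2 fun s => (hd s).continuousAt
  have hn : ∀ s, HasDerivAt (fun s => ‖c s‖ ^ 2) (2 * (c' s * (starRingEnd ℂ) (c s)).re) s := fun s => by
    have h1 : ∀ s, ‖c s‖ ^ 2 = (c s).re ^ 2 + (c s).im ^ 2 := fun s => by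
      rw [← Complex.normSq_eq_norm_sq, Complex.normSq_apply]; ring
    simp only [h1]
    have hre := Complex.reCLM.hasFDerivAt.comp_hasDerivAt s (hd s)
    have him := Complex.imCLM.hasFDerivAt.comp_hasDerivAt s (hd s)
    refine ((hre.pow 2).add (him.pow 2)).congr_deriv ?_
    simp [Complex.mul_re]
    ring
  have hcont : Continuous fun s => 2 * (c' s * (starRingEnd ℂ) (c s)).re :=
    continuous_const.mul (Complex.continuous_re.comp (hc.mul (Complex.continuous_conj.comp hcc)))
  have := intervalIntegral.integral_eq_sub_of_hasDerivAt (fun s _ => hn s) (hcont.intervalIntegrable 0 t)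
  rw [this]
  simp [hcdef]

end FourierEvolution

namespace IsStrongSolution

variable {L T b B : ℝ} {h : ℝ → ℝ → ℝ}

theorem admissible_clamp (hT : 0 < T) (hA : ∀ t ∈ Icc 0 T, Admissible L b B (h t)) (s : ℝ) :
    Admissible L b B (h (clampTime T s)) := hA _ (clampTime_mem hT.le s)

theorem continuous_clamp {m : ℕ} (hT : 0 < T) (hs : IsStrongSolution L T m h) (x : ℝ) :
    Continuous fun s => h (clampTime T s) x :=
  ContinuousOn.comp_clampTime hT.le (hs.continuousOn_time hT x)

theorem continuous_evolRate_clamp {m : ℕ} (hL : 0 < L) (hb : b < 0) (hT : 0 < T)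
    (hs : IsStrongSolution L T m h) (hA : ∀ t ∈ Icc 0 T, Admissible L b B (h t)) :
    Continuous fun z : ℝ × ℝ => evolRate L (h (clampTime T z.1)) z.2 :=
  continuous_evolRate (F := fun s => h (clampTime T s)) hL hb (admissible_clamp hT hA)
    (hs.continuous_clamp hT)

theorem eq_integral {m : ℕ} (hL : 0 < L) (hb : b < 0) (hT : 0 < T) (hs : IsStrongSolution L T m h)
    (hA : ∀ t ∈ Icc 0 T, Admissible L b B (h t)) {t : ℝ} (ht : t ∈ Icc 0 T) (x : ℝ) :
    h t x = h 0 x + ∫ s in (0 : ℝ)..t, evolRate L (h (clampTime T s)) x := by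
  obtain ⟨g, ⟨K, hK⟩, hg, hev⟩ := hs.evolution
  rw [(hg x t ht).2]
  congr 1
  refine intervalIntegral.integral_congr_ae_restrict ?_
  rw [uIoc_of_le ht.1]
  have hsub : Ioc 0 t ⊆ Icc 0 T := fun s hs => ⟨hs.1.le, hs.2.trans ht.2⟩
  have hFc := hs.continuous_evolRate_clamp hL hb hT hA
  filter_upwards [ae_restrict_of_ae_restrict_of_subset hsub hK,
    ae_restrict_of_ae_restrict_of_subset hsub hev, ae_restrict_mem measurableSet_Ioc] with s h1 h2 h3
  have hF : Continuous (evolRate L (h s)) := by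
    have := hFc.comp (f := fun x : ℝ => (s, x)) (by fun_prop)
    simpa only [Function.comp_def, clampTime_of_mem (hsub h3)] using this
  have := (Continuous.ae_eq_iff_eq volume h1.1.1 hF).1 h2
  rw [clampTime_of_mem (hsub h3), this]

theorem hasDerivWithinAt {m : ℕ} (hL : 0 < L) (hb : b < 0) (hT : 0 < T) (hs : IsStrongSolution L T m h)
    (hA : ∀ t ∈ Icc 0 T, Admissible L b B (h t)) {t : ℝ} (ht : t ∈ Icc 0 T) (x : ℝ) :
    HasDerivWithinAt (fun s => h s x) (evolRate L (h t) x) (Icc 0 T) t := by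
  have hc : Continuous fun s => evolRate L (h (clampTime T s)) x :=
    (hs.continuous_evolRate_clamp hL hb hT hA).comp (g := fun z : ℝ × ℝ => evolRate L (h (clampTime T z.1)) z.2)
      (f := fun s => (s, x)) (by fun_prop)
  have h1 : HasDerivAt (fun t => h 0 x + ∫ s in (0 : ℝ)..t, evolRate L (h (clampTime T s)) x)
      (evolRate L (h (clampTime T t)) x) t :=
    (intervalIntegral.integral_hasDerivAt_right (hc.intervalIntegrable _ _)
      (hc.stronglyMeasurableAtFilter _ _) hc.continuousAt).const_add _
  rw [clampTime_of_mem ht] at h1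
  exact h1.hasDerivWithinAt.congr (fun s hs' => hs.eq_integral hL hb hT hA hs' x)
    (hs.eq_integral hL hb hT hA ht x)

theorem mode_energy {m : ℕ} (hL : 0 < L) (hb : b < 0) (hT : 0 < T) (hs : IsStrongSolution L T m h)
    (hA : ∀ t ∈ Icc 0 T, Admissible L b B (h t)) {t : ℝ} (ht : t ∈ Icc 0 T) (k : ℤ) :
    freq L k ^ 14 * ‖fc L (perPart L (h t)) k‖ ^ 2 = freq L k ^ 14 * ‖fc L (perPart L (h 0)) k‖ ^ 2
      + ∫ s in (0 : ℝ)..t, energyRate L (h (clampTime T s)) k := by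
  have hFc := hs.continuous_evolRate_clamp hL hb hT hA
  have hv : Continuous (perPart L (h 0)) :=
    (hs.cont_mem 0 ⟨le_rfl, hT.le⟩).1.add (continuous_id.div_const L)
  have hcoef : ∀ t ∈ Icc 0 T, fc L (perPart L (h t)) k = fc L (perPart L (h 0)) k
      + ∫ s in (0 : ℝ)..t, fc L (evolRate L (h (clampTime T s))) k := fun t ht => by
    rw [← fc_add_integral (G := fun s => evolRate L (h (clampTime T s))) hFc hv]
    congr 1
    funext x
    rw [perPart, perPart, hs.eq_integral hL hb hT hA ht x]; ring
  rw [hcoef t ht, norm_sq_integral (continuous_fc_family (G := fun s => evolRate L (h (clampTime T s))) hFc k), mul_add,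
    ← intervalIntegral.integral_const_mul]
  congr 1
  refine intervalIntegral.integral_congr fun s hs' => ?_
  rw [uIcc_of_le ht.1] at hs'
  have hsT : s ∈ Icc 0 T := ⟨hs'.1, hs'.2.trans ht.2⟩
  simp only [energyRate]
  rw [← hcoef s hsT, clampTime_of_mem hsT]
  rfl

theorem continuous_energyRate {m : ℕ} (hL : 0 < L) (hb : b < 0) (hT : 0 < T) (hs : IsStrongSolution L T m h)
    (hA : ∀ t ∈ Icc 0 T, Admissible L b B (h t)) (k : ℤ) :
    Continuous fun s => energyRate L (h (clampTime T s)) k := by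
  have h1 := hs.continuous_fc hL hT k
  have h2 := continuous_fc_family (L := L) (G := fun s => evolRate L (h (clampTime T s)))
    (hs.continuous_evolRate_clamp hL hb hT hA) k
  exact continuous_const.mul (continuous_const.mul
    (Complex.continuous_re.comp (h2.mul (Complex.continuous_conj.comp h1))))

end IsStrongSolution

theorem IsWeakDeriv.ae_unique {k : ℕ} {u g g' : ℝ → ℝ} (h : IsWeakDeriv k u g) (h' : IsWeakDeriv k u g') :
    g =ᵐ[volume] g' := by
  refine ae_eq_of_integral_contDiff_smul_eq h.2.1 h'.2.1 fun ψ hψ hc => ?_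
  have h1 := h.2.2 ψ hψ hc
  rw [h'.2.2 ψ hψ hc] at h1
  have : ((-1 : ℝ) ^ k) ≠ 0 := pow_ne_zero _ (by norm_num)
  simp only [smul_eq_mul, mul_comm (ψ _)]
  exact (mul_left_cancel₀ this h1).symm

theorem MemSobolevLoc.memLp_weakDeriv {L : ℝ} {k : ℕ} {u : ℝ → ℝ} (hL : 0 < L) (hu : MemSobolevLoc k u) :
    MemLp (weakDeriv k u) 2 (volume.restrict (Ioc 0 L)) := by
  obtain ⟨g, hg, hg2⟩ := hu k le_rfl
  have h1 : MemLp g 2 (volume.restrict (Ioc 0 L)) :=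
    (hg2 L).mono_measure (Measure.restrict_mono (Ioc_subset_Icc_self.trans
      (Icc_subset_Icc_left (by linarith))) le_rfl)
  exact h1.ae_eq (ae_restrict_of_ae (hg.ae_unique (hu.isWeakDeriv le_rfl)))

/-- The sum `∑ λ_k¹⁸ |c_k|²` controlled by the norm of order nine. -/
def topEnergy (L : ℝ) (u : ℝ → ℝ) : ℝ≥0∞ :=
  ∑' k, ENNReal.ofReal (freq L k ^ 18 * ‖fc L (perPart L u) k‖ ^ 2)

theorem MemSobolevStar.topEnergy_le {L : ℝ} {u : ℝ → ℝ} (hL : 0 < L) (hu : MemSobolevStar L 9 u) :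
    topEnergy L u ≤ ENNReal.ofReal (1 / L) * sobolevNorm L 9 u ^ 2 := by
  obtain ⟨h1, h2⟩ := hu.regular (k := 8)
  have h3 := hu.2.1.memLp_weakDeriv hL
  have h4 := StepFlow.hasSum_energy (n := 7) hL (h1.differentiable (by simp)) hu.2.2 h1 h2 (by norm_num) h3
  rw [show 2 * (7 + 2) = 18 from rfl] at h4
  rw [topEnergy, ← ENNReal.ofReal_tsum_of_nonneg (fun k => by positivity) h4.summable, h4.tsum_eq,
    ENNReal.ofReal_mul (by positivity)]
  gcongr
  rw [intervalIntegral.integral_of_le hL.le,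
    ofReal_integral_eq_lintegral_ofReal h3.integrable_sq (Eventually.of_forall fun x => sq_nonneg _)]
  refine le_trans ?_ (lintegral_weakDeriv_le L 9 u)
  refine le_trans (lintegral_mono fun x => ?_) (lintegral_mono_set Ioc_subset_Icc_self)
  rw [← sq_abs, ENNReal.ofReal_pow (abs_nonneg _), Real.enorm_eq_ofReal_abs]

namespace IsStrongSolution

variable {L T b B : ℝ} {h : ℝ → ℝ → ℝ}

theorem ae_regular (hL : 0 < L) (hs : IsStrongSolution L T 7 h) :
    ∀ᵐ s ∂(volume.restrict (Icc 0 T)), ContDiff ℝ 8 (h s) ∧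
      IsPrimitive (iteratedDeriv 8 (h s)) (weakDeriv 9 (h s)) ∧
      MemLp (weakDeriv 9 (h s)) 2 (volume.restrict (Ioc 0 L)) := by
  filter_upwards [hs.ltwo_mem] with s h1
  exact ⟨h1.regular.1, h1.regular.2, h1.2.1.memLp_weakDeriv hL⟩

theorem integrable_topEnergy (hL : 0 < L) (hT : 0 < T) (hs : IsStrongSolution L T 7 h) :
    Integrable (fun s => (topEnergy L (h (clampTime T s))).toReal) (volume.restrict (Icc 0 T)) := by
  have hm : Measurable fun s => topEnergy L (h (clampTime T s)) := by
    refine Measurable.tsum fun k => ENNReal.measurable_ofReal.comp ?_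
    exact (continuous_const.mul ((hs.continuous_fc hL hT k).norm.pow 2)).measurable
  refine integrable_toReal_of_lintegral_ne_top hm.aemeasurable (ne_of_lt ?_)
  calc ∫⁻ s in Icc 0 T, topEnergy L (h (clampTime T s))
      ≤ ∫⁻ s in Icc 0 T, ENNReal.ofReal (1 / L) * sobolevNorm L 9 (h s) ^ 2 := by
        refine lintegral_mono_ae ?_
        filter_upwards [hs.ltwo_mem, ae_restrict_mem measurableSet_Icc] with s h1 h2
        rw [clampTime_of_mem h2]
        exact h1.topEnergy_le hL
    _ = ENNReal.ofReal (1 / L) * ∫⁻ s in Icc 0 T, sobolevNorm L 9 (h s) ^ 2 :=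
        lintegral_const_mul' _ _ (by finiteness)
    _ < ⊤ := ENNReal.mul_lt_top (by finiteness) hs.ltwo

theorem energy_eq (hL : 0 < L) (hb : b < 0) (hT : 0 < T) (hs : IsStrongSolution L T 7 h)
    (hA : ∀ t ∈ Icc 0 T, Admissible L b B (h t)) :
    IntervalIntegrable (fun s => ∑' k, energyRate L (h (clampTime T s)) k) volume 0 T ∧
    ∀ t ∈ Icc 0 T, energy L (h t) = energy L (h 0)
      + ∫ s in (0 : ℝ)..t, ∑' k, energyRate L (h (clampTime T s)) k := by
  obtain ⟨E, hE⟩ := hs.exists_energy_bound hL hT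
  obtain ⟨C, hC0, hC⟩ := exists_energyRate_bound hL hb B E
  have hgood : ∀ᵐ s ∂(volume.restrict (Icc 0 T)),
      (∀ S : Finset ℤ, |∑ k ∈ S, energyRate L (h (clampTime T s)) k|
        ≤ C * (1 + (topEnergy L (h (clampTime T s))).toReal)) ∧
      Summable (energyRate L (h (clampTime T s))) := by
    filter_upwards [hs.ae_regular hL, ae_restrict_mem measurableSet_Icc] with s h1 h2
    rw [clampTime_of_mem h2]
    obtain ⟨h3, h4, -⟩ := hC (h s) _ (hA s h2) h1.1 h1.2.1 h1.2.2 (hE s h2).2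
    refine ⟨fun S => ?_, h4⟩
    have := h3 S
    rw [topEnergy, ENNReal.tsum_toReal_eq fun k => ENNReal.ofReal_ne_top]
    simpa only [ENNReal.toReal_ofReal (mul_nonneg (by positivity) (sq_nonneg _) :
      (0 : ℝ) ≤ freq L _ ^ 18 * ‖fc L (perPart L (h s)) _‖ ^ 2)] using this
  have hbound : Integrable (fun s => C * (1 + (topEnergy L (h (clampTime T s))).toReal))
      (volume.restrict (Icc 0 T)) :=
    ((integrable_const 1).add (hs.integrable_topEnergy hL hT)).const_mul C
  have hcont : ∀ S : Finset ℤ, Continuous fun s => ∑ k ∈ S, energyRate L (h (clampTime T s)) k := fun S =>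
    continuous_finsetSum _ fun k _ => hs.continuous_energyRate hL hb hT hA k
  have hlim : ∀ᵐ s ∂(volume.restrict (Icc 0 T)), Tendsto
      (fun S : Finset ℤ => ∑ k ∈ S, energyRate L (h (clampTime T s)) k) atTop
      (𝓝 (∑' k, energyRate L (h (clampTime T s)) k)) := by
    filter_upwards [hgood] with s h1
    exact h1.2.hasSum
  have hint : Integrable (fun s => ∑' k, energyRate L (h (clampTime T s)) k) (volume.restrict (Icc 0 T)) := by
    refine hbound.mono' (aestronglyMeasurable_of_tendsto_ae atTop
      (fun S => (hcont S).aestronglyMeasurable) hlim) ?_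
    filter_upwards [hgood, hlim] with s h1 h2
    exact le_of_tendsto h2.norm (Eventually.of_forall fun S => h1.1 S)
  have hsub : ∀ t ∈ Icc 0 T, Ioc 0 t ⊆ Icc 0 T := fun t ht s hs => ⟨hs.1.le, hs.2.trans ht.2⟩
  refine ⟨(intervalIntegrable_iff_integrableOn_Ioc_of_le hT.le).2
    (hint.mono_measure (Measure.restrict_mono Ioc_subset_Icc_self le_rfl)), fun t ht => ?_⟩
  have hle : volume.restrict (Ioc 0 t) ≤ volume.restrict (Icc 0 T) :=
    Measure.restrict_mono (hsub t ht) le_rfl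
  have h1 : Tendsto (fun S : Finset ℤ => ∫ s in (0 : ℝ)..t, ∑ k ∈ S, energyRate L (h (clampTime T s)) k)
      atTop (𝓝 (∫ s in (0 : ℝ)..t, ∑' k, energyRate L (h (clampTime T s)) k)) := by
    simp only [intervalIntegral.integral_of_le ht.1]
    refine tendsto_integral_filter_of_dominated_convergence
      (fun s => C * (1 + (topEnergy L (h (clampTime T s))).toReal))
      (Eventually.of_forall fun S => (hcont S).aestronglyMeasurable)
      (Eventually.of_forall fun S => ?_) (hbound.mono_measure hle) (ae_mono hle hlim)
    filter_upwards [ae_mono hle hgood] with s h1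
    exact h1.1 S
  have h2 : Tendsto (fun S : Finset ℤ => ∫ s in (0 : ℝ)..t, ∑ k ∈ S, energyRate L (h (clampTime T s)) k)
      atTop (𝓝 (energy L (h t) - energy L (h 0))) := by
    have h3 := (hE t ht).1.hasSum.sub (hE 0 ⟨le_rfl, hT.le⟩).1.hasSum
    refine Tendsto.congr (fun S => ?_) h3
    rw [intervalIntegral.integral_finsetSum fun k _ =>
      (hs.continuous_energyRate hL hb hT hA k).intervalIntegrable _ _]
    refine Finset.sum_congr rfl fun k _ => ?_
    beta_reduce
    rw [hs.mode_energy hL hb hT hA ht k]; ring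
  linarith [tendsto_nhds_unique h1 h2]

theorem continuousOn_energy (hL : 0 < L) (hb : b < 0) (hT : 0 < T) (hs : IsStrongSolution L T 7 h)
    (hA : ∀ t ∈ Icc 0 T, Admissible L b B (h t)) : ContinuousOn (fun t => energy L (h t)) (Icc 0 T) := by
  obtain ⟨h1, h2⟩ := hs.energy_eq hL hb hT hA
  have h3 : IntegrableOn (fun s => ∑' k, energyRate L (h (clampTime T s)) k) (uIcc 0 T) := by
    rw [uIcc_of_le hT.le, integrableOn_Icc_iff_integrableOn_Ioc]
    exact (intervalIntegrable_iff_integrableOn_Ioc_of_le hT.le).1 h1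
  have h4 := intervalIntegral.continuousOn_primitive_interval h3
  rw [uIcc_of_le hT.le] at h4
  exact (continuousOn_const.add h4).congr h2

theorem energy_le (hL : 0 < L) (hb : b < 0) (hT : 0 < T) (hs : IsStrongSolution L T 7 h)
    (hA : ∀ t ∈ Icc 0 T, Admissible L b B (h t)) {C t : ℝ} (ht : t ∈ Icc 0 T)
    (hC : ∀ s ∈ Icc 0 t, ∀ g, ContDiff ℝ 8 (h s) → IsPrimitive (iteratedDeriv 8 (h s)) g →
      MemLp g 2 (volume.restrict (Ioc 0 L)) → ∑' k, energyRate L (h s) k ≤ C) :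
    energy L (h t) ≤ energy L (h 0) + C * t := by
  obtain ⟨h1, h2⟩ := hs.energy_eq hL hb hT hA
  rw [h2 t ht]
  have hsub : Icc 0 t ⊆ Icc 0 T := Icc_subset_Icc_right ht.2
  have h3 : ∫ s in (0 : ℝ)..t, ∑' k, energyRate L (h (clampTime T s)) k ≤ ∫ _ in (0 : ℝ)..t, C := by
    refine intervalIntegral.integral_mono_ae_restrict ht.1 (h1.mono_set ?_) (by simp) ?_
    · rw [uIcc_of_le ht.1, uIcc_of_le hT.le]; exact hsub
    · filter_upwards [ae_restrict_of_ae_restrict_of_subset hsub (hs.ae_regular hL),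
        ae_restrict_mem measurableSet_Icc] with s h4 h5
      rw [clampTime_of_mem (hsub h5)]
      exact hC s h5 _ h4.1 h4.2.1 h4.2.2
  rw [intervalIntegral.integral_const, smul_eq_mul, sub_zero] at h3
  linarith

end IsStrongSolution

/-! ### Uniform bounds for short times -/

theorem forall_le_of_forall_Icc {L c : ℝ} (hL : 0 < L) {f : ℝ → ℝ} (hper : ∀ x, f (x + L) = f x)
    (h : ∀ x ∈ Icc 0 L, f x < c) (x : ℝ) : f x < c := by
  obtain ⟨y, hy, hxy⟩ : ∃ y ∈ Ico (0 : ℝ) (0 + L), f x = f y :=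
    Function.Periodic.exists_mem_Ico hper hL x 0
  rw [hxy]
  rw [zero_add] at hy
  exact h y (Ico_subset_Icc_self hy)

/-- A continuity argument: a closed condition that improves itself persists. -/
theorem forall_Icc_of_improve {T : ℝ} {P : ℝ → Prop}
    (hclosed : ∀ t ∈ Ioc 0 T, (∀ s ∈ Ico 0 t, P s) → P t) (h0 : P 0)
    (hopen : ∀ t ∈ Icc 0 T, (∀ s ∈ Icc 0 t, P s) → ∀ᶠ s in 𝓝 t, s ∈ Icc 0 T → P s) :
    ∀ t ∈ Icc 0 T, P t := by
  by_contra! hcon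
  set S := {t | t ∈ Icc 0 T ∧ ¬P t} with hS
  have hne : S.Nonempty := by obtain ⟨t, ht, ht'⟩ := hcon; exact ⟨t, ht, ht'⟩
  have hbd : BddBelow S := ⟨0, fun t ht => ht.1.1⟩
  set τ := sInf S with hτ
  have hτ0 : 0 ≤ τ := le_csInf hne fun t ht => ht.1.1
  have hτT : τ ≤ T := by obtain ⟨t, ht⟩ := hne; exact (csInf_le hbd ht).trans ht.1.2
  have hlt : ∀ s ∈ Ico 0 τ, P s := fun s hs => by
    by_contra h
    exact absurd (csInf_le hbd (show s ∈ S from ⟨⟨hs.1, hs.2.le.trans hτT⟩, h⟩)) (not_le.2 hs.2)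
  have hPτ : P τ := by
    rcases hτ0.eq_or_lt with h | h
    · rw [← h]; exact h0
    · exact hclosed τ ⟨h, hτT⟩ hlt
  have hall : ∀ s ∈ Icc 0 τ, P s := fun s hs => by
    rcases hs.2.eq_or_lt with h | h
    · rw [h]; exact hPτ
    · exact hlt s ⟨hs.1, h⟩
  obtain ⟨δ, hδ, hδ'⟩ := Metric.eventually_nhds_iff.1 (hopen τ ⟨hτ0, hτT⟩ hall)
  obtain ⟨s, hs, hsδ⟩ := exists_lt_of_csInf_lt hne (show sInf S < τ + δ by linarith)
  refine hs.2 (hδ' ?_ hs.1)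
  have := csInf_le hbd hs
  rw [Real.dist_eq, abs_lt]; constructor <;> linarith

theorem exists_short_time {L β : ℝ} (hL : 0 < L) (hβ : β < 0) (M : ℝ) :
    ∃ T₀ > 0, ∃ B, ∀ T, 0 < T → T ≤ T₀ → ∀ h : ℝ → ℝ → ℝ, MemSobolevStar L 7 (h 0) →
      sobolevNorm L 7 (h 0) ≤ ENNReal.ofReal M → (∀ x, deriv (h 0) x ≤ 2 * β) →
      IsStrongSolution L T 7 h → ∀ t ∈ Icc 0 T, Admissible L β B (h t) := by
  set K := max M 0 ^ 2 / L with hK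
  obtain ⟨B, hB⟩ := exists_admissible_of_energy hL (K + 1)
  obtain ⟨C, hC0, hC⟩ := exists_energyRate_bound hL hβ B (K + 1)
  obtain ⟨D, hD0, hD⟩ := exists_CB_evolRate hL hβ B
  set η := -β / (4 * (|B| + 1)) with hη
  have hη0 : 0 < η := div_pos (by linarith) (by positivity)
  have hBη : B * η ≤ -β / 4 := by
    rw [hη, ← mul_div_assoc, div_le_div_iff₀ (by positivity) (by norm_num)]
    nlinarith [le_abs_self B]
  set T₀ := min (1 / (2 * (C + 1))) (-β * η / (8 * (D + 1))) with hT₀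
  have hT₀pos : 0 < T₀ := lt_min (by positivity) (div_pos (mul_pos (by linarith) hη0) (by positivity))
  refine ⟨T₀, hT₀pos, B, fun T hT hTT h hm hn hsl hs => ?_⟩
  obtain ⟨b, hb, B', hA⟩ := hs.exists_admissible hL hT
  obtain ⟨E, hE⟩ := hs.exists_energy_bound hL hT
  have hadm : ∀ t ∈ Icc 0 T, energy L (h t) ≤ K + 1 → (∀ x, deriv (h t) x ≤ β) →
      Admissible L β B (h t) := fun t ht h1 h2 =>
    hB β (h t) (hs.cont_mem t ht).1 (hs.cont_mem t ht).2.2 (hE t ht).1 h1 h2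
  have hE0 : energy L (h 0) ≤ K := by
    obtain ⟨-, X, hX, hsum⟩ := MemSobolevStar.hasSum_energy (n := 5) (K := max M 0) hL (by norm_num)
      (le_max_right _ _) hm (hn.trans (ENNReal.ofReal_le_ofReal (le_max_left _ _)))
    rw [show 2 * (5 + 2) = 14 from rfl] at hsum
    rw [energy, hsum.tsum_eq]; exact hX
  have hEc := hs.continuousOn_energy hL hb hT hA
  have hpc : Continuous fun z : ℝ × ℝ => deriv (h (clampTime T z.1)) z.2 :=
    continuous_uncurry_deriv (F := fun s => h (clampTime T s)) (IsStrongSolution.admissible_clamp hT hA)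
      (hs.continuous_clamp hT)
  have key : ∀ t ∈ Icc 0 T, energy L (h t) ≤ K + 1 ∧ ∀ x, deriv (h t) x ≤ β := by
    refine forall_Icc_of_improve (fun t ht hlt => ?_) ⟨by linarith, fun x => (hsl x).trans (by linarith)⟩
      fun t ht hle => ?_
    · have hsub : Icc 0 t ⊆ Icc 0 T := Icc_subset_Icc_right ht.2
      have hcl : closure (Ico 0 t) = Icc 0 t := closure_Ico ht.1.ne
      have htc : t ∈ closure (Ico 0 t) := by rw [hcl]; exact ⟨ht.1.le, le_rfl⟩
      refine ⟨le_on_closure (f := fun t => energy L (h t)) (g := fun _ => K + 1)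
        (fun s hs => (hlt s hs).1) (by rw [hcl]; exact hEc.mono hsub) continuousOn_const htc, fun x => ?_⟩
      have h1 := le_on_closure (f := fun s => deriv (h (clampTime T s)) x) (g := fun _ => β)
        (s := Ico 0 t) (fun s hs => by
          rw [clampTime_of_mem (hsub (Ico_subset_Icc_self hs))]; exact (hlt s hs).2 x)
        (hpc.comp (f := fun s : ℝ => (s, x)) (by fun_prop)).continuousOn continuousOn_const htc
      rwa [clampTime_of_mem ⟨ht.1.le, ht.2⟩] at h1
    · have hsub : Icc 0 t ⊆ Icc 0 T := Icc_subset_Icc_right ht.2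
      have ha : ∀ s ∈ Icc 0 t, Admissible L β B (h s) := fun s hs =>
        hadm s (hsub hs) (hle s hs).1 (hle s hs).2
      have htT : t ≤ T₀ := ht.2.trans hTT
      -- improved energy bound
      have e1 : energy L (h t) < K + 1 := by
        have h1 := hs.energy_le hL hb hT hA ht (C := C) fun s hs' g h8 hg hg2 =>
          (hC (h s) g (ha s hs') h8 hg hg2 (hle s hs').1).2.2
        have h2 : C * t ≤ 1 / 2 := by
          have h3 : t ≤ 1 / (2 * (C + 1)) := htT.trans (min_le_left _ _)
          rw [le_div_iff₀ (by positivity)] at h3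
          nlinarith [ht.1]
        linarith
      -- improved slope bound
      have hdiff : ∀ x, |h t x - h 0 x| ≤ D * t := fun x => by
        rw [hs.eq_integral hL hb hT hA ht x, add_sub_cancel_left]
        have := intervalIntegral.norm_integral_le_of_norm_le_const (a := 0) (b := t) (C := D)
          (f := fun s => evolRate L (h (clampTime T s)) x) (fun s hs' => by
            rw [uIoc_of_le ht.1] at hs'
            have hs2 : s ∈ Icc 0 t := Ioc_subset_Icc_self hs'
            rw [clampTime_of_mem (hsub hs2)]
            exact (hD _ (ha s hs2)).bound x)
        rwa [sub_zero, abs_of_nonneg ht.1] at this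
      have e2 : ∀ x, deriv (h t) x < β := fun x => by
        have hat := ha t ⟨ht.1, le_rfl⟩
        have h1 := (abs_le.1 (abs_slope_sub_deriv_le hat.diff (hat.cb.of_le (by norm_num)) x hη0)).1
        have h2 := sub_le_of_deriv_le (ha 0 ⟨le_rfl, ht.1⟩).diff hsl (by linarith : x ≤ x + η)
        have h3 := abs_le.1 (hdiff x)
        have h4 := abs_le.1 (hdiff (x + η))
        have h5 : (h t (x + η) - h t x) / η ≤ 2 * β + -β / 4 := by
          rw [div_le_iff₀ hη0]
          have h6 : t ≤ -β * η / (8 * (D + 1)) := htT.trans (min_le_right _ _)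
          rw [le_div_iff₀ (by positivity)] at h6
          nlinarith [ht.1]
        linarith
      have ev1 : ∀ᶠ s in 𝓝 t, s ∈ Icc 0 T → energy L (h s) < K + 1 :=
        eventually_nhdsWithin_iff.1 ((hEc t ht).eventually (gt_mem_nhds e1))
      have ev2 : ∀ᶠ s in 𝓝 t, ∀ x ∈ Icc (0 : ℝ) L, deriv (h (clampTime T s)) x < β :=
        IsCompact.eventually_forall_of_forall_eventually isCompact_Icc fun x _ =>
          hpc.continuousAt.eventually (gt_mem_nhds (by
            simpa only [clampTime_of_mem ht] using e2 x))
      filter_upwards [ev1, ev2] with s h1 h2 hsT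
      refine ⟨(h1 hsT).le, fun x => ?_⟩
      rw [clampTime_of_mem hsT] at h2
      exact (forall_le_of_forall_Icc hL (hA s hsT).deriv_per h2 x).le
  exact fun t ht => hadm t ht (key t ht).1 (key t ht).2

/-! ### Motion of the level sets -/

theorem exists_mem_uIcc_deriv_eq {f : ℝ → ℝ} (hf : Differentiable ℝ f) (x y : ℝ) :
    ∃ ξ ∈ uIcc x y, f y - f x = deriv f ξ * (y - x) := by
  rcases lt_trichotomy x y with h | h | h
  · obtain ⟨ξ, hξ, hξ'⟩ := exists_deriv_eq_slope f h hf.continuous.continuousOn hf.differentiableOn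
    refine ⟨ξ, by rw [uIcc_of_le h.le]; exact Ioo_subset_Icc_self hξ, ?_⟩
    rw [hξ', div_mul_cancel₀ _ (by linarith : y - x ≠ 0)]
  · exact ⟨x, left_mem_uIcc, by rw [h]; ring⟩
  · obtain ⟨ξ, hξ, hξ'⟩ := exists_deriv_eq_slope f h hf.continuous.continuousOn hf.differentiableOn
    refine ⟨ξ, by rw [uIcc_of_ge h.le]; exact Ioo_subset_Icc_self hξ, ?_⟩
    rw [hξ', div_mul_eq_mul_div, eq_div_iff (by linarith : x - y ≠ 0)]; ring

/-- Implicit differentiation of a level set. -/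
theorem hasDerivWithinAt_level {F : ℝ → ℝ → ℝ} {x : ℝ → ℝ} {S : Set ℝ} {t b α F' : ℝ} (hb : b < 0)
    (ht : t ∈ S) (hd : ∀ s ∈ S, Differentiable ℝ (F s)) (hslope : ∀ s ∈ S, ∀ y, deriv (F s) y ≤ b)
    (hx : ∀ s ∈ S, F s (x s) = α) (hF : HasDerivWithinAt (fun s => F s (x t)) F' S t)
    (hc : ContinuousWithinAt (fun z : ℝ × ℝ => deriv (F z.1) z.2) (S ×ˢ univ) (t, x t)) :
    HasDerivWithinAt x (-(F' / deriv (F t) (x t))) S t := by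
  have hex : ∀ s, ∃ ξ, s ∈ S → ξ ∈ uIcc (x t) (x s) ∧
      F s (x s) - F s (x t) = deriv (F s) ξ * (x s - x t) := fun s => by
    by_cases hs : s ∈ S
    · obtain ⟨ξ, h1, h2⟩ := exists_mem_uIcc_deriv_eq (hd s hs) (x t) (x s)
      exact ⟨ξ, fun _ => ⟨h1, h2⟩⟩
    · exact ⟨0, fun h => absurd h hs⟩
  choose ξ hξ using hex
  have hne : ∀ s ∈ S, ∀ y, deriv (F s) y ≠ 0 := fun s hs y => ((hslope s hs y).trans_lt hb).ne
  have hmove : ∀ s ∈ S, x s - x t = -(1 / deriv (F s) (ξ s)) * (F s (x t) - F t (x t)) := fun s hs => by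
    have h1 := (hξ s hs).2
    rw [hx s hs] at h1
    have h2 := hne s hs (ξ s)
    rw [hx t ht]
    field_simp
    linarith
  have hFt : Tendsto (fun s => F s (x t) - F t (x t)) (𝓝[S] t) (𝓝 0) := by
    have := hF.continuousWithinAt.tendsto.sub_const (F t (x t))
    rwa [sub_self] at this
  have hxt : Tendsto x (𝓝[S] t) (𝓝 (x t)) := by
    have h1 : ∀ᶠ s in 𝓝[S] t, ‖x s - x t‖ ≤ 1 / |b| * |F s (x t) - F t (x t)| := by
      filter_upwards [self_mem_nhdsWithin] with s hs
      rw [hmove s hs, norm_mul, norm_neg, Real.norm_eq_abs, Real.norm_eq_abs, abs_div, abs_one]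
      have h2 := hslope s hs (ξ s)
      refine mul_le_mul_of_nonneg_right (one_div_le_one_div_of_le (abs_pos.2 hb.ne) ?_) (abs_nonneg _)
      rw [abs_of_neg hb, abs_of_neg (h2.trans_lt hb)]; linarith
    have h2 := (hFt.abs).const_mul (1 / |b|)
    rw [abs_zero, mul_zero] at h2
    have h3 := squeeze_zero_norm' h1 h2
    have := h3.add_const (x t)
    simpa using this
  have hξt : Tendsto ξ (𝓝[S] t) (𝓝 (x t)) := by
    have h1 : ∀ᶠ s in 𝓝[S] t, ‖ξ s - x t‖ ≤ |x s - x t| := by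
      filter_upwards [self_mem_nhdsWithin] with s hs
      exact abs_sub_left_of_mem_uIcc (hξ s hs).1
    have h2 : Tendsto (fun s => |x s - x t|) (𝓝[S] t) (𝓝 0) := by
      have := (hxt.sub_const (x t)).abs
      rwa [sub_self, abs_zero] at this
    have := (squeeze_zero_norm' h1 h2).add_const (x t)
    simpa using this
  have hq : Tendsto (fun s => deriv (F s) (ξ s)) (𝓝[S] t) (𝓝 (deriv (F t) (x t))) := by
    have hz : Tendsto (fun s => (s, ξ s)) (𝓝[S] t) (𝓝[S ×ˢ univ] (t, x t)) := by
      refine tendsto_nhdsWithin_iff.2 ⟨(tendsto_id.mono_left nhdsWithin_le_nhds).prodMk_nhds hξt, ?_⟩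
      filter_upwards [self_mem_nhdsWithin] with s hs
      exact ⟨hs, mem_univ _⟩
    exact hc.tendsto.comp hz
  rw [hasDerivWithinAt_iff_tendsto_slope] at hF ⊢
  have hmono : 𝓝[S \ {t}] t ≤ 𝓝[S] t := nhdsWithin_mono _ sdiff_subset
  have h1 := ((hq.mono_left hmono).inv₀ (hne t ht _)).neg.mul hF
  refine (h1.congr' ?_).trans_eq ?_
  · filter_upwards [self_mem_nhdsWithin] with s hs
    rw [slope_def_field, slope_def_field, hmove s hs.1]
    field_simp
  · congr 1; ring

end

end StepFlow

theorem mainTheorem4 (L β M : ℝ) (hL : 0 < L) (hβ : β < 0) :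
    ∃ T₀ : ℝ, 0 < T₀ ∧ ∃ C : ℝ, ∀ T : ℝ, 0 < T → T ≤ T₀ →
      ∀ h φ : ℝ → ℝ → ℝ,
        StepFlow.MemSobolevStar L 7 (h 0) →
        StepFlow.sobolevNorm L 7 (h 0) ≤ ENNReal.ofReal M →
        (∀ x, deriv (h 0) x ≤ 2 * β) →
        StepFlow.IsStrongSolution L T 7 h →
        (∀ t ∈ Set.Icc 0 T, ∀ α, h t (φ t α) = α) →
        ∀ N : ℕ, 1 ≤ N → ∀ a : ℝ, a = 1 / (N : ℝ) →
          ∀ f : ℝ → ℤ → ℝ,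
            (∀ t i, f t i = StepFlow.discreteChem L a (StepFlow.nodal N (φ t)) i) →
            (∃ R : ℝ → ℤ → ℝ, ∀ t ∈ Set.Icc 0 T, ∀ i ∈ Finset.Icc (1 : ℤ) N,
              HasDerivWithinAt (fun s => StepFlow.nodal N (φ s) i)
                (StepFlow.stepVelocity L a (StepFlow.nodal N (φ t)) i
                  - StepFlow.rZero L (φ t) (StepFlow.node N i) * a + R t i * a ^ 2)
                (Set.Icc 0 T) t ∧
              |StepFlow.rZero L (φ t) (StepFlow.node N i)| ≤ C ∧ |R t i| ≤ C) ∧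
            (∀ t ∈ Set.Icc 0 T, ∃ E' : ℝ,
              HasDerivWithinAt
                (fun s => StepFlow.discreteEnergy L N (StepFlow.nodal N (φ s))) E'
                (Set.Icc 0 T) t ∧
              E' + ∑ i ∈ Finset.Icc (1 : ℤ) N, (f t (i + 1) - f t i) ^ 2 /
                (StepFlow.nodal N (φ t) (i + 1) - StepFlow.nodal N (φ t) i) ≤ C * a ∧
              E' + |β| * (a * ∑ i ∈ Finset.Icc (1 : ℤ) N, ((f t (i + 1) - f t i) / a) ^ 2)
                ≤ C * a) := by
  obtain ⟨T₀, hT₀, B, hB⟩ := StepFlow.exists_short_time hL hβ M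
  obtain ⟨C, hC⟩ := StepFlow.StepProfile.energy_estimates (B := B) hL hβ
  refine ⟨T₀, hT₀, C, fun T hT hTT h φ hm hn hsl hs hinv N hN a ha f hf => ?_⟩
  obtain rfl : f = fun t => StepFlow.discreteChem L a (StepFlow.nodal N (φ t)) :=
    funext fun t => funext fun i => hf t i
  have hA := hB T hT hTT h hm hn hsl hs
  have ha0 : a ≠ 0 := by
    have : (0 : ℝ) < N := by exact_mod_cast hN
    rw [ha]; positivity
  let d : ∀ t ∈ Set.Icc 0 T, StepFlow.StepProfile L β B := fun t ht =>
    ⟨h t, φ t, N, hN, hA t ht, hinv t ht⟩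
  have hvel : ∀ t (ht : t ∈ Set.Icc 0 T) (i : ℤ), HasDerivWithinAt (fun s => StepFlow.nodal N (φ s) i)
      ((d t ht).levelVelocity i) (Set.Icc 0 T) t := fun t ht i => by
    refine StepFlow.hasDerivWithinAt_level (F := h) (α := StepFlow.node N i) hβ ht (fun s hs' => (hA s hs').diff)
      (fun s hs' => (hA s hs').slope) (fun s hs' => hinv s hs' _)
      (hs.hasDerivWithinAt hL hβ hT hA ht _) ?_
    have hc := StepFlow.continuous_uncurry_deriv (F := fun s => h (StepFlow.clampTime T s))
      (StepFlow.IsStrongSolution.admissible_clamp hT hA) (hs.continuous_clamp hT)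
    refine hc.continuousWithinAt.congr (fun z hz => ?_) ?_
    · rw [StepFlow.clampTime_of_mem hz.1]
    · rw [StepFlow.clampTime_of_mem ht]
  have had : ∀ t ht, (d t ht).a = a := fun t ht => ha.symm
  constructor
  · classical
    refine ⟨fun t i => if ht : t ∈ Set.Icc 0 T then ((d t ht).levelVelocity i
      - (StepFlow.stepVelocity L a (StepFlow.nodal N (φ t)) i
        - StepFlow.rZero L (φ t) (StepFlow.node N i) * a)) / a ^ 2 else 0, fun t ht i _ => ?_⟩
    obtain ⟨h1, h2⟩ := (hC (d t ht)).1 i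
    rw [had t ht] at h2
    refine ⟨?_, h1, ?_⟩
    · refine (hvel t ht i).congr_deriv ?_
      beta_reduce
      rw [dif_pos ht, div_mul_cancel₀ _ (pow_ne_zero 2 ha0)]; ring
    · beta_reduce
      rw [dif_pos ht, abs_div, abs_of_nonneg (sq_nonneg a), div_le_iff₀ (by positivity)]
      exact h2
  · intro t ht
    obtain ⟨-, h1, h2⟩ := hC (d t ht)
    rw [had t ht] at h1 h2
    refine ⟨_, StepFlow.hasDerivWithinAt_discreteEnergy (x := fun s => StepFlow.nodal N (φ s)) hL hN
      ((d t ht).nodal_per hβ) ((d t ht).nodal_strictMono hβ) ((d t ht).levelVelocity_per hL hβ)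
      (hvel t ht), ?_, ?_⟩
    · rw [← ha]; exact h1
    · rw [← ha]; exact h2
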